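/- Let $c>0$, $L>0$, and let $h_1,h_2\in\mathbb R$ with $h_1+h_2\neq 0$, $h_1\neq\pm1$, $h_2\neq\pm1$. Consider the damper–damper bar $$u_{tt}=c^2u_{xx}+p\quad(0<x<L,\ t>0),\qquad u_x(0,t)=\tfrac{h_1}{c}u_t(0,t),\quad u_x(L,t)=-\tfrac{h_2}{c}u_t(L,t),$$ $$u(x,0)=f(x),\qquad u_t(x,0)=g(x),$$ where $f,g,p$ are real, $f$ is absolutely continuous on $[0,L]$ with $f'\in L^2(0,L)$, $g\in L^2(0,L)$, and $p\in L^2((0,L)\times(0,T))$ for every $T>0$. A weak solution is a continuous function $u$ on $[0,L]\times[0,\infty)$ with $u(x,0)=f(x)$ such that for every $\varphi\in C_c^\infty(\mathbb R^2)$ $$\begin{aligned}\int_0^\infty\!\!\int_0^L u(\varphi_{tt}-c^2\varphi_{xx})\,dx\,dt={}&\int_0^\infty\!\!\int_0^L p\,\varphi\,dx\,dt+\int_0^L\bigl(g\,\varphi(x,0)-f\,\varphi_t(x,0)\bigr)dx\\&+c h_2\Bigl(f(L)\varphi(L,0)+\int_0^\infty u(L,t)\varphi_t(L,t)\,dt\Bigr)+c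 h_1\Bigl(f(0)\varphi(0,0)+\int_0^\infty u(0,t)\varphi_t(0,t)\,dt\Bigr)\\&-c^2\int_0^\infty\bigl(u(L,t)\varphi_x(L,t)-u(0,t)\varphi_x(0,t)\bigr)dt .\end{aligned}$$ Put $q=\frac{(1-h_1)(1-h_2)}{(1+h_1)(1+h_2)}$ and, for $r\in\mathbb Z$, $$\lambda_r=\frac{c}{2L}\Bigl[\ln|q|+i\bigl(\operatorname{Arg}q+2r\pi\bigr)\Bigr],\qquad u_{1,r}(x)=\cosh\frac{\lambda_r x}{c}+h_1\sinh\frac{\lambda_r x}{c},$$ with $\operatorname{Arg}$ the principal argument in $(-\pi,\pi]$. Then a weak solution exists; every classical solution (one for which $u,u_t,u_x,u_{tt},u_{xx}$ exist and are continuous on $[0,L]\times[0,\infty)$) is a weak solution; and every weak solution $u$ satisfies, for all $x\in[0,L]$ and $t\ge0$, $$\begin{aligned}u(x,t)={}&\frac{1}{c(h_1+h_2)}\Bigl[\int_0^L g(\xi)\,d\xi+c f(L)h_2+c f(0)h_1\Bigr]\\&+\frac{c f(L)h_2}{(1-h_1^2)L}\sum_{r=-\infty}^{\infty}\frac{u_{1,r}(L)u_{1,r}(x)}{\lambda_r}e^{\lambda_r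 t}+\frac{c f(0)h_1}{(1-h_1^2)L}\sum_{r=-\infty}^{\infty}\frac{u_{1,r}(0)u_{1,r}(x)}{\lambda_r}e^{\lambda_r t}\\&+\frac{1}{(1-h_1^2)L}\sum_{r=-\infty}^{\infty}\frac{u_{1,r}(x)}{\lambda_r}e^{\lambda_r t}\int_0^L u_{1,r}(\xi)\bigl[\lambda_r f(\xi)+g(\xi)\bigr]d\xi\\&+\frac{1}{c(h_1+h_2)}\int_0^t\!\!\int_0^L p(\xi,\tau)\,d\xi\,d\tau+\frac{1}{(1-h_1^2)L}\sum_{r=-\infty}^{\infty}\frac{u_{1,r}(x)}{\lambda_r}\int_0^t e^{\lambda_r(t-\tau)}\int_0^L p(\xi,\tau)u_{1,r}(\xi)\,d\xi\,d\tau,\end{aligned}$$ where each of the four series converges in the sense of symmetric partial sums $\lim_{k\to\infty}\sum_{r=-k}^{k}$. (In particular the weak solution is unique. When $h_1f(0)=0$ the two terms containing $f(0)$ vanish.) -/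

import Mathlib

open MeasureTheory Set Function
open scoped ContDiff

namespace ViscousBar

noncomputable section

/-- The eigenvalues `λ_r`, `r ∈ ℤ`:
`λ_r = (c / 2L) (ln |q| + i (Arg q + 2 r π))` with
`q = (1 - h₁)(1 - h₂) / ((1 + h₁)(1 + h₂))`. -/
def eigenvalue (c L h₁ h₂ : ℝ) (r : ℤ) : ℂ :=
  let q : ℝ := (1 - h₁) * (1 - h₂) / ((1 + h₁) * (1 + h₂))
  ((c / (2 * L) : ℝ) : ℂ) *
    ((Real.log |q| : ℂ) + Complex.I * ((Complex.arg (q : ℂ) + 2 * r * Real.pi : ℝ) : ℂ))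

/-- The eigenfunctions `u_{1,r}(x) = cosh (λ_r x / c) + h₁ sinh (λ_r x / c)`. -/
def mode (c L h₁ h₂ : ℝ) (r : ℤ) (x : ℝ) : ℂ :=
  Complex.cosh (eigenvalue c L h₁ h₂ r / c * x) +
    h₁ * Complex.sinh (eigenvalue c L h₁ h₂ r / c * x)

/-- `u` is a classical solution on `[0, L] × [0, ∞)` of
`u_tt = c² u_xx + p`, `u_x(0,t) = (h₁/c) u_t(0,t)`, `u_x(L,t) = -(h₂/c) u_t(L,t)`,
`u(x,0) = f(x)`, `u_t(x,0) = g(x)`: the derivatives `u_t, u_x, u_tt, u_xx` exist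
(one-sided at the boundary) and, together with `u`, are continuous up to the boundary. -/
def IsClassicalSolution (c L h₁ h₂ : ℝ) (f g : ℝ → ℝ) (p u : ℝ → ℝ → ℝ) : Prop :=
  ∃ ut ux utt uxx : ℝ → ℝ → ℝ,
    ContinuousOn (uncurry u) (Icc 0 L ×ˢ Ici 0) ∧
    ContinuousOn (uncurry ut) (Icc 0 L ×ˢ Ici 0) ∧
    ContinuousOn (uncurry ux) (Icc 0 L ×ˢ Ici 0) ∧
    ContinuousOn (uncurry utt) (Icc 0 L ×ˢ Ici 0) ∧
    ContinuousOn (uncurry uxx) (Icc 0 L ×ˢ Ici 0) ∧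
    (∀ x ∈ Icc 0 L, ∀ t ∈ Ici (0 : ℝ),
      HasDerivWithinAt (fun s => u x s) (ut x t) (Ici 0) t ∧
      HasDerivWithinAt (fun s => ut x s) (utt x t) (Ici 0) t ∧
      HasDerivWithinAt (fun y => u y t) (ux x t) (Icc 0 L) x ∧
      HasDerivWithinAt (fun y => ux y t) (uxx x t) (Icc 0 L) x) ∧
    (∀ x ∈ Ioo 0 L, ∀ t > 0, utt x t = c ^ 2 * uxx x t + p x t) ∧
    (∀ t > 0, ux 0 t = h₁ / c * ut 0 t) ∧
    (∀ t > 0, ux L t = -(h₂ / c) * ut L t) ∧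
    (∀ x ∈ Icc 0 L, u x 0 = f x) ∧
    (∀ x ∈ Icc 0 L, ut x 0 = g x)

/-- `u` is a (continuous) weak solution on `[0, L] × [0, ∞)` of the same initial boundary value
problem: `u` is continuous, `u(x,0) = f(x)`, and the identity obtained from the wave equation by
multiplying with a test function `φ ∈ C_c^∞(ℝ²)`, integrating over `(0, L) × (0, ∞)`, moving all
derivatives of `u` to `φ`, and inserting the boundary and the initial conditions, holds for
every such `φ`. -/
structure IsWeakSolution (c L h₁ h₂ : ℝ) (f g : ℝ → ℝ) (p u : ℝ → ℝ → ℝ) : Prop where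
  continuousOn : ContinuousOn (uncurry u) (Icc 0 L ×ˢ Ici 0)
  initial : ∀ x ∈ Icc 0 L, u x 0 = f x
  weak : ∀ φ : ℝ → ℝ → ℝ, ContDiff ℝ ∞ (uncurry φ) → HasCompactSupport (uncurry φ) →
    ∫ t in Ioi (0 : ℝ), ∫ x in (0 : ℝ)..L,
        u x t * (iteratedDeriv 2 (fun s => φ x s) t - c ^ 2 * iteratedDeriv 2 (fun y => φ y t) x)
      = (∫ t in Ioi (0 : ℝ), ∫ x in (0 : ℝ)..L, p x t * φ x t)
        + (∫ x in (0 : ℝ)..L, (g x * φ x 0 - f x * deriv (fun s => φ x s) 0))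
        + c * h₂ * (f L * φ L 0 + ∫ t in Ioi (0 : ℝ), u L t * deriv (fun s => φ L s) t)
        + c * h₁ * (f 0 * φ 0 0 + ∫ t in Ioi (0 : ℝ), u 0 t * deriv (fun s => φ 0 s) t)
        - c ^ 2 * ∫ t in Ioi (0 : ℝ),
            (u L t * deriv (fun y => φ y t) L - u 0 t * deriv (fun y => φ y t) 0)

end

end ViscousBar

/-! Write `k_r = λ_r / c` and let `q` be the product of the reflection coefficients. The numbers `2
L k_r` are the complex logarithms of `q`, so `k_r = k_0 + iπr/L`, and the functions `exp (k_r x)` on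
`[-L, L]` are the Fourier basis times the fixed weight `exp (k_0 x)`, with `exp (-k_r x)` as
biorthogonal system. A velocity `g` and a gradient `d = f'` on `[0, L]` are folded into one function
on `[-L, L]` (`profile`), whose halves are the two travelling waves; testing the data against a mode
becomes testing this function against `exp (-k_r x)` (`coeff_eq`). Parseval then gives completeness
of the modes for the velocity (`hasSum_coeff_mul_integral_mode`). Division by `k_r` integrates the
expansion: the series `potential` converges absolutely and is on `[-L, L]` a primitive of `2L` times
the profile. Its additive constant is fixed by `P (s + 2L) = q P s`, because `q ≠ 1`, and produces
the static term of the formula (`hasSum_modal_initial`).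

Existence: each mode times `exp (λ_r t)`, and each constant, solves the homogeneous problem
classically, so it satisfies the weak identity by integration by parts. Summation over `r` gives the
identity for given initial data (`weakOp_free`). A force is treated by Duhamel's principle: it is a
superposition of free vibrations started at time `τ` with velocity `p(·, τ)`, and the time shift is
moved to the test function (`weakOp_forced`).

Uniqueness: the test functions `A (t - x/c) B (t + x/c)` satisfy `φ_tt - c² φ_xx = 4 A' B'`. With
one factor equal to `1` where it matters, they give two reflection relations between the boundary
values of the difference of two solutions. Iterated over round trips of duration `2L/c`, these force
the boundary values to vanish (`boundary_eq_zero`); localized products then show that the difference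
vanishes inside (`eq_zero_of_mem_interior`).

Formula: integration by parts turns `∫ mode (λ f + g)` into a modal coefficient minus endpoint terms
(`integral_mode_mul`). The endpoint terms lead to series `∑ exp (k_r s) / k_r`, whose terms have
size `1/|r|`; they are not absolutely convergent, and symmetric partial sums are needed
(`hasSum_exp_div_freq`). -/

namespace ViscousBar

/-! ### Reflection coefficients, frequencies and modes. -/

/-- The standing assumptions on the parameters of the bar. -/
structure Admissible (c L h₁ h₂ : ℝ) : Prop where
  hc : 0 < c
  hL : 0 < L
  hsum : h₁ + h₂ ≠ 0
  h₁_ne_one : h₁ ≠ 1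
  h₁_ne_neg_one : h₁ ≠ -1
  h₂_ne_one : h₂ ≠ 1
  h₂_ne_neg_one : h₂ ≠ -1

/-- The product of the two reflection coefficients. -/
noncomputable def reflection (h₁ h₂ : ℝ) : ℝ := (1 - h₁) * (1 - h₂) / ((1 + h₁) * (1 + h₂))

/-- The spatial frequency `λ_r / c`. -/
noncomputable def freq (c L h₁ h₂ : ℝ) (r : ℤ) : ℂ := eigenvalue c L h₁ h₂ r / c

/-- The function `sinh (λ_r x / c) + h₁ cosh (λ_r x / c)`, a multiple of the derivative of the
mode. -/
noncomputable def dualMode (c L h₁ h₂ : ℝ) (r : ℤ) (x : ℝ) : ℂ :=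
  Complex.sinh (freq c L h₁ h₂ r * x) + h₁ * Complex.cosh (freq c L h₁ h₂ r * x)

variable {c L h₁ h₂ : ℝ}

/-- Right and left going exponentials are separated here because every later expansion takes place
in `exp (k_r s)`. -/
lemma mode_eq (r : ℤ) (x : ℝ) : mode c L h₁ h₂ r x =
    ((1 + h₁) * Complex.exp (freq c L h₁ h₂ r * x) +
      (1 - h₁) * Complex.exp (freq c L h₁ h₂ r * (-x : ℝ))) / 2 := by
  simp only [mode, Complex.cosh, Complex.sinh, freq]
  push_cast
  rw [mul_neg]; ring

lemma dualMode_eq (r : ℤ) (x : ℝ) : dualMode c L h₁ h₂ r x =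
    ((1 + h₁) * Complex.exp (freq c L h₁ h₂ r * x) -
      (1 - h₁) * Complex.exp (freq c L h₁ h₂ r * (-x : ℝ))) / 2 := by
  simp only [dualMode, Complex.cosh, Complex.sinh]
  push_cast
  rw [mul_neg]; ring

lemma mode_zero (r : ℤ) : mode c L h₁ h₂ r 0 = 1 := by simp [mode]

lemma dualMode_zero (r : ℤ) : dualMode c L h₁ h₂ r 0 = h₁ := by simp [dualMode]

lemma hasDerivAt_mode (r : ℤ) (x : ℝ) :
    HasDerivAt (mode c L h₁ h₂ r) (freq c L h₁ h₂ r * dualMode c L h₁ h₂ r x) x := by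
  have h0 : HasDerivAt (fun y : ℂ => freq c L h₁ h₂ r * y) (freq c L h₁ h₂ r) x := by
    simpa using (hasDerivAt_id (x : ℂ)).const_mul (freq c L h₁ h₂ r)
  have := (h0.ccosh.add (h0.csinh.const_mul (h₁ : ℂ))).comp_ofReal
  convert! this using 1
  simp only [dualMode]; ring

lemma hasDerivAt_dualMode (r : ℤ) (x : ℝ) :
    HasDerivAt (dualMode c L h₁ h₂ r) (freq c L h₁ h₂ r * mode c L h₁ h₂ r x) x := by
  have h0 : HasDerivAt (fun y : ℂ => freq c L h₁ h₂ r * y) (freq c L h₁ h₂ r) x := by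
    simpa using (hasDerivAt_id (x : ℂ)).const_mul (freq c L h₁ h₂ r)
  have := (h0.csinh.add (h0.ccosh.const_mul (h₁ : ℂ))).comp_ofReal
  convert! this using 1
  simp only [mode, freq]; ring

lemma continuous_mode (r : ℤ) : Continuous (mode c L h₁ h₂ r) :=
  continuous_iff_continuousAt.2 fun x => (hasDerivAt_mode r x).continuousAt

lemma continuous_dualMode (r : ℤ) : Continuous (dualMode c L h₁ h₂ r) :=
  continuous_iff_continuousAt.2 fun x => (hasDerivAt_dualMode r x).continuousAt

namespace Admissible

variable (H : Admissible c L h₁ h₂)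
include H

lemma one_add_h₁ : 1 + h₁ ≠ 0 := fun h => H.h₁_ne_neg_one (by linarith)
lemma one_sub_h₁ : 1 - h₁ ≠ 0 := fun h => H.h₁_ne_one (by linarith)
lemma one_add_h₂ : 1 + h₂ ≠ 0 := fun h => H.h₂_ne_neg_one (by linarith)
lemma one_sub_h₂ : 1 - h₂ ≠ 0 := fun h => H.h₂_ne_one (by linarith)

lemma reflection_ne_zero : reflection h₁ h₂ ≠ 0 :=
  div_ne_zero (mul_ne_zero H.one_sub_h₁ H.one_sub_h₂) (mul_ne_zero H.one_add_h₁ H.one_add_h₂)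

/-- `q = 1` amounts to `h₁ + h₂ = 0`. Excluding it keeps zero out of the spectrum and later
determines the static term. -/
lemma reflection_ne_one : reflection h₁ h₂ ≠ 1 := by
  intro h
  rw [reflection, div_eq_one_iff_eq (mul_ne_zero H.one_add_h₁ H.one_add_h₂)] at h
  exact H.hsum (by linarith)

lemma ofReal_c_ne : (c : ℂ) ≠ 0 := by exact_mod_cast H.hc.ne'
lemma ofReal_L_ne : (L : ℂ) ≠ 0 := by exact_mod_cast H.hL.ne'

lemma freq_eq (r : ℤ) : freq c L h₁ h₂ r =
    (Complex.log (reflection h₁ h₂) + r * (2 * Real.pi * Complex.I)) / (2 * L) := by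
  have h1 := H.ofReal_c_ne
  have h2 := H.ofReal_L_ne
  simp only [freq, eigenvalue, Complex.log, reflection]
  push_cast
  rw [show ‖((1 - h₁ : ℂ)) * (1 - h₂) / ((1 + h₁) * (1 + h₂))‖ =
    |(1 - h₁) * (1 - h₂) / ((1 + h₁) * (1 + h₂))| by
      rw [← Real.norm_eq_abs, ← Complex.norm_real]; push_cast; rfl]
  field_simp
  ring

lemma eigenvalue_eq (r : ℤ) : eigenvalue c L h₁ h₂ r = c * freq c L h₁ h₂ r := by
  rw [freq, mul_div_cancel₀ _ H.ofReal_c_ne]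

/-- The characteristic equation: one round trip through the bar multiplies an exponential by `q`. -/
lemma exp_freq (r : ℤ) : Complex.exp (2 * L * freq c L h₁ h₂ r) = (reflection h₁ h₂ : ℝ) := by
  rw [H.freq_eq, mul_div_cancel₀ _ (mul_ne_zero two_ne_zero H.ofReal_L_ne), Complex.exp_add,
    Complex.exp_int_mul_two_pi_mul_I, mul_one,
    Complex.exp_log (by exact_mod_cast H.reflection_ne_zero)]

lemma freq_ne_zero (r : ℤ) : freq c L h₁ h₂ r ≠ 0 := by
  intro h
  have := H.exp_freq r
  rw [h, mul_zero, Complex.exp_zero] at this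
  exact H.reflection_ne_one (by exact_mod_cast this.symm)

lemma eigenvalue_ne_zero (r : ℤ) : eigenvalue c L h₁ h₂ r ≠ 0 := by
  rw [H.eigenvalue_eq]; exact mul_ne_zero H.ofReal_c_ne (H.freq_ne_zero r)

/-- Logarithms of the same number differ by imaginary multiples, so all frequencies lie on one
vertical line and `‖exp (k_r x)‖` does not depend on `r`. -/
lemma freq_re (r : ℤ) : (freq c L h₁ h₂ r).re = (freq c L h₁ h₂ 0).re := by
  rw [H.freq_eq, H.freq_eq]
  rw [show (2 * (L:ℂ)) = ((2 * L : ℝ) : ℂ) by push_cast; ring, Complex.div_ofReal_re,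
    Complex.div_ofReal_re]
  simp

lemma freq_im (r : ℤ) :
    (freq c L h₁ h₂ r).im = (Complex.arg (reflection h₁ h₂) + 2 * Real.pi * r) / (2 * L) := by
  rw [H.freq_eq]
  rw [show (2 * (L:ℂ)) = ((2 * L : ℝ) : ℂ) by push_cast; ring, Complex.div_ofReal_im]
  simp [Complex.log_im]
  ring

lemma norm_exp_freq (r : ℤ) (x : ℝ) :
    ‖Complex.exp (freq c L h₁ h₂ r * x)‖ = Real.exp ((freq c L h₁ h₂ 0).re * x) := by
  rw [Complex.norm_exp, Complex.re_mul_ofReal, H.freq_re]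

lemma norm_exp_freq_le (r : ℤ) {x R : ℝ} (hx : |x| ≤ R) :
    ‖Complex.exp (freq c L h₁ h₂ r * x)‖ ≤ Real.exp (|(freq c L h₁ h₂ 0).re| * R) := by
  rw [H.norm_exp_freq]
  apply Real.exp_le_exp.2
  calc _ ≤ |(freq c L h₁ h₂ 0).re * x| := le_abs_self _
    _ = |(freq c L h₁ h₂ 0).re| * |x| := abs_mul _ _
    _ ≤ _ := by gcongr

lemma mode_mul_exp (r : ℤ) (x t : ℝ) :
    mode c L h₁ h₂ r x * Complex.exp (eigenvalue c L h₁ h₂ r * t) =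
    ((1 + h₁) * Complex.exp (freq c L h₁ h₂ r * (c * t + x : ℝ)) +
      (1 - h₁) * Complex.exp (freq c L h₁ h₂ r * (c * t - x : ℝ))) / 2 := by
  rw [mode_eq, H.eigenvalue_eq]
  push_cast
  rw [mul_add (freq c L h₁ h₂ r), mul_sub, Complex.exp_add, Complex.exp_sub, mul_neg,
    Complex.exp_neg, ← mul_assoc (freq c L h₁ h₂ r), mul_comm (freq c L h₁ h₂ r) (c : ℂ)]
  ring

/-- The boundary condition of the mode at `x = L`, obtained from the characteristic equation; the
one at `x = 0` is built into the form of the mode. -/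
lemma dualMode_L (r : ℤ) : dualMode c L h₁ h₂ r L = -h₂ * mode c L h₁ h₂ r L := by
  have h := H.exp_freq r
  have h1 : (1 + h₁ : ℂ) ≠ 0 := by exact_mod_cast H.one_add_h₁
  have h2 : (1 + h₂ : ℂ) ≠ 0 := by exact_mod_cast H.one_add_h₂
  rw [dualMode_eq, mode_eq]
  have h3 : Complex.exp (freq c L h₁ h₂ r * L) =
      (reflection h₁ h₂ : ℝ) * Complex.exp (freq c L h₁ h₂ r * (-L : ℝ)) := by
    rw [← h, ← Complex.exp_add]; congr 1; push_cast; ring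
  rw [h3, reflection]
  push_cast
  field_simp
  ring

lemma exists_norm_mode_le : ∃ K : ℝ, 0 < K ∧ ∀ r : ℤ, ∀ x ∈ Icc 0 L,
    ‖mode c L h₁ h₂ r x‖ ≤ K ∧ ‖dualMode c L h₁ h₂ r x‖ ≤ K := by
  set E := Real.exp (|(freq c L h₁ h₂ 0).re| * L) with hE
  have hE0 : 0 < E := Real.exp_pos _
  refine ⟨(‖(1 + h₁ : ℂ)‖ + ‖(1 - h₁ : ℂ)‖) * E + 1, by positivity, fun r x hx => ?_⟩
  have e1 := H.norm_exp_freq_le r (x := x) (R := L) (abs_le.2 ⟨by linarith [hx.1, H.hL], hx.2⟩)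
  have e2 := H.norm_exp_freq_le r (x := -x) (R := L) (abs_le.2 ⟨by linarith [hx.2], by linarith [hx.1, H.hL]⟩)
  rw [← hE] at e1 e2
  have hb : ∀ a b : ℂ, ‖a‖ ≤ ‖(1 + h₁ : ℂ)‖ * E → ‖b‖ ≤ ‖(1 - h₁ : ℂ)‖ * E →
      ‖(a + b) / 2‖ ≤ (‖(1 + h₁ : ℂ)‖ + ‖(1 - h₁ : ℂ)‖) * E + 1 := by
    intro a b ha hb
    rw [norm_div, Complex.norm_ofNat]
    have := norm_add_le a b
    have := norm_nonneg (a + b)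
    linarith
  constructor
  · rw [mode_eq]
    refine hb _ _ ?_ ?_ <;> rw [norm_mul] <;> gcongr
  · rw [dualMode_eq, sub_eq_add_neg]
    refine hb _ _ ?_ ?_
    · rw [norm_mul]; gcongr
    · rw [norm_neg, norm_mul]; gcongr

/-- The imaginary parts form an arithmetic progression of step `π / L`, so `‖k_r‖` grows linearly.
-/
lemma summable_inv_norm_freq_sq : Summable fun r : ℤ => (‖freq c L h₁ h₂ r‖ ^ 2)⁻¹ := by
  have hL := H.hL
  have hpi := Real.pi_pos
  set A := Complex.arg (reflection h₁ h₂) / (2 * Real.pi) with hA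
  have hs : Summable fun r : ℤ => 1 / |(r : ℝ) + A| ^ (2 : ℝ) :=
    (Real.summable_one_div_int_add_rpow A 2).2 one_lt_two
  refine Summable.of_norm_bounded_eventually (hs.mul_left ((L / Real.pi) ^ 2)) ?_
  -- Where `r + A = 0` the imaginary part gives no lower bound; this concerns at most one index.
  have hfin : {r : ℤ | (r : ℝ) + A = 0}.Finite := by
    refine Set.Subsingleton.finite fun a ha b hb => ?_
    have : (a : ℝ) = b := by simp only [mem_ofPred_eq] at ha hb; linarith
    exact_mod_cast this
  filter_upwards [hfin.compl_mem_cofinite] with r hr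
  have hr : (r : ℝ) + A ≠ 0 := hr
  have him : (freq c L h₁ h₂ r).im = (Real.pi / L) * (r + A) := by
    rw [H.freq_im, hA]; field_simp; ring
  have h1 : (Real.pi / L * |r + A|) ≤ ‖freq c L h₁ h₂ r‖ := by
    have := Complex.abs_im_le_norm (freq c L h₁ h₂ r)
    rwa [him, abs_mul, abs_of_pos (div_pos hpi hL)] at this
  have h2 : 0 < |(r : ℝ) + A| := abs_pos.2 hr
  have h3 : (L / Real.pi) ^ 2 * (1 / |(r : ℝ) + A| ^ (2 : ℝ)) = ((Real.pi / L * |r + A|) ^ 2)⁻¹ := by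
    rw [Real.rpow_two]; field_simp
  rw [h3, Real.norm_of_nonneg (by positivity)]
  gcongr

end Admissible

end ViscousBar

/-! ### Conditionally convergent exponential series. -/

namespace ViscousBar

open Filter Topology

lemma _root_.HasSum.symmetricIcc {E : Type*} [AddCommMonoid E] [TopologicalSpace E] {f : ℤ → E}
    {a : E} (h : HasSum f a) : HasSum f a (SummationFilter.symmetricIcc ℤ) :=
  h.mono_left (SummationFilter.LeAtTop.le_atTop (L := SummationFilter.symmetricIcc ℤ))

lemma sum_Icc_neg_eq_add_sum_range {E : Type*} [AddCommGroup E] (f : ℤ → E) (N : ℕ) :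
    ∑ r ∈ Finset.Icc (-(N : ℤ)) N, f r =
      f 0 + ∑ n ∈ Finset.range N, (f ((n : ℤ) + 1) + f (-((n : ℤ) + 1))) := by
  induction N with
  | zero => simp
  | succ N ih =>
    rw [Nat.cast_succ, Finset.sum_Icc_succ_eq_add_endpoints, ih, Finset.sum_range_succ]
    abel

/-- Dirichlet's test: for `z ≠ 1` the geometric sums are bounded, and `1 / (n + 1)` decreases to
zero. -/
lemma tendsto_sum_pow_div {z : ℂ} (hz : ‖z‖ = 1) (h1 : z ≠ 1) :
    ∃ S, Tendsto (fun N => ∑ n ∈ Finset.range N, z ^ (n + 1) / ((n : ℂ) + 1)) atTop (𝓝 S) := by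
  have ha : Antitone fun n : ℕ => 1 / ((n : ℝ) + 1) := fun a b h => by
    dsimp only; gcongr
  have hb : ∀ n, ‖∑ i ∈ Finset.range n, z ^ (i + 1)‖ ≤ 2 / ‖z - 1‖ := by
    intro n
    have h0 : 0 < ‖z - 1‖ := norm_pos_iff.2 (sub_ne_zero.2 h1)
    have : ∑ i ∈ Finset.range n, z ^ (i + 1) = z * ((z ^ n - 1) / (z - 1)) := by
      rw [← geom_sum_eq h1, Finset.mul_sum]
      exact Finset.sum_congr rfl fun i _ => by ring
    rw [this, norm_mul, hz, one_mul, norm_div]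
    gcongr
    calc ‖z ^ n - 1‖ ≤ ‖z ^ n‖ + ‖(1 : ℂ)‖ := norm_sub_le _ _
      _ = 2 := by rw [norm_pow, hz]; norm_num
  have := ha.cauchySeq_series_mul_of_tendsto_zero_of_bounded
    (tendsto_one_div_add_atTop_nhds_zero_nat) hb
  obtain ⟨S, hS⟩ := cauchySeq_tendsto_of_complete this
  refine ⟨S, hS.congr fun N => Finset.sum_congr rfl fun n _ => ?_⟩
  rw [Complex.real_smul]
  push_cast
  ring

/-- For `z = 1` both half series diverge and only the cancellation of `r` against `-r` helps;
otherwise each half converges by Dirichlet's test. -/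
lemma hasSum_zpow_div_symmetricIcc {z : ℂ} (hz : ‖z‖ = 1) :
    ∃ S, HasSum (fun r : ℤ => z ^ r / (r : ℂ)) S (SummationFilter.symmetricIcc ℤ) := by
  by_cases h1 : z = 1
  · refine ⟨0, ?_⟩
    rw [SummationFilter.hasSum_symmetricIcc_iff]
    refine tendsto_const_nhds.congr fun N => ?_
    rw [sum_Icc_neg_eq_add_sum_range]
    symm
    -- The index `r = 0` contributes nothing, since division by zero yields `0`.
    simp only [h1, one_zpow, Int.cast_zero, div_zero, zero_add]
    refine Finset.sum_eq_zero fun n _ => ?_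
    push_cast
    rw [div_neg, add_neg_cancel]
  · have hz0 : z ≠ 0 := fun h => by simp [h] at hz
    obtain ⟨S, hS⟩ := tendsto_sum_pow_div hz h1
    obtain ⟨S', hS'⟩ := tendsto_sum_pow_div (z := z⁻¹) (by rw [norm_inv, hz, inv_one])
      (fun h => h1 (inv_eq_one.1 h))
    refine ⟨S - S', ?_⟩
    rw [SummationFilter.hasSum_symmetricIcc_iff]
    refine (hS.sub hS').congr fun N => ?_
    rw [sum_Icc_neg_eq_add_sum_range, ← Finset.sum_sub_distrib]
    simp only [Int.cast_zero, div_zero, zero_add]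
    refine Finset.sum_congr rfl fun n _ => ?_
    rw [zpow_neg, show ((n : ℤ) + 1) = ((n + 1 : ℕ) : ℤ) by push_cast; rfl, zpow_natCast, inv_pow]
    push_cast
    rw [div_neg, sub_eq_add_neg]

variable {c L h₁ h₂ : ℝ}

namespace Admissible

variable (H : Admissible c L h₁ h₂)
include H

lemma freq_eq_add (r : ℤ) : freq c L h₁ h₂ r = freq c L h₁ h₂ 0 + Real.pi / L * Complex.I * r := by
  have := H.ofReal_L_ne
  rw [H.freq_eq, H.freq_eq]
  field_simp
  push_cast
  ring

/-- The series `∑ exp (k_r s) / k_r` converges in the sense of symmetric partial sums. -/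
lemma hasSum_exp_div_freq (s : ℝ) :
    ∃ S, HasSum (fun r : ℤ => Complex.exp (freq c L h₁ h₂ r * s) / freq c L h₁ h₂ r) S
      (SummationFilter.symmetricIcc ℤ) := by
  have hL := H.hL
  have hpi := Real.pi_pos
  have hpi' : (Real.pi : ℂ) ≠ 0 := by exact_mod_cast hpi.ne'
  have hL' := H.ofReal_L_ne
  set ν := freq c L h₁ h₂ 0 with hν
  set z : ℂ := Complex.exp ((Real.pi / L * s : ℝ) * Complex.I) with hz
  obtain ⟨S, hS⟩ := hasSum_zpow_div_symmetricIcc (z := z) (by rw [hz, Complex.norm_exp_ofReal_mul_I])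
  have hexp : ∀ r : ℤ, Complex.exp (freq c L h₁ h₂ r * s) = Complex.exp (ν * s) * z ^ r := by
    intro r
    rw [hz, ← Complex.exp_int_mul, ← Complex.exp_add, H.freq_eq_add]
    congr 1; push_cast; ring
  -- Comparison of `1 / k_r` with `L / (π i r)`: the difference is of order `1 / r²`, hence
  -- absolutely summable, and what remains is the series `∑ z ^ r / r`.
  have hsum : Summable fun r : ℤ => Complex.exp (freq c L h₁ h₂ r * s) *
      (1 / freq c L h₁ h₂ r - (L / (Real.pi * Complex.I)) / r) := by
    have hr : Summable fun r : ℤ => (1 : ℝ) / (r : ℝ) ^ 2 :=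
      Real.summable_one_div_int_pow.2 one_lt_two
    have hb := (H.summable_inv_norm_freq_sq.add hr).mul_left
      (Real.exp (ν.re * s) * (‖ν‖ * (L / Real.pi)))
    refine Summable.of_norm_bounded_eventually hb ?_
    filter_upwards [(Set.finite_singleton (0 : ℤ)).compl_mem_cofinite] with r hr0
    have hr0 : (r : ℂ) ≠ 0 := by exact_mod_cast hr0
    rw [norm_mul, H.norm_exp_freq, mul_assoc]
    refine mul_le_mul_of_nonneg_left ?_ (Real.exp_pos _).le
    have h0 := H.freq_ne_zero r
    have : 1 / freq c L h₁ h₂ r - (L / (Real.pi * Complex.I)) / r =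
        -(ν * (L / Real.pi)) * ((1 / freq c L h₁ h₂ r) * (1 / (Complex.I * r))) := by
      have h2 := H.freq_eq_add r
      have : ν = freq c L h₁ h₂ r - Real.pi / L * Complex.I * r := by rw [h2]; ring
      rw [this]
      field_simp
      ring
    rw [this, norm_mul, norm_neg]
    have e1 : ‖ν * (L / Real.pi : ℂ)‖ = ‖ν‖ * (L / Real.pi) := by
      rw [norm_mul, ← Complex.ofReal_div, Complex.norm_real, Real.norm_of_nonneg (by positivity)]
    rw [e1]
    refine mul_le_mul_of_nonneg_left ?_ (by positivity)
    rw [norm_mul]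
    have e2 : ‖1 / freq c L h₁ h₂ r‖ ^ 2 = (‖freq c L h₁ h₂ r‖ ^ 2)⁻¹ := by
      rw [norm_div, norm_one, div_pow, one_pow, one_div]
    have e3 : ‖1 / (Complex.I * r)‖ ^ 2 = 1 / (r : ℝ) ^ 2 := by
      rw [norm_div, norm_one, norm_mul, Complex.norm_I, one_mul, div_pow, one_pow,
        Complex.norm_intCast, sq_abs]
    rw [← e2, ← e3]
    nlinarith [sq_nonneg (‖1 / freq c L h₁ h₂ r‖ - ‖1 / (Complex.I * r)‖),
      sq_nonneg ‖1 / freq c L h₁ h₂ r‖, sq_nonneg ‖1 / (Complex.I * r)‖]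
  refine ⟨_, ((hS.mul_left (Complex.exp (ν * s) * (L / (Real.pi * Complex.I)))).add
    hsum.hasSum.symmetricIcc).congr_fun fun r => ?_⟩
  rw [hexp]
  ring

end Admissible

end ViscousBar

/-! ### Fourier analysis on `[-L, L]` and biorthogonal exponentials. -/

namespace ViscousBar

open Filter Topology

/-- The polarized Parseval identity on an interval. -/
lemma hasSum_conj_fourierCoeffOn_mul {a b : ℝ} {F G : ℝ → ℂ} (hab : a < b)
    (hF : MemLp F 2 (volume.restrict (Ioc a b))) (hG : MemLp G 2 (volume.restrict (Ioc a b))) :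
    HasSum (fun i => fourierCoeffOn hab G i * (starRingEnd ℂ) (fourierCoeffOn hab F i))
      ((b - a)⁻¹ • ∫ x in a..b, G x * (starRingEnd ℂ) (F x)) := by
  have := Fact.mk (by linarith : 0 < b - a)
  -- The endpoint `b` is written as `a + (b - a)` to match the circle of length `b - a`.
  rw [← add_sub_cancel a b] at hF hG
  have hF' := hF.memLp_liftIoc.haarAddCircle
  have hG' := hG.memLp_liftIoc.haarAddCircle
  convert! fourierBasis.hasSum_inner_mul_inner hF'.toLp hG'.toLp using 1
  · ext i
    rw [← inner_conj_symm hF'.toLp, ← HilbertBasis.repr_apply_apply, ← HilbertBasis.repr_apply_apply,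
      fourierBasis_repr, fourierBasis_repr, fourierCoeff_congr_ae hF'.coeFn_toLp,
      fourierCoeff_congr_ae hG'.coeFn_toLp, mul_comm]
    simp [fourierCoeff_liftIoc_eq]
  · nth_rw 2 [← add_sub_cancel a b]
    rw [L2.inner_def]
    have := AddCircle.integral_liftIoc_eq_intervalIntegral (T := b - a) (t := a)
      (f := fun x => G x * (starRingEnd ℂ) (F x))
    rw [← this, ← AddCircle.integral_haarAddCircle]
    apply integral_congr_ae
    filter_upwards [hF'.coeFn_toLp, hG'.coeFn_toLp] with x hx hy
    rw [hx, hy]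
    rfl

lemma _root_.MeasureTheory.MemLp.continuous_mul_Ioc {a b : ℝ} {F G : ℝ → ℂ} (hF : Continuous F)
    (hG : MemLp G 2 (volume.restrict (Ioc a b))) :
    MemLp (fun x => F x * G x) 2 (volume.restrict (Ioc a b)) := by
  obtain ⟨C, hC⟩ := isCompact_Icc.exists_bound_of_continuousOn (s := Icc a b) hF.continuousOn
  refine hG.of_le_mul (c := C) (hF.aestronglyMeasurable.mul hG.1) ?_
  filter_upwards [ae_restrict_mem measurableSet_Ioc] with x hx
  rw [norm_mul]
  gcongr
  exact hC x (Ioc_subset_Icc_self hx)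

lemma _root_.MeasureTheory.MemLp.intervalIntegrable {a b : ℝ} {E : Type*} [NormedAddCommGroup E]
    {F : ℝ → E} (hab : a ≤ b) (hF : MemLp F 2 (volume.restrict (Ioc a b))) :
    IntervalIntegrable F volume a b := by
  rw [intervalIntegrable_iff_integrableOn_Ioc_of_le hab]
  exact hF.integrable one_le_two

/-- The function equal to `u` on the positive half line and to `x ↦ v (-x)` on the rest. -/
noncomputable def glue (u v : ℝ → ℝ) (x : ℝ) : ℝ := if 0 < x then u x else v (-x)

lemma memLp_comp_neg {L : ℝ} {v : ℝ → ℝ} (hv : MemLp v 2 (volume.restrict (Ioc 0 L))) :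
    MemLp (fun x => v (-x)) 2 (volume.restrict (Ioc (-L) 0)) := by
  have h1 : volume.restrict (Ioc (-L) 0) = volume.restrict (Ico (-L) 0) :=
    Measure.restrict_congr_set Ico_ae_eq_Ioc.symm
  have h2 : (fun x : ℝ => -x) ⁻¹' (Ioc 0 L) = Ico (-L) 0 := by simp
  have := (Measure.measurePreserving_neg (volume : Measure ℝ)).restrict_preimage
    (measurableSet_Ioc (a := 0) (b := L))
  rw [show (Neg.neg : ℝ → ℝ) ⁻¹' (Ioc 0 L) = Ico (-L) 0 from h2, ← h1] at this
  exact hv.comp_measurePreserving this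

lemma memLp_glue {L : ℝ} (hL : 0 < L) {u v : ℝ → ℝ} (hu : MemLp u 2 (volume.restrict (Ioc 0 L)))
    (hv : MemLp v 2 (volume.restrict (Ioc 0 L))) :
    MemLp (fun x => (glue u v x : ℂ)) 2 (volume.restrict (Ioc (-L) L)) := by
  have e : glue u v = (Ioi 0).indicator u + (Iic 0).indicator (fun x => v (-x)) := by
    ext x
    by_cases hx : 0 < x
    · simp [glue, hx, not_le.2 hx]
    · simp [glue, hx, not_lt.1 hx]
  have : MemLp (glue u v) 2 (volume.restrict (Ioc (-L) L)) := by
    rw [e]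
    refine MemLp.add ?_ ?_
    · rw [memLp_indicator_iff_restrict measurableSet_Ioi, Measure.restrict_restrict measurableSet_Ioi]
      rwa [show Ioi 0 ∩ Ioc (-L) L = Ioc 0 L by
        ext x; simp only [mem_inter_iff, mem_Ioi, mem_Ioc]; constructor
        · rintro ⟨a, b, d⟩; exact ⟨a, d⟩
        · rintro ⟨a, b⟩; exact ⟨a, by linarith, b⟩]
    · rw [memLp_indicator_iff_restrict measurableSet_Iic, Measure.restrict_restrict measurableSet_Iic]
      rw [show Iic 0 ∩ Ioc (-L) L = Ioc (-L) 0 by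
        ext x; simp only [mem_inter_iff, mem_Iic, mem_Ioc]; constructor
        · rintro ⟨a, b, d⟩; exact ⟨b, a⟩
        · rintro ⟨a, b⟩; exact ⟨b, a, by linarith⟩]
      exact memLp_comp_neg hv
  exact this.ofReal

/-- The condition on `F` asks for square integrability of each half separately, so that `F` may be
an exponential as well as another glued function. -/
lemma integral_mul_glue {L : ℝ} (hL : 0 < L) {u v : ℝ → ℝ}
    (hu : MemLp u 2 (volume.restrict (Ioc 0 L))) (hv : MemLp v 2 (volume.restrict (Ioc 0 L)))
    {F : ℝ → ℂ} (hF : ∃ u' v' : ℝ → ℂ, MemLp u' 2 (volume.restrict (Ioc 0 L)) ∧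
      MemLp v' 2 (volume.restrict (Ioc 0 L)) ∧ (∀ x, 0 < x → F x = u' x) ∧
      (∀ x, 0 < x → F (-x) = v' x)) :
    ∫ x in -L..L, F x * glue u v x = ∫ x in 0..L, (F x * u x + F (-x) * v x) := by
  obtain ⟨u', v', hu', hv', h1, h2⟩ := hF
  have hR : IntervalIntegrable (fun x => F x * (u x : ℂ)) volume 0 L := by
    rw [intervalIntegrable_iff_integrableOn_Ioc_of_le hL.le]
    refine (hu'.integrable_mul hu.ofReal).congr ?_
    filter_upwards [ae_restrict_mem measurableSet_Ioc] with x hx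
    simp [h1 x hx.1]
  have hN : IntervalIntegrable (fun x => F (-x) * (v x : ℂ)) volume 0 L := by
    rw [intervalIntegrable_iff_integrableOn_Ioc_of_le hL.le]
    refine (hv'.integrable_mul hv.ofReal).congr ?_
    filter_upwards [ae_restrict_mem measurableSet_Ioc] with x hx
    simp [h2 x hx.1]
  have e1 : ∀ᵐ x, x ∈ uIoc 0 L → F x * (u x : ℂ) = F x * glue u v x := by
    refine ae_of_all _ fun x hx => ?_
    rw [uIoc_of_le hL.le] at hx
    simp [glue, hx.1]
  have e2 : ∀ᵐ x, x ∈ uIoc (-L) 0 → F x * (v (-x) : ℂ) = F x * glue u v x := by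
    refine ae_of_all _ fun x hx => ?_
    rw [uIoc_of_le (by linarith)] at hx
    simp [glue, not_lt.2 hx.2]
  have hN' : IntervalIntegrable (fun x => F x * (v (-x) : ℂ)) volume (-L) 0 := by
    have := (IntervalIntegrable.iff_comp_neg (f := fun x => F (-x) * (v x : ℂ)) enorm_ne_top).1 hN |>.symm
    simpa using this
  rw [← intervalIntegral.integral_add_adjacent_intervals (b := 0)
    (hN'.congr_ae ((ae_restrict_iff' measurableSet_uIoc).2 e2))
    (hR.congr_ae ((ae_restrict_iff' measurableSet_uIoc).2 e1)),
    ← intervalIntegral.integral_congr_ae e1, ← intervalIntegral.integral_congr_ae e2,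
    intervalIntegral.integral_add hR hN, add_comm]
  congr 1
  have := intervalIntegral.integral_comp_neg (a := 0) (b := L) (fun x => F x * (v (-x) : ℂ))
  simp only [neg_neg, neg_zero] at this
  exact this.symm

variable {c L h₁ h₂ : ℝ}

/-- The integral of `exp (-k_r x) γ x` over `[-L, L]`. -/
noncomputable def transform (c L h₁ h₂ : ℝ) (γ : ℝ → ℂ) (r : ℤ) : ℂ :=
  ∫ x in -L..L, Complex.exp (freq c L h₁ h₂ r * (-x : ℝ)) * γ x

namespace Admissible

variable (H : Admissible c L h₁ h₂)
include H

lemma neg_L_lt : -L < L := by linarith [H.hL]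

/-- `exp (-k_r x)` is the weight `exp (-k_0 x)` times the character `exp (-iπrx/L)`; the weight is
absorbed into the function. -/
lemma transform_eq (γ : ℝ → ℂ) (r : ℤ) : transform c L h₁ h₂ γ r = 2 * L *
    fourierCoeffOn H.neg_L_lt (fun x => Complex.exp (freq c L h₁ h₂ 0 * (-x : ℝ)) * γ x) r := by
  have hL := H.ofReal_L_ne
  rw [fourierCoeffOn_eq_integral, Complex.real_smul, ← mul_assoc]
  have : 2 * (L : ℂ) * ((1 / (L - -L) : ℝ) : ℂ) = 1 := by
    push_cast; field_simp; ring
  rw [this, one_mul]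
  refine intervalIntegral.integral_congr fun x _ => ?_
  simp only [smul_eq_mul]
  rw [← mul_assoc, fourier_coe_apply, ← Complex.exp_add, H.freq_eq_add r]
  congr 2
  push_cast
  field_simp
  ring

/-- Here the character has the opposite sign, hence the two conjugations; this is the shape in which
the polarized Parseval identity takes its second factor. -/
lemma integral_exp_freq_eq (ψ : ℝ → ℂ) (r : ℤ) :
    ∫ x in -L..L, Complex.exp (freq c L h₁ h₂ r * x) * ψ x = 2 * L *
    (starRingEnd ℂ) (fourierCoeffOn H.neg_L_lt
      (fun x => (starRingEnd ℂ) (Complex.exp (freq c L h₁ h₂ 0 * x) * ψ x)) r) := by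
  have hL := H.ofReal_L_ne
  rw [fourierCoeffOn_eq_integral, Complex.real_smul, map_mul, Complex.conj_ofReal, ← mul_assoc]
  have : 2 * (L : ℂ) * ((1 / (L - -L) : ℝ) : ℂ) = 1 := by
    push_cast; field_simp; ring
  rw [this, one_mul, intervalIntegral.integral_of_le H.neg_L_lt.le,
    intervalIntegral.integral_of_le H.neg_L_lt.le, ← integral_conj]
  refine integral_congr_ae (ae_of_all _ fun x => ?_)
  simp only [smul_eq_mul, map_mul, Complex.conj_conj]
  rw [← mul_assoc, fourier_neg, Complex.conj_conj, fourier_coe_apply, ← Complex.exp_add,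
    H.freq_eq_add r]
  congr 2
  push_cast
  field_simp
  ring

/-- Biorthogonal expansion with respect to the exponentials `exp (k_r x)` on `[-L, L]`. -/
lemma hasSum_transform_mul {γ ψ : ℝ → ℂ} (hγ : MemLp γ 2 (volume.restrict (Ioc (-L) L)))
    (hψ : MemLp ψ 2 (volume.restrict (Ioc (-L) L))) :
    HasSum (fun r : ℤ => transform c L h₁ h₂ γ r *
      ∫ x in -L..L, Complex.exp (freq c L h₁ h₂ r * x) * ψ x) (2 * L * ∫ x in -L..L, γ x * ψ x) := by
  have hL := H.ofReal_L_ne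
  have h1 := hγ.continuous_mul_Ioc (F := fun x => Complex.exp (freq c L h₁ h₂ 0 * (-x : ℝ)))
    (by fun_prop)
  have h2 := hψ.continuous_mul_Ioc (F := fun x => Complex.exp (freq c L h₁ h₂ 0 * x))
    (by fun_prop)
  have h2' : MemLp (fun x : ℝ => (starRingEnd ℂ) (Complex.exp (freq c L h₁ h₂ 0 * x) * ψ x)) 2
      (volume.restrict (Ioc (-L) L)) := h2.star
  have := (hasSum_conj_fourierCoeffOn_mul H.neg_L_lt h2' h1).mul_left ((2 * L) * (2 * L) : ℂ)
  convert! this using 1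
  · ext r
    rw [H.transform_eq, H.integral_exp_freq_eq]
    ring
  · rw [Complex.real_smul, ← mul_assoc]
    have : (2 * L * (2 * L) : ℂ) * (((L - -L)⁻¹ : ℝ) : ℂ) = 2 * L := by
      push_cast; field_simp; ring
    rw [this]
    congr 1
    refine intervalIntegral.integral_congr fun x _ => ?_
    simp only [Complex.conj_conj]
    -- The weights of the two factors are inverse to each other, so Parseval leaves the unweighted
    -- integral of `γ ψ`.
    have : Complex.exp (freq c L h₁ h₂ 0 * (-x : ℝ)) * Complex.exp (freq c L h₁ h₂ 0 * x) = 1 := by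
      rw [← Complex.exp_add]; simp
    linear_combination (-γ x * ψ x) * this

/-- Bessel's inequality for the weighted function; the weight is at most `E` on `[-L, L]`, and the
factor `(2L)²` meets the normalization `1 / (2L)`. -/
lemma exists_sum_norm_transform_sq_le : ∃ K : ℝ, 0 < K ∧ ∀ γ : ℝ → ℂ,
    MemLp γ 2 (volume.restrict (Ioc (-L) L)) → ∀ s : Finset ℤ,
    ∑ r ∈ s, ‖transform c L h₁ h₂ γ r‖ ^ 2 ≤ K * ∫ x in -L..L, ‖γ x‖ ^ 2 := by
  have hL := H.hL
  set E := Real.exp (|(freq c L h₁ h₂ 0).re| * L) with hE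
  have hE0 : 0 < E := Real.exp_pos _
  refine ⟨2 * L * E ^ 2, by positivity, fun γ hγ s => ?_⟩
  have h1 := hγ.continuous_mul_Ioc (F := fun x => Complex.exp (freq c L h₁ h₂ 0 * (-x : ℝ)))
    (by fun_prop)
  have h2 := hasSum_sq_fourierCoeffOn H.neg_L_lt h1
  have h3 := sum_le_hasSum s (fun i _ => sq_nonneg _) h2
  have h4 : ∑ r ∈ s, ‖transform c L h₁ h₂ γ r‖ ^ 2 = (2 * L) ^ 2 * ∑ r ∈ s,
      ‖fourierCoeffOn H.neg_L_lt (fun x => Complex.exp (freq c L h₁ h₂ 0 * (-x : ℝ)) * γ x) r‖ ^ 2 := by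
    rw [Finset.mul_sum]
    refine Finset.sum_congr rfl fun r _ => ?_
    rw [H.transform_eq, norm_mul, mul_pow]
    congr 2
    simp [abs_of_pos hL]
  rw [h4]
  have h5 : ∫ x in -L..L, ‖Complex.exp (freq c L h₁ h₂ 0 * (-x : ℝ)) * γ x‖ ^ 2 ≤
      E ^ 2 * ∫ x in -L..L, ‖γ x‖ ^ 2 := by
    rw [← intervalIntegral.integral_const_mul]
    refine intervalIntegral.integral_mono_on H.neg_L_lt.le ?_ ?_ fun x hx => ?_
    · rw [intervalIntegrable_iff_integrableOn_Ioc_of_le H.neg_L_lt.le]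
      exact h1.integrable_norm_pow two_ne_zero
    · refine IntervalIntegrable.const_mul ?_ _
      rw [intervalIntegrable_iff_integrableOn_Ioc_of_le H.neg_L_lt.le]
      exact hγ.integrable_norm_pow two_ne_zero
    · rw [norm_mul, mul_pow]
      gcongr
      exact H.norm_exp_freq_le 0 (abs_le.2 ⟨by linarith [hx.2], by linarith [hx.1]⟩)
  calc _ ≤ (2 * L) ^ 2 * ((L - -L)⁻¹ * (E ^ 2 * ∫ x in -L..L, ‖γ x‖ ^ 2)) := by
        refine mul_le_mul_of_nonneg_left (h3.trans ?_) (by positivity)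
        rw [smul_eq_mul]
        refine mul_le_mul_of_nonneg_left h5 (inv_nonneg.2 (by linarith))
    _ = _ := by field_simp; ring

end Admissible

end ViscousBar

/-! ### Modal coefficients, completeness, and the modal series at time zero. -/

namespace ViscousBar

open Filter Topology

variable {c L h₁ h₂ : ℝ}

/-- The modal coefficient of the velocity `g` and the displacement gradient `d`. -/
noncomputable def coeff (c L h₁ h₂ : ℝ) (g d : ℝ → ℝ) (r : ℤ) : ℂ :=
  ∫ ξ in 0..L, (mode c L h₁ h₂ r ξ * g ξ - c * (dualMode c L h₁ h₂ r ξ * d ξ))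

/-- The travelling wave profile on `[-L, L]` generated by velocity `g` and gradient `d`. -/
noncomputable def profile (c h₁ : ℝ) (g d : ℝ → ℝ) : ℝ → ℝ :=
  glue (fun x => (g x + c * d x) / 2) (fun x => (1 + h₁) / (1 - h₁) * ((g x - c * d x) / 2))

/-- `∑ a_r exp (k_r s) / k_r`, with `a_r` the transform of `γ`. -/
noncomputable def potential (c L h₁ h₂ : ℝ) (γ : ℝ → ℂ) (s : ℝ) : ℂ :=
  ∑' r : ℤ, transform c L h₁ h₂ γ r / freq c L h₁ h₂ r * Complex.exp (freq c L h₁ h₂ r * s)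

namespace Admissible

variable (H : Admissible c L h₁ h₂)
include H

omit H in
lemma memLp_profile_parts {g d : ℝ → ℝ} (hg : MemLp g 2 (volume.restrict (Ioc 0 L)))
    (hd : MemLp d 2 (volume.restrict (Ioc 0 L))) :
    MemLp (fun x => (g x + c * d x) / 2) 2 (volume.restrict (Ioc 0 L)) ∧
    MemLp (fun x => (1 + h₁) / (1 - h₁) * ((g x - c * d x) / 2)) 2 (volume.restrict (Ioc 0 L)) := by
  have h1 : MemLp (fun x => g x + c * d x) 2 (volume.restrict (Ioc 0 L)) := hg.add (hd.const_mul c)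
  have h2 : MemLp (fun x => g x - c * d x) 2 (volume.restrict (Ioc 0 L)) := hg.sub (hd.const_mul c)
  simp only [div_eq_inv_mul _ (2 : ℝ)]
  exact ⟨h1.const_mul _, (h2.const_mul _).const_mul _⟩

lemma memLp_profile {g d : ℝ → ℝ} (hg : MemLp g 2 (volume.restrict (Ioc 0 L)))
    (hd : MemLp d 2 (volume.restrict (Ioc 0 L))) :
    MemLp (fun x => (profile c h₁ g d x : ℂ)) 2 (volume.restrict (Ioc (-L) L)) :=
  memLp_glue H.hL (memLp_profile_parts (c := c) (h₁ := h₁) hg hd).1 (memLp_profile_parts (c := c) (h₁ := h₁) hg hd).2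

lemma ofReal_one_sub_h₁ : (1 - h₁ : ℂ) ≠ 0 := by exact_mod_cast H.one_sub_h₁
lemma ofReal_one_add_h₁ : (1 + h₁ : ℂ) ≠ 0 := by exact_mod_cast H.one_add_h₁

omit H in
lemma memLp_continuous {F : ℝ → ℂ} (hF : Continuous F) (a b : ℝ) :
    MemLp F 2 (volume.restrict (Ioc a b)) := by
  have h1 : MemLp (fun _ : ℝ => (1 : ℂ)) 2 (volume.restrict (Ioc a b)) := memLp_const 1
  simpa using h1.continuous_mul_Ioc hF

/-- Written in exponentials, the integrand of the coefficient is half of `(1 - h₁) exp (-k x) (g + c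
d) + (1 + h₁) exp (k x) (g - c d)`. Reflecting the second term to `[-L, 0]` explains the factor `(1
+ h₁) / (1 - h₁)` in the profile. -/
lemma coeff_eq {g d : ℝ → ℝ} (hg : MemLp g 2 (volume.restrict (Ioc 0 L)))
    (hd : MemLp d 2 (volume.restrict (Ioc 0 L))) (r : ℤ) : coeff c L h₁ h₂ g d r =
    (1 - h₁) * transform c L h₁ h₂ (fun x => profile c h₁ g d x) r := by
  have h1 := H.ofReal_one_sub_h₁
  rw [transform, profile, integral_mul_glue H.hL (memLp_profile_parts (c := c) (h₁ := h₁) hg hd).1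
    (memLp_profile_parts (c := c) (h₁ := h₁) hg hd).2 ⟨fun x => Complex.exp (freq c L h₁ h₂ r * (-x : ℝ)),
      fun x => Complex.exp (freq c L h₁ h₂ r * x), memLp_continuous (by fun_prop) _ _,
      memLp_continuous (by fun_prop) _ _, fun _ _ => rfl, fun x _ => by rw [neg_neg]⟩,
    ← intervalIntegral.integral_const_mul, coeff]
  refine intervalIntegral.integral_congr fun x _ => ?_
  simp only [mode_eq, dualMode_eq, neg_neg]
  push_cast
  field_simp
  ring

lemma exists_sum_norm_coeff_sq_le : ∃ K : ℝ, 0 < K ∧ ∀ g d : ℝ → ℝ,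
    MemLp g 2 (volume.restrict (Ioc 0 L)) → MemLp d 2 (volume.restrict (Ioc 0 L)) →
    ∀ s : Finset ℤ, ∑ r ∈ s, ‖coeff c L h₁ h₂ g d r‖ ^ 2 ≤ K * ∫ x in 0..L, (g x ^ 2 + d x ^ 2) := by
  obtain ⟨K, hK, hb⟩ := H.exists_sum_norm_transform_sq_le
  set M : ℝ := (1 + c ^ 2) * (1 + ((1 + h₁) / (1 - h₁)) ^ 2) with hM
  refine ⟨((1 - h₁) ^ 2 + 1) * (K * M), by positivity, fun g d hg hd s => ?_⟩
  have hp := memLp_profile_parts (c := c) (h₁ := h₁) hg hd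
  have h1 := hb _ (H.memLp_profile hg hd) s
  have h2 : ∫ x in -L..L, ‖(profile c h₁ g d x : ℂ)‖ ^ 2 = ∫ x in 0..L,
      (((g x + c * d x) / 2) ^ 2 + ((1 + h₁) / (1 - h₁) * ((g x - c * d x) / 2)) ^ 2) := by
    have := integral_mul_glue H.hL hp.1 hp.2 (F := fun x => (profile c h₁ g d x : ℂ))
      ⟨_, _, hp.1.ofReal, hp.2.ofReal, fun x hx => by simp [profile, glue, hx],
        fun x hx => by simp [profile, glue, not_lt.2 hx.le]⟩
    have h3 : ∫ x in -L..L, (profile c h₁ g d x : ℂ) * glue (fun x => (g x + c * d x) / 2)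
        (fun x => (1 + h₁) / (1 - h₁) * ((g x - c * d x) / 2)) x =
        ((∫ x in -L..L, ‖(profile c h₁ g d x : ℂ)‖ ^ 2 : ℝ) : ℂ) := by
      rw [← intervalIntegral.integral_ofReal]
      refine intervalIntegral.integral_congr fun x _ => ?_
      simp only [Complex.norm_real, Real.norm_eq_abs, sq_abs]
      rw [profile]; push_cast; ring
    rw [h3] at this
    apply Complex.ofReal_injective
    rw [this, ← intervalIntegral.integral_ofReal, intervalIntegral.integral_of_le H.hL.le,
      intervalIntegral.integral_of_le H.hL.le]
    refine setIntegral_congr_fun measurableSet_Ioc fun x hx => ?_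
    simp only [profile, glue, hx.1, if_true, Left.neg_pos_iff, not_lt.2 hx.1.le, if_false, neg_neg]
    push_cast; ring
  have h3 : ∫ x in -L..L, ‖(profile c h₁ g d x : ℂ)‖ ^ 2 ≤ M * ∫ x in 0..L, (g x ^ 2 + d x ^ 2) := by
    rw [h2, ← intervalIntegral.integral_const_mul]
    have hi : ∀ {w : ℝ → ℝ}, MemLp w 2 (volume.restrict (Ioc 0 L)) →
        IntervalIntegrable (fun x => w x ^ 2) volume 0 L := fun hw => by
      rw [intervalIntegrable_iff_integrableOn_Ioc_of_le H.hL.le]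
      exact hw.integrable_sq
    refine intervalIntegral.integral_mono_on H.hL.le ((hi hp.1).add (hi hp.2))
      (((hi hg).add (hi hd)).const_mul _) fun x _ => ?_
    have e1 : ((g x + c * d x) / 2) ^ 2 ≤ (1 + c ^ 2) * (g x ^ 2 + d x ^ 2) := by
      nlinarith [sq_nonneg (g x - c * d x), sq_nonneg (c * g x), sq_nonneg (c * d x),
        sq_nonneg (g x), sq_nonneg (d x)]
    have e2 : ((g x - c * d x) / 2) ^ 2 ≤ (1 + c ^ 2) * (g x ^ 2 + d x ^ 2) := by
      nlinarith [sq_nonneg (g x + c * d x), sq_nonneg (c * g x), sq_nonneg (c * d x),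
        sq_nonneg (g x), sq_nonneg (d x)]
    rw [mul_pow, hM]
    have e3 := mul_le_mul_of_nonneg_left e2 (sq_nonneg ((1 + h₁) / (1 - h₁)))
    nlinarith
  have h4 : 0 ≤ ∫ x in 0..L, (g x ^ 2 + d x ^ 2) :=
    intervalIntegral.integral_nonneg H.hL.le fun x _ => by positivity
  have h5 : ∑ r ∈ s, ‖coeff c L h₁ h₂ g d r‖ ^ 2 = (1 - h₁) ^ 2 *
      ∑ r ∈ s, ‖transform c L h₁ h₂ (fun x => profile c h₁ g d x) r‖ ^ 2 := by
    rw [Finset.mul_sum]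
    refine Finset.sum_congr rfl fun r _ => ?_
    rw [H.coeff_eq hg hd, norm_mul, mul_pow]
    congr 1
    rw [show (1 - h₁ : ℂ) = ((1 - h₁ : ℝ) : ℂ) by push_cast; rfl, Complex.norm_real,
      Real.norm_eq_abs, sq_abs]
  rw [h5]
  calc _ ≤ (1 - h₁) ^ 2 * (K * (M * ∫ x in 0..L, (g x ^ 2 + d x ^ 2))) := by
        gcongr
        exact h1.trans (by gcongr)
    _ ≤ ((1 - h₁) ^ 2 + 1) * (K * (M * ∫ x in 0..L, (g x ^ 2 + d x ^ 2))) := by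
        gcongr; linarith
    _ = _ := by ring

/-- Completeness of the modes: the velocity is recovered, tested against `ψ`. -/
lemma hasSum_coeff_mul_integral_mode {g d ψ : ℝ → ℝ} (hg : MemLp g 2 (volume.restrict (Ioc 0 L)))
    (hd : MemLp d 2 (volume.restrict (Ioc 0 L))) (hψ : MemLp ψ 2 (volume.restrict (Ioc 0 L))) :
    HasSum (fun r : ℤ => coeff c L h₁ h₂ g d r * ∫ x in 0..L, mode c L h₁ h₂ r x * ψ x)
      ((1 - h₁ ^ 2) * L * ∫ x in 0..L, (g x * ψ x : ℂ)) := by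
  have hp := memLp_profile_parts (c := c) (h₁ := h₁) hg hd
  -- The test function is glued with the reciprocal of the factor in the profile. The product of the
  -- two then has halves `(g + c d) ψ / 2` and `(g - c d) ψ / 2`, and the gradient drops out.
  have hψ' : MemLp (fun x => (1 - h₁) / (1 + h₁) * ψ x) 2 (volume.restrict (Ioc 0 L)) :=
    hψ.const_mul _
  have h1 := H.ofReal_one_sub_h₁
  have h2 := H.ofReal_one_add_h₁
  have := (H.hasSum_transform_mul (H.memLp_profile hg hd) (memLp_glue H.hL hψ hψ')).mul_left
    ((1 - h₁) * ((1 + h₁) / 2) : ℂ)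
  convert! this using 1
  · ext r
    rw [H.coeff_eq hg hd, integral_mul_glue H.hL hψ hψ'
      ⟨fun x => Complex.exp (freq c L h₁ h₂ r * x),
      fun x => Complex.exp (freq c L h₁ h₂ r * (-x : ℝ)), memLp_continuous (by fun_prop) _ _,
      memLp_continuous (by fun_prop) _ _, fun _ _ => rfl, fun x _ => rfl⟩]
    have : ∫ x in 0..L, mode c L h₁ h₂ r x * ψ x = ((1 + h₁) / 2) *
        ∫ x in 0..L, (Complex.exp (freq c L h₁ h₂ r * x) * ψ x +
          Complex.exp (freq c L h₁ h₂ r * (-x : ℝ)) * ((1 - h₁) / (1 + h₁) * ψ x : ℝ)) := by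
      rw [← intervalIntegral.integral_const_mul]
      refine intervalIntegral.integral_congr fun x _ => ?_
      simp only [mode_eq]
      push_cast
      field_simp
    rw [this]; ring
  · rw [integral_mul_glue H.hL hψ hψ' ⟨_, _, hp.1.ofReal, hp.2.ofReal,
        fun x hx => by simp [profile, glue, hx], fun x hx => by simp [profile, glue, not_lt.2 hx.le]⟩]
    have : ∫ x in 0..L, ((profile c h₁ g d x : ℂ) * ψ x +
        profile c h₁ g d (-x) * ((1 - h₁) / (1 + h₁) * ψ x : ℝ)) = ∫ x in 0..L, (g x * ψ x : ℂ) := by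
      rw [intervalIntegral.integral_of_le H.hL.le, intervalIntegral.integral_of_le H.hL.le]
      refine setIntegral_congr_fun measurableSet_Ioc fun x hx => ?_
      simp only [profile, glue, hx.1, if_true, Left.neg_pos_iff, not_lt.2 hx.1.le, if_false, neg_neg]
      push_cast
      field_simp
      ring
    rw [this]; ring

/-- Young's inequality for `‖a_r‖ · ‖k_r‖⁻¹`, both factors being square summable. -/
lemma summable_norm_div_freq {a : ℤ → ℂ} (ha : Summable fun r => ‖a r‖ ^ 2) :
    Summable fun r => ‖a r / freq c L h₁ h₂ r‖ := by
  refine Summable.of_nonneg_of_le (fun _ => norm_nonneg _) (fun r => ?_)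
    (ha.add H.summable_inv_norm_freq_sq)
  rw [norm_div, div_eq_mul_inv, ← inv_pow]
  nlinarith [sq_nonneg (‖a r‖ - ‖freq c L h₁ h₂ r‖⁻¹), sq_nonneg ‖a r‖,
    sq_nonneg (‖freq c L h₁ h₂ r‖⁻¹)]

lemma summable_coeff_sq {g d : ℝ → ℝ} (hg : MemLp g 2 (volume.restrict (Ioc 0 L)))
    (hd : MemLp d 2 (volume.restrict (Ioc 0 L))) :
    Summable fun r : ℤ => ‖coeff c L h₁ h₂ g d r‖ ^ 2 := by
  obtain ⟨K, -, hb⟩ := H.exists_sum_norm_coeff_sq_le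
  exact summable_of_sum_le (fun _ => sq_nonneg _) (hb g d hg hd)

section Potential

variable {γ : ℝ → ℂ} (hγ : MemLp γ 2 (volume.restrict (Ioc (-L) L)))
include hγ

lemma summable_transform_div : Summable fun r : ℤ =>
    ‖transform c L h₁ h₂ γ r / freq c L h₁ h₂ r‖ := by
  obtain ⟨K, -, hb⟩ := H.exists_sum_norm_transform_sq_le
  exact H.summable_norm_div_freq (summable_of_sum_le (fun _ => sq_nonneg _) (hb γ hγ))

lemma hasSum_potential (s : ℝ) : HasSum (fun r : ℤ => transform c L h₁ h₂ γ r /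
    freq c L h₁ h₂ r * Complex.exp (freq c L h₁ h₂ r * s)) (potential c L h₁ h₂ γ s) := by
  refine Summable.hasSum (Summable.of_norm_bounded
    ((H.summable_transform_div hγ).mul_right (Real.exp ((freq c L h₁ h₂ 0).re * s))) fun r => ?_)
  rw [norm_mul, H.norm_exp_freq]

lemma potential_add_two_mul (s : ℝ) : potential c L h₁ h₂ γ (s + 2 * L) =
    (reflection h₁ h₂ : ℝ) * potential c L h₁ h₂ γ s := by
  refine (H.hasSum_potential hγ _).unique ?_
  convert! (H.hasSum_potential hγ s).mul_left ((reflection h₁ h₂ : ℝ) : ℂ) using 1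
  ext r
  rw [← H.exp_freq r]
  push_cast
  rw [mul_add, Complex.exp_add, mul_comm (freq c L h₁ h₂ r) (2 * L : ℂ)]
  ring

/-- The biorthogonal expansion is applied to the signed indicator of the interval between `0` and
`s`; its integral against `exp (k_r x)` is `(exp (k_r s) - 1) / k_r`. -/
lemma potential_sub_zero {s : ℝ} (hs : s ∈ Icc (-L) L) :
    potential c L h₁ h₂ γ s - potential c L h₁ h₂ γ 0 = 2 * L * ∫ x in 0..s, γ x := by
  have key : ∀ {F : ℝ → ℂ}, MemLp F 2 (volume.restrict (Ioc (-L) L)) → ∫ x in -L..L, F x *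
      ((Ioc 0 s).indicator 1 x - (Ioc s 0).indicator 1 x) = ∫ x in 0..s, F x := by
    intro F hF
    have hi := hF.intervalIntegrable H.neg_L_lt.le
    rw [intervalIntegrable_iff_integrableOn_Ioc_of_le H.neg_L_lt.le] at hi
    rw [intervalIntegral.integral_of_le H.neg_L_lt.le, intervalIntegral]
    have e : ∀ x, F x * ((Ioc 0 s).indicator 1 x - (Ioc s 0).indicator 1 x) =
        (Ioc 0 s).indicator F x - (Ioc s 0).indicator F x := fun x => by
      by_cases h1 : x ∈ Ioc 0 s <;> by_cases h2 : x ∈ Ioc s 0 <;> simp [h1, h2]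
    simp only [e]
    have sub1 : Ioc 0 s ⊆ Ioc (-L) L := Ioc_subset_Ioc (by linarith [H.hL]) hs.2
    have sub2 : Ioc s 0 ⊆ Ioc (-L) L := Ioc_subset_Ioc hs.1 (by linarith [H.hL])
    rw [integral_sub (Integrable.indicator hi measurableSet_Ioc)
      (Integrable.indicator hi measurableSet_Ioc), setIntegral_indicator measurableSet_Ioc,
      setIntegral_indicator measurableSet_Ioc, inter_eq_self_of_subset_right sub1,
      inter_eq_self_of_subset_right sub2]
  have hψ : MemLp (fun x : ℝ => ((Ioc 0 s).indicator 1 x - (Ioc s 0).indicator 1 x : ℂ)) 2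
      (volume.restrict (Ioc (-L) L)) := by
    refine MemLp.sub ?_ ?_ <;> exact (memLp_const (1 : ℂ)).indicator measurableSet_Ioc
  have h1 := H.hasSum_transform_mul hγ hψ
  rw [key hγ] at h1
  refine ((H.hasSum_potential hγ s).sub (H.hasSum_potential hγ 0)).unique (h1.congr_fun fun r => ?_)
  rw [key (memLp_continuous (by fun_prop) _ _)]
  have h2 := H.freq_ne_zero r
  rw [integral_exp_mul_complex h2]
  push_cast
  field_simp

end Potential

section Modal

variable {g d : ℝ → ℝ} (hg : MemLp g 2 (volume.restrict (Ioc 0 L)))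
  (hd : MemLp d 2 (volume.restrict (Ioc 0 L)))
include hg hd

/-- d'Alembert's form: a vibrating mode is a combination of `exp (k_r (c t + x))` and `exp (k_r (c t
- x))`, so the series is a sum of two travelling copies of the potential. -/
lemma hasSum_modal (x t : ℝ) : HasSum (fun r : ℤ => mode c L h₁ h₂ r x / eigenvalue c L h₁ h₂ r *
      Complex.exp (eigenvalue c L h₁ h₂ r * t) * coeff c L h₁ h₂ g d r)
    ((1 - h₁ ^ 2) / (2 * c) * (potential c L h₁ h₂ (fun y => profile c h₁ g d y) (c * t + x) +
      (1 - h₁) / (1 + h₁) * potential c L h₁ h₂ (fun y => profile c h₁ g d y) (c * t - x))) := by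
  have hγ := H.memLp_profile hg hd
  have h2 := H.ofReal_one_add_h₁
  have hc := H.ofReal_c_ne
  convert! ((H.hasSum_potential hγ (c * t + x)).add ((H.hasSum_potential hγ (c * t - x)).mul_left
    ((1 - h₁) / (1 + h₁) : ℂ))).mul_left ((1 - h₁ ^ 2) / (2 * c) : ℂ) using 1
  ext r
  rw [div_mul_eq_mul_div, H.mode_mul_exp, H.coeff_eq hg hd, H.eigenvalue_eq]
  have := H.freq_ne_zero r
  field_simp
  ring

/-- The modal series at time zero. -/
lemma hasSum_modal_initial {x : ℝ} (hx : x ∈ Icc 0 L) :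
    HasSum (fun r : ℤ => mode c L h₁ h₂ r x / eigenvalue c L h₁ h₂ r * coeff c L h₁ h₂ g d r)
    (((1 - h₁ ^ 2) * L * ((∫ y in 0..x, d y) -
      ((∫ y in 0..L, g y) + c * h₂ * ∫ y in 0..L, d y) / (c * (h₁ + h₂))) : ℝ) : ℂ) := by
  have hγ := H.memLp_profile hg hd
  have hL := H.hL
  have hgi := hg.intervalIntegrable hL.le
  have hdi := hd.intervalIntegrable hL.le
  have hp := memLp_profile_parts (c := c) (h₁ := h₁) hg hd
  set P := potential c L h₁ h₂ (fun x => (profile c h₁ g d x : ℂ)) with hP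
  have h0L : (0 : ℝ) ∈ Icc 0 L := ⟨le_rfl, hL.le⟩
  have hsub : ∀ {a : ℝ}, a ∈ Icc 0 L → IntervalIntegrable g volume 0 a ∧
      IntervalIntegrable d volume 0 a := fun {a} ha => by
    have : uIcc 0 a ⊆ uIcc 0 L := by
      rw [uIcc_of_le ha.1, uIcc_of_le hL.le]; exact Icc_subset_Icc_right ha.2
    exact ⟨hgi.mono_set this, hdi.mono_set this⟩
  have hpos : ∀ a ∈ Icc 0 L, P a - P 0 =
      ((L * ((∫ y in 0..a, g y) + c * ∫ y in 0..a, d y) : ℝ) : ℂ) := fun a ha => by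
    rw [hP, H.potential_sub_zero hγ ⟨by linarith [ha.1], ha.2⟩, intervalIntegral.integral_ofReal]
    have : ∫ y in 0..a, profile c h₁ g d y = ∫ y in 0..a, (g y + c * d y) / 2 := by
      rw [intervalIntegral.integral_of_le ha.1, intervalIntegral.integral_of_le ha.1]
      refine setIntegral_congr_fun measurableSet_Ioc fun y hy => ?_
      simp [profile, glue, hy.1]
    rw [this, intervalIntegral.integral_div, intervalIntegral.integral_add (hsub ha).1
      ((hsub ha).2.const_mul c), intervalIntegral.integral_const_mul]
    push_cast; ring
  have hneg : ∀ a ∈ Icc 0 L, P (-a) - P 0 = ((-(L * ((1 + h₁) / (1 - h₁)) *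
      ((∫ y in 0..a, g y) - c * ∫ y in 0..a, d y)) : ℝ) : ℂ) := fun a ha => by
    rw [hP, H.potential_sub_zero hγ ⟨by linarith [ha.2], by linarith [ha.1]⟩,
      intervalIntegral.integral_ofReal]
    have : ∫ y in 0..-a, profile c h₁ g d y =
        -∫ y in 0..a, (1 + h₁) / (1 - h₁) * ((g y - c * d y) / 2) := by
      rw [intervalIntegral.integral_symm, ← neg_zero, ← intervalIntegral.integral_comp_neg]
      congr 1
      rw [neg_zero, intervalIntegral.integral_of_le ha.1, intervalIntegral.integral_of_le ha.1]
      refine setIntegral_congr_fun measurableSet_Ioc fun y hy => ?_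
      simp [profile, glue, not_lt.2 hy.1.le]
    rw [this, intervalIntegral.integral_const_mul, intervalIntegral.integral_div,
      intervalIntegral.integral_sub (hsub ha).1 ((hsub ha).2.const_mul c),
      intervalIntegral.integral_const_mul]
    push_cast; ring
  -- The primitive formula leaves `P 0` open. Comparing `P L` with `P (-L)` through the factor `q`
  -- gives a linear equation for it, solvable since `h₁ + h₂ ≠ 0`.
  have hq := H.potential_add_two_mul hγ (-L)
  rw [show -L + 2 * L = L by ring, ← hP] at hq
  have hLL : L ∈ Icc 0 L := ⟨hL.le, le_rfl⟩
  have e1 := hpos L hLL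
  have e2 := hneg L hLL
  have hs := H.hasSum_modal hg hd x 0
  rw [← hP, mul_zero, zero_add, zero_sub] at hs
  have e3 := hpos x hx
  have e4 := hneg x hx
  have n1 := H.ofReal_one_sub_h₁
  have n2 := H.ofReal_one_add_h₁
  have n3 : (1 + h₂ : ℂ) ≠ 0 := by exact_mod_cast H.one_add_h₂
  have n4 : (h₁ + h₂ : ℂ) ≠ 0 := by exact_mod_cast H.hsum
  have n5 := H.ofReal_c_ne
  have hP0 : P 0 = -((1 + h₁) * L * ((∫ y in 0..L, g y : ℝ) + c * h₂ * (∫ y in 0..L, d y : ℝ))) /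
      (h₁ + h₂) := by
    rw [eq_div_iff n4]
    rw [eq_add_of_sub_eq e1, eq_add_of_sub_eq e2, reflection] at hq
    push_cast at hq
    field_simp at hq
    linear_combination (1 / 2 : ℂ) * hq
  convert! hs using 1
  · ext r; simp
  · rw [eq_add_of_sub_eq e3, eq_add_of_sub_eq e4, hP0]
    push_cast
    field_simp
    ring

end Modal

end Admissible

end ViscousBar

/-! ### Test functions and space-time pairings. -/

namespace ViscousBar

open Filter Topology

/-- A continuous compactly supported function of two variables, in curried form. -/
structure IsKernel (Φ : ℝ → ℝ → ℝ) : Prop where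
  continuous : Continuous (uncurry Φ)
  hasCompactSupport : HasCompactSupport (uncurry Φ)

/-- A smooth compactly supported function of two variables, in curried form. -/
structure IsTest (φ : ℝ → ℝ → ℝ) : Prop where
  contDiff : ContDiff ℝ ∞ (uncurry φ)
  hasCompactSupport : HasCompactSupport (uncurry φ)

/-- The partial derivative in the second variable. -/
noncomputable def dt (φ : ℝ → ℝ → ℝ) (x t : ℝ) : ℝ := deriv (fun s => φ x s) t

/-- The partial derivative in the first variable. -/
noncomputable def dx (φ : ℝ → ℝ → ℝ) (x t : ℝ) : ℝ := deriv (fun y => φ y t) x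

namespace IsTest

variable {φ : ℝ → ℝ → ℝ} (h : IsTest φ)
include h

lemma isKernel : IsKernel φ := ⟨h.contDiff.continuous, h.hasCompactSupport⟩

lemma hasDerivAt_fderiv_snd (x t : ℝ) :
    HasDerivAt (fun s => φ x s) (fderiv ℝ (uncurry φ) (x, t) (0, 1)) t := by
  have h1 : HasFDerivAt (uncurry φ) (fderiv ℝ (uncurry φ) (x, t)) (x, t) :=
    (h.contDiff.differentiable (by simp) (x, t)).hasFDerivAt
  have h2 : HasDerivAt (fun s : ℝ => (x, s)) ((0 : ℝ), (1 : ℝ)) t :=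
    (hasDerivAt_const t x).prodMk (hasDerivAt_id t)
  exact h1.comp_hasDerivAt t h2

lemma hasDerivAt_fderiv_fst (x t : ℝ) :
    HasDerivAt (fun y => φ y t) (fderiv ℝ (uncurry φ) (x, t) (1, 0)) x := by
  have h1 : HasFDerivAt (uncurry φ) (fderiv ℝ (uncurry φ) (x, t)) (x, t) :=
    (h.contDiff.differentiable (by simp) (x, t)).hasFDerivAt
  have h2 : HasDerivAt (fun y : ℝ => (y, t)) ((1 : ℝ), (0 : ℝ)) x :=
    (hasDerivAt_id x).prodMk (hasDerivAt_const x t)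
  exact h1.comp_hasDerivAt x h2

lemma hasDerivAt_dt (x t : ℝ) : HasDerivAt (fun s => φ x s) (dt φ x t) t :=
  (h.hasDerivAt_fderiv_snd x t).differentiableAt.hasDerivAt

lemma hasDerivAt_dx (x t : ℝ) : HasDerivAt (fun y => φ y t) (dx φ x t) x :=
  (h.hasDerivAt_fderiv_fst x t).differentiableAt.hasDerivAt

lemma of_fderiv_apply {ψ : ℝ → ℝ → ℝ} (v : ℝ × ℝ)
    (hψ : ∀ x t, ψ x t = fderiv ℝ (uncurry φ) (x, t) v) : IsTest ψ := by
  have e : uncurry ψ = fun z => fderiv ℝ (uncurry φ) z v := by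
    ext ⟨x, t⟩; exact hψ x t
  constructor
  · rw [e]
    exact (h.contDiff.fderiv_right (m := ∞) (by simp)).clm_apply contDiff_const
  · rw [e]
    exact (h.hasCompactSupport.fderiv ℝ).comp_left (g := fun A : (ℝ × ℝ) →L[ℝ] ℝ => A v) (by simp)

lemma dt : IsTest (dt φ) := h.of_fderiv_apply (0, 1) fun x t => (h.hasDerivAt_fderiv_snd x t).deriv

lemma dx : IsTest (dx φ) := h.of_fderiv_apply (1, 0) fun x t => (h.hasDerivAt_fderiv_fst x t).deriv

lemma shift (τ : ℝ) : IsTest fun x t => φ x (t + τ) := by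
  constructor
  · exact h.contDiff.comp (contDiff_fst.prodMk (contDiff_snd.add contDiff_const))
  · exact h.hasCompactSupport.comp_homeomorph
      ((Homeomorph.refl ℝ).prodCongr (Homeomorph.addRight τ))

end IsTest

/-- The expression `φ_tt - c² φ_xx`. -/
noncomputable def wave (c : ℝ) (φ : ℝ → ℝ → ℝ) (x t : ℝ) : ℝ :=
  dt (dt φ) x t - c ^ 2 * dx (dx φ) x t

namespace IsKernel

lemma sub {Φ Ψ : ℝ → ℝ → ℝ} (h : IsKernel Φ) (h' : IsKernel Ψ) :
    IsKernel fun x t => Φ x t - Ψ x t :=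
  ⟨h.continuous.sub h'.continuous, h.hasCompactSupport.sub h'.hasCompactSupport⟩

lemma const_mul {Φ : ℝ → ℝ → ℝ} (h : IsKernel Φ) (a : ℝ) : IsKernel fun x t => a * Φ x t :=
  ⟨h.continuous.const_smul a, h.hasCompactSupport.smul_left (f := fun _ => a)⟩

lemma exists_bound_support {Φ : ℝ → ℝ → ℝ} (h : IsKernel Φ) :
    ∃ T > 0, ∀ x t, T ≤ t → Φ x t = 0 := by
  obtain ⟨R, hR⟩ := h.hasCompactSupport.isCompact.isBounded.subset_closedBall 0
  refine ⟨max R 0 + 1, by positivity, fun x t ht => ?_⟩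
  by_contra hne
  have h1 : (x, t) ∈ Metric.closedBall (0 : ℝ × ℝ) R := hR (subset_tsupport _ hne)
  rw [mem_closedBall_zero_iff, Prod.norm_def] at h1
  have h2 : |t| ≤ R := (le_max_right _ _).trans h1
  have := le_abs_self t
  have := le_max_left R 0
  linarith

lemma exists_bound {Φ : ℝ → ℝ → ℝ} (h : IsKernel Φ) : ∃ C > 0, ∀ x t, |Φ x t| ≤ C := by
  obtain ⟨C, hC⟩ := h.hasCompactSupport.exists_bound_of_continuous h.continuous
  exact ⟨max C 1, by positivity, fun x t => (hC (x, t)).trans (le_max_left _ _)⟩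

lemma shift {Φ : ℝ → ℝ → ℝ} (h : IsKernel Φ) (τ : ℝ) : IsKernel fun x t => Φ x (t + τ) := by
  constructor
  · exact h.continuous.comp (continuous_fst.prodMk (continuous_snd.add continuous_const))
  · exact h.hasCompactSupport.comp_homeomorph
      ((Homeomorph.refl ℝ).prodCongr (Homeomorph.addRight τ))

end IsKernel

lemma IsTest.wave {φ : ℝ → ℝ → ℝ} (h : IsTest φ) (c : ℝ) : IsKernel (wave c φ) :=
  h.dt.dt.isKernel.sub (h.dx.dx.isKernel.const_mul _)

/-- The measure `μ ⊗ dt` on `ℝ × (0, ∞)`. -/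
noncomputable def spaceTime (μ : Measure ℝ) : Measure (ℝ × ℝ) := μ.prod (volume.restrict (Ioi 0))

instance {μ : Measure ℝ} [SFinite μ] : SFinite (spaceTime μ) := by
  unfold spaceTime; infer_instance

/-- The integral of `Φ u` over `μ ⊗ dt`. -/
noncomputable def pairing {E : Type*} [NormedAddCommGroup E] [NormedSpace ℝ E] (μ : Measure ℝ)
    (Φ : ℝ → ℝ → ℝ) (u : ℝ → ℝ → E) : E := ∫ z, Φ z.1 z.2 • u z.1 z.2 ∂spaceTime μ

section Pairing

variable {E : Type*} [NormedAddCommGroup E] [NormedSpace ℝ E] {L : ℝ} {μ : Measure ℝ}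
  [IsFiniteMeasure μ] {Φ : ℝ → ℝ → ℝ} {u v : ℝ → ℝ → E}

omit [IsFiniteMeasure μ] in
-- The condition on `μ` holds for Lebesgue measure on `Ioc 0 L` and for Dirac masses at both ends,
-- so interior and boundary terms of the weak formulation share one calculus.
lemma ae_spaceTime (hμ : μ (Icc 0 L)ᶜ = 0) :
    ∀ᵐ z ∂spaceTime μ, z ∈ Icc 0 L ×ˢ Ici (0 : ℝ) := by
  have h1 : ∀ᵐ x ∂μ, x ∈ Icc 0 L := hμ
  have h2 : ∀ᵐ t ∂(volume.restrict (Ioi (0 : ℝ))), t ∈ Ici (0 : ℝ) := by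
    filter_upwards [ae_restrict_mem measurableSet_Ioi] with t ht using (mem_Ioi.1 ht).le
  have h3 : ∀ᵐ z ∂spaceTime μ, z.1 ∈ Icc 0 L := Measure.quasiMeasurePreserving_fst.ae h1
  have h4 : ∀ᵐ z ∂spaceTime μ, z.2 ∈ Ici (0 : ℝ) := Measure.quasiMeasurePreserving_snd.ae h2
  filter_upwards [h3, h4] with z h5 h6 using ⟨h5, h6⟩

lemma integrable_pairing (hμ : μ (Icc 0 L)ᶜ = 0) (hΦ : IsKernel Φ)
    (hu : ContinuousOn (uncurry u) (Icc 0 L ×ˢ Ici 0)) :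
    Integrable (fun z : ℝ × ℝ => Φ z.1 z.2 • u z.1 z.2) (spaceTime μ) := by
  obtain ⟨T, hT, hT'⟩ := hΦ.exists_bound_support
  have hsub : Icc 0 L ×ˢ Icc 0 T ⊆ Icc 0 L ×ˢ Ici (0 : ℝ) :=
    prod_mono le_rfl Icc_subset_Ici_self
  have hloc : IsFiniteMeasureOnCompacts (spaceTime μ) := by
    unfold spaceTime; infer_instance
  have h1 : IntegrableOn (fun z : ℝ × ℝ => Φ z.1 z.2 • u z.1 z.2) (Icc 0 L ×ˢ Icc 0 T)
      (spaceTime μ) :=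
    ((hΦ.continuous.continuousOn).smul (hu.mono hsub)).integrableOn_compact
      (isCompact_Icc.prod isCompact_Icc)
  refine h1.integrable_of_ae_notMem_eq_zero ?_
  filter_upwards [ae_spaceTime (L := L) hμ] with z hz hz'
  have : T ≤ z.2 := by
    by_contra hlt
    exact hz' ⟨hz.1, hz.2, (not_le.1 hlt).le⟩
  rw [hT' _ _ this, zero_smul]

lemma pairing_add (hμ : μ (Icc 0 L)ᶜ = 0) (hΦ : IsKernel Φ)
    (hu : ContinuousOn (uncurry u) (Icc 0 L ×ˢ Ici 0))
    (hv : ContinuousOn (uncurry v) (Icc 0 L ×ˢ Ici 0)) :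
    pairing μ Φ (fun x t => u x t + v x t) = pairing μ Φ u + pairing μ Φ v := by
  simp only [pairing, smul_add]
  exact integral_add (integrable_pairing hμ hΦ hu) (integrable_pairing hμ hΦ hv)

lemma pairing_sub (hμ : μ (Icc 0 L)ᶜ = 0) (hΦ : IsKernel Φ)
    (hu : ContinuousOn (uncurry u) (Icc 0 L ×ˢ Ici 0))
    (hv : ContinuousOn (uncurry v) (Icc 0 L ×ˢ Ici 0)) :
    pairing μ Φ (fun x t => u x t - v x t) = pairing μ Φ u - pairing μ Φ v := by
  simp only [pairing, smul_sub]
  exact integral_sub (integrable_pairing hμ hΦ hu) (integrable_pairing hμ hΦ hv)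

lemma pairing_eq_integral_integral (hμ : μ (Icc 0 L)ᶜ = 0) (hΦ : IsKernel Φ)
    (hu : ContinuousOn (uncurry u) (Icc 0 L ×ˢ Ici 0)) :
    pairing μ Φ u = ∫ t in Ioi (0 : ℝ), ∫ x, Φ x t • u x t ∂μ :=
  integral_prod_symm _ (integrable_pairing hμ hΦ hu)

lemma pairing_volume (hL : 0 < L) (hΦ : IsKernel Φ)
    (hu : ContinuousOn (uncurry u) (Icc 0 L ×ˢ Ici 0)) :
    pairing (volume.restrict (Ioc 0 L)) Φ u = ∫ t in Ioi (0 : ℝ), ∫ x in 0..L, Φ x t • u x t := by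
  rw [pairing_eq_integral_integral (L := L) _ hΦ hu]
  · simp only [intervalIntegral.integral_of_le hL.le]
  · rw [Measure.restrict_apply measurableSet_Icc.compl]
    convert measure_empty (μ := (volume : Measure ℝ))
    ext x; simp; grind

lemma pairing_dirac [CompleteSpace E] {a : ℝ} (ha : a ∈ Icc 0 L) (hΦ : IsKernel Φ)
    (hu : ContinuousOn (uncurry u) (Icc 0 L ×ˢ Ici 0)) :
    pairing (Measure.dirac a) Φ u = ∫ t in Ioi (0 : ℝ), Φ a t • u a t := by
  rw [pairing_eq_integral_integral (L := L) _ hΦ hu]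
  · simp only [integral_dirac]
  · rw [Measure.dirac_apply' _ measurableSet_Icc.compl]; simp [ha.1, ha.2]

/-- Summable bounds are needed only on bounded time intervals, because the kernel vanishes at large
times. -/
lemma hasSum_pairing [CompleteSpace E] (hμ : μ (Icc 0 L)ᶜ = 0) (hΦ : IsKernel Φ)
    {u : ℤ → ℝ → ℝ → E} (hu : ∀ r, ContinuousOn (uncurry (u r)) (Icc 0 L ×ˢ Ici 0))
    (hB : ∀ T > 0, ∃ B : ℤ → ℝ, Summable B ∧
      ∀ r, ∀ x ∈ Icc 0 L, ∀ t ∈ Icc 0 T, ‖u r x t‖ ≤ B r)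
    (hs : ∀ x ∈ Icc 0 L, ∀ t ∈ Ici 0, HasSum (fun r => u r x t) (v x t)) :
    HasSum (fun r => pairing μ Φ (u r)) (pairing μ Φ v) := by
  obtain ⟨T, hT, hT'⟩ := hΦ.exists_bound_support
  obtain ⟨B, hB, hb⟩ := hB T hT
  have hΦi : Integrable (fun z : ℝ × ℝ => Φ z.1 z.2 • (1 : ℝ)) (spaceTime μ) :=
    integrable_pairing (L := L) (u := fun _ _ => (1 : ℝ)) hμ hΦ continuousOn_const
  have hsum : Summable fun r => ∫ z, ‖Φ z.1 z.2 • u r z.1 z.2‖ ∂spaceTime μ := by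
    refine Summable.of_nonneg_of_le (fun r => integral_nonneg fun z => norm_nonneg _) (fun r => ?_)
      (hB.mul_left (∫ z, ‖Φ z.1 z.2 • (1 : ℝ)‖ ∂spaceTime μ))
    rw [← integral_mul_const]
    refine integral_mono_ae (integrable_pairing hμ hΦ (hu r)).norm (hΦi.norm.mul_const _) ?_
    filter_upwards [ae_spaceTime (L := L) hμ] with z hz
    by_cases h : T ≤ z.2
    · simp [hT' _ _ h]
    · simp only [norm_smul, norm_one, mul_one]
      gcongr
      exact hb r _ hz.1 _ ⟨hz.2, (not_le.1 h).le⟩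
  have := hasSum_integral_of_summable_integral_norm
    (fun r => integrable_pairing hμ hΦ (hu r)) hsum
  convert! this using 1
  refine integral_congr_ae ?_
  filter_upwards [ae_spaceTime (L := L) hμ] with z hz
  exact ((hs _ hz.1 _ hz.2).const_smul (Φ z.1 z.2)).tsum_eq.symm

end Pairing

end ViscousBar

/-! ### The weak formulation as an operator identity. -/

namespace ViscousBar

open Filter Topology

section WeakOp

variable {E : Type*} [NormedAddCommGroup E] [NormedSpace ℝ E]

/-- The part of the weak formulation that involves the solution `u` for positive times. -/
noncomputable def weakOp (c L h₁ h₂ : ℝ) (φ : ℝ → ℝ → ℝ) (u : ℝ → ℝ → E) : E :=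
  pairing (volume.restrict (Ioc 0 L)) (wave c φ) u
    - (c * h₂) • pairing (Measure.dirac L) (dt φ) u
    - (c * h₁) • pairing (Measure.dirac 0) (dt φ) u
    + c ^ 2 • (pairing (Measure.dirac L) (dx φ) u - pairing (Measure.dirac 0) (dx φ) u)

/-- The part of the weak formulation that involves the initial data. -/
noncomputable def initialOp (c L h₁ h₂ : ℝ) (φ : ℝ → ℝ → ℝ) (f g : ℝ → E) : E :=
  (∫ x in 0..L, (φ x 0 • g x - dt φ x 0 • f x)) + (c * h₂) • φ L 0 • f L + (c * h₁) • φ 0 0 • f 0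

lemma volume_restrict_compl (L : ℝ) : (volume.restrict (Ioc 0 L)) (Icc 0 L)ᶜ = 0 := by
  rw [Measure.restrict_apply measurableSet_Icc.compl]
  convert measure_empty (μ := (volume : Measure ℝ))
  ext x; simp; grind

lemma dirac_compl {a L : ℝ} (ha : a ∈ Icc 0 L) : Measure.dirac a (Icc 0 L)ᶜ = 0 := by
  rw [Measure.dirac_apply' _ measurableSet_Icc.compl]; simp [ha.1, ha.2]

variable {c L h₁ h₂ : ℝ} {φ : ℝ → ℝ → ℝ} {u v : ℝ → ℝ → E}

lemma weakOp_add (hL : 0 < L) (hφ : IsTest φ)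
    (hu : ContinuousOn (uncurry u) (Icc 0 L ×ˢ Ici 0))
    (hv : ContinuousOn (uncurry v) (Icc 0 L ×ˢ Ici 0)) :
    weakOp c L h₁ h₂ φ (fun x t => u x t + v x t) =
      weakOp c L h₁ h₂ φ u + weakOp c L h₁ h₂ φ v := by
  have h0 := dirac_compl (L := L) ⟨le_rfl, hL.le⟩
  have h1 := dirac_compl (L := L) ⟨hL.le, le_rfl⟩
  simp only [weakOp, pairing_add (volume_restrict_compl L) (hφ.wave c) hu hv,
    pairing_add h0 hφ.dt.isKernel hu hv, pairing_add h1 hφ.dt.isKernel hu hv,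
    pairing_add h0 hφ.dx.isKernel hu hv, pairing_add h1 hφ.dx.isKernel hu hv]
  module

lemma weakOp_sub (hL : 0 < L) (hφ : IsTest φ)
    (hu : ContinuousOn (uncurry u) (Icc 0 L ×ˢ Ici 0))
    (hv : ContinuousOn (uncurry v) (Icc 0 L ×ˢ Ici 0)) :
    weakOp c L h₁ h₂ φ (fun x t => u x t - v x t) =
      weakOp c L h₁ h₂ φ u - weakOp c L h₁ h₂ φ v := by
  have h0 := dirac_compl (L := L) ⟨le_rfl, hL.le⟩
  have h1 := dirac_compl (L := L) ⟨hL.le, le_rfl⟩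
  simp only [weakOp, pairing_sub (volume_restrict_compl L) (hφ.wave c) hu hv,
    pairing_sub h0 hφ.dt.isKernel hu hv, pairing_sub h1 hφ.dt.isKernel hu hv,
    pairing_sub h0 hφ.dx.isKernel hu hv, pairing_sub h1 hφ.dx.isKernel hu hv]
  module

lemma hasSum_weakOp [CompleteSpace E] (hL : 0 < L) (hφ : IsTest φ)
    {u : ℤ → ℝ → ℝ → E} (hu : ∀ r, ContinuousOn (uncurry (u r)) (Icc 0 L ×ˢ Ici 0))
    (hB : ∀ T > 0, ∃ B : ℤ → ℝ, Summable B ∧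
      ∀ r, ∀ x ∈ Icc 0 L, ∀ t ∈ Icc 0 T, ‖u r x t‖ ≤ B r)
    (hs : ∀ x ∈ Icc 0 L, ∀ t ∈ Ici 0, HasSum (fun r => u r x t) (v x t)) :
    HasSum (fun r => weakOp c L h₁ h₂ φ (u r)) (weakOp c L h₁ h₂ φ v) := by
  have h0 := dirac_compl (L := L) ⟨le_rfl, hL.le⟩
  have h1 := dirac_compl (L := L) ⟨hL.le, le_rfl⟩
  exact (((hasSum_pairing (volume_restrict_compl L) (hφ.wave c) hu hB hs).sub
    ((hasSum_pairing h1 hφ.dt.isKernel hu hB hs).const_smul _)).sub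
    ((hasSum_pairing h0 hφ.dt.isKernel hu hB hs).const_smul _)).add
    (((hasSum_pairing h1 hφ.dx.isKernel hu hB hs).sub
    (hasSum_pairing h0 hφ.dx.isKernel hu hB hs)).const_smul _)

end WeakOp

variable {c L h₁ h₂ : ℝ}

/-- The weak formulation in terms of `weakOp` and `initialOp`. -/
lemma isWeakSolution_iff (hL : 0 < L) {f g : ℝ → ℝ} {p u : ℝ → ℝ → ℝ} :
    IsWeakSolution c L h₁ h₂ f g p u ↔ ContinuousOn (uncurry u) (Icc 0 L ×ˢ Ici 0) ∧
      (∀ x ∈ Icc 0 L, u x 0 = f x) ∧ ∀ φ, IsTest φ → weakOp c L h₁ h₂ φ u =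
        (∫ t in Ioi (0 : ℝ), ∫ x in (0 : ℝ)..L, p x t * φ x t) + initialOp c L h₁ h₂ φ f g := by
  have key : ContinuousOn (uncurry u) (Icc 0 L ×ˢ Ici 0) → ∀ φ, IsTest φ →
      ((∫ t in Ioi (0 : ℝ), ∫ x in (0 : ℝ)..L,
        u x t * (iteratedDeriv 2 (fun s => φ x s) t - c ^ 2 * iteratedDeriv 2 (fun y => φ y t) x)
      = (∫ t in Ioi (0 : ℝ), ∫ x in (0 : ℝ)..L, p x t * φ x t)
        + (∫ x in (0 : ℝ)..L, (g x * φ x 0 - f x * deriv (fun s => φ x s) 0))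
        + c * h₂ * (f L * φ L 0 + ∫ t in Ioi (0 : ℝ), u L t * deriv (fun s => φ L s) t)
        + c * h₁ * (f 0 * φ 0 0 + ∫ t in Ioi (0 : ℝ), u 0 t * deriv (fun s => φ 0 s) t)
        - c ^ 2 * ∫ t in Ioi (0 : ℝ),
            (u L t * deriv (fun y => φ y t) L - u 0 t * deriv (fun y => φ y t) 0)) ↔
      weakOp c L h₁ h₂ φ u =
        (∫ t in Ioi (0 : ℝ), ∫ x in (0 : ℝ)..L, p x t * φ x t) + initialOp c L h₁ h₂ φ f g) := by
    intro hu φ hφ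
    have h0 : (0 : ℝ) ∈ Icc 0 L := ⟨le_rfl, hL.le⟩
    have h1 : L ∈ Icc 0 L := ⟨hL.le, le_rfl⟩
    have i0 := (integrable_pairing (dirac_compl h0) hφ.dx.isKernel hu)
    have i1 := (integrable_pairing (dirac_compl h1) hφ.dx.isKernel hu)
    have j : ∀ a, Integrable (fun z : ℝ × ℝ => dx φ z.1 z.2 • u z.1 z.2)
        (spaceTime (Measure.dirac a)) →
        Integrable (fun t => dx φ a t * u a t) (volume.restrict (Ioi 0)) := fun a i => by
      rw [spaceTime, Measure.dirac_prod] at i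
      exact i.comp_measurable measurable_prodMk_left
    rw [weakOp, initialOp, pairing_volume hL (hφ.wave c) hu, pairing_dirac h1 hφ.dt.isKernel hu,
      pairing_dirac h0 hφ.dt.isKernel hu, pairing_dirac h1 hφ.dx.isKernel hu,
      pairing_dirac h0 hφ.dx.isKernel hu]
    simp only [smul_eq_mul]
    rw [← integral_sub (j L i1) (j 0 i0)]
    have e1 : ∀ x t, u x t * (iteratedDeriv 2 (fun s => φ x s) t -
        c ^ 2 * iteratedDeriv 2 (fun y => φ y t) x) = wave c φ x t * u x t := fun x t => by
      simp only [iteratedDeriv_succ, iteratedDeriv_zero, wave]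
      rw [mul_comm]; rfl
    simp only [e1, mul_comm (u _ _), mul_comm (g _), mul_comm (f _)]
    have e2 : ∀ x t, deriv (fun s => φ x s) t = dt φ x t := fun _ _ => rfl
    have e3 : ∀ x t, deriv (fun y => φ y t) x = dx φ x t := fun _ _ => rfl
    simp only [e2, e3]
    constructor <;> intro h <;> linarith
  constructor
  · intro h
    exact ⟨h.continuousOn, h.initial, fun φ hφ => (key h.continuousOn φ hφ).1
      (h.weak φ hφ.contDiff hφ.hasCompactSupport)⟩
  · rintro ⟨h1, h2, h3⟩
    exact ⟨h1, h2, fun φ hφ hφ' => (key h1 φ ⟨hφ, hφ'⟩).2 (h3 φ ⟨hφ, hφ'⟩)⟩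

/-! ### Integration by parts: classical solutions are weak solutions. -/

section Classical

variable {E : Type*} [NormedAddCommGroup E] [NormedSpace ℝ E] [CompleteSpace E] {φ : ℝ → ℝ → ℝ}

omit [CompleteSpace E] in
lemma integral_Ioi_eq_intervalIntegral {T : ℝ} (hT : 0 ≤ T) {F : ℝ → E} (hF : ∀ t, T ≤ t → F t = 0) :
    ∫ t in Ioi 0, F t = ∫ t in 0..T, F t := by
  rw [intervalIntegral.integral_of_le hT]
  refine setIntegral_eq_of_subset_of_forall_sdiff_eq_zero measurableSet_Ioi Ioc_subset_Ioi_self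
    fun t ht => hF t ?_
  by_contra h
  exact ht.2 ⟨ht.1, (not_le.1 h).le⟩

/-- The integral is really over a bounded interval `[0, S]` with `φ x S = 0`, so the only boundary
term sits at `t = 0`. -/
lemma integral_dt_smul (hφ : IsTest φ) (x : ℝ) {w w' : ℝ → E} (hw' : ContinuousOn w' (Ici 0))
    (hd : ∀ t ∈ Ici (0 : ℝ), HasDerivWithinAt w (w' t) (Ici 0) t) :
    ∫ t in Ioi (0 : ℝ), dt φ x t • w t = -(φ x 0 • w 0) - ∫ t in Ioi (0 : ℝ), φ x t • w' t := by
  obtain ⟨T, hT, h1⟩ := hφ.isKernel.exists_bound_support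
  obtain ⟨T', -, h2⟩ := hφ.dt.isKernel.exists_bound_support
  set S := max T T'
  have hS : 0 ≤ S := hT.le.trans (le_max_left _ _)
  have hsub : uIcc 0 S ⊆ Ici 0 := by rw [uIcc_of_le hS]; exact Icc_subset_Ici_self
  have c1 : Continuous fun t => φ x t := hφ.isKernel.continuous.comp (Continuous.prodMk_right x)
  have c2 : Continuous fun t => dt φ x t :=
    hφ.dt.isKernel.continuous.comp (Continuous.prodMk_right x)
  rw [integral_Ioi_eq_intervalIntegral hS fun t ht => by
      rw [h2 x t ((le_max_right _ _).trans ht), zero_smul],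
    integral_Ioi_eq_intervalIntegral hS fun t ht => by
      rw [h1 x t ((le_max_left _ _).trans ht), zero_smul],
    intervalIntegral.integral_smul_deriv_eq_deriv_smul_of_hasDeriv_right (u := fun t => φ x t)
      (u' := fun t => dt φ x t) (v := w) c1.continuousOn
      (fun t ht => ((hd t (hsub ht)).mono hsub).continuousWithinAt)
      (fun t _ => (hφ.hasDerivAt_dt x t).hasDerivWithinAt) (fun t ht => ?_)
      (c2.intervalIntegrable _ _) ((hw'.mono hsub).intervalIntegrable), h1 x S (le_max_left _ _)]
  · simp
  · rw [min_eq_left hS] at ht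
    exact (hd t ht.1.le).mono fun y hy => (ht.1.trans hy).le

lemma integral_dx_smul {L : ℝ} (hL : 0 < L) (hφ : IsTest φ) (t : ℝ) {w w' : ℝ → E}
    (hw' : ContinuousOn w' (Icc 0 L))
    (hd : ∀ x ∈ Icc 0 L, HasDerivWithinAt w (w' x) (Icc 0 L) x) :
    ∫ x in 0..L, dx φ x t • w x = φ L t • w L - φ 0 t • w 0 - ∫ x in 0..L, φ x t • w' x := by
  have hsub : uIcc 0 L = Icc 0 L := uIcc_of_le hL.le
  have c1 : Continuous fun x => φ x t := hφ.isKernel.continuous.comp (Continuous.prodMk_left t)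
  have c2 : Continuous fun x => dx φ x t :=
    hφ.dx.isKernel.continuous.comp (Continuous.prodMk_left t)
  rw [intervalIntegral.integral_smul_deriv_eq_deriv_smul_of_hasDeriv_right (u := fun x => φ x t)
      (u' := fun x => dx φ x t) (v := w) c1.continuousOn
      (fun x hx => ((hd x (hsub ▸ hx)).mono hsub.le).continuousWithinAt)
      (fun x _ => (hφ.hasDerivAt_dx x t).hasDerivWithinAt) (fun x hx => ?_)
      (c2.intervalIntegrable _ _) ((hw'.mono hsub.le).intervalIntegrable)]
  · simp
  · rw [min_eq_left hL.le, max_eq_right hL.le] at hx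
    exact ((hd x (Ioo_subset_Icc_self hx)).hasDerivAt (Icc_mem_nhds hx.1 hx.2)).hasDerivWithinAt

variable {u ut ux utt uxx : ℝ → ℝ → E}

omit [CompleteSpace E] in
lemma pairing_volume' (hL : 0 < L) {Φ : ℝ → ℝ → ℝ} (hΦ : IsKernel Φ)
    (hu : ContinuousOn (uncurry u) (Icc 0 L ×ˢ Ici 0)) :
    pairing (volume.restrict (Ioc 0 L)) Φ u = ∫ x in 0..L, ∫ t in Ioi (0 : ℝ), Φ x t • u x t := by
  rw [intervalIntegral.integral_of_le hL.le]
  exact integral_prod _ (integrable_pairing (volume_restrict_compl L) hΦ hu)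

omit [CompleteSpace E] [NormedSpace ℝ E] in
lemma continuousOn_left (hu : ContinuousOn (uncurry u) (Icc 0 L ×ˢ Ici 0)) {t : ℝ} (ht : 0 ≤ t) :
    ContinuousOn (fun x => u x t) (Icc 0 L) :=
  hu.comp (Continuous.prodMk_left t).continuousOn fun _ hx => ⟨hx, ht⟩

omit [CompleteSpace E] [NormedSpace ℝ E] in
lemma continuousOn_right (hu : ContinuousOn (uncurry u) (Icc 0 L ×ˢ Ici 0)) {x : ℝ}
    (hx : x ∈ Icc 0 L) : ContinuousOn (fun t => u x t) (Ici 0) :=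
  hu.comp (Continuous.prodMk_right x).continuousOn fun _ ht => ⟨hx, ht⟩

lemma pairing_dirac_dt (hφ : IsTest φ) {a : ℝ} (ha : a ∈ Icc 0 L)
    (hu : ContinuousOn (uncurry u) (Icc 0 L ×ˢ Ici 0))
    (hut : ContinuousOn (uncurry ut) (Icc 0 L ×ˢ Ici 0))
    (hd : ∀ t ∈ Ici (0 : ℝ), HasDerivWithinAt (fun s => u a s) (ut a t) (Ici 0) t) :
    pairing (Measure.dirac a) (dt φ) u = -(φ a 0 • u a 0) - pairing (Measure.dirac a) φ ut := by
  rw [pairing_dirac ha hφ.dt.isKernel hu, pairing_dirac ha hφ.isKernel hut]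
  exact integral_dt_smul hφ a (continuousOn_right hut ha) hd

/-- With the time integral taken first, two integrations by parts in `t` leave only terms at the
initial time. -/
lemma pairing_dt_dt (hL : 0 < L) (hφ : IsTest φ)
    (hu : ContinuousOn (uncurry u) (Icc 0 L ×ˢ Ici 0))
    (hut : ContinuousOn (uncurry ut) (Icc 0 L ×ˢ Ici 0))
    (hutt : ContinuousOn (uncurry utt) (Icc 0 L ×ˢ Ici 0))
    (hd : ∀ x ∈ Icc 0 L, ∀ t ∈ Ici (0 : ℝ), HasDerivWithinAt (fun s => u x s) (ut x t) (Ici 0) t ∧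
      HasDerivWithinAt (fun s => ut x s) (utt x t) (Ici 0) t) :
    pairing (volume.restrict (Ioc 0 L)) (dt (dt φ)) u =
      (∫ x in 0..L, (φ x 0 • ut x 0 - dt φ x 0 • u x 0)) +
        pairing (volume.restrict (Ioc 0 L)) φ utt := by
  have hsub : uIcc 0 L = Icc 0 L := uIcc_of_le hL.le
  rw [pairing_volume' hL hφ.dt.dt.isKernel hu, pairing_volume' hL hφ.isKernel hutt,
    ← intervalIntegral.integral_add]
  · refine intervalIntegral.integral_congr fun x hx => ?_
    rw [hsub] at hx
    rw [integral_dt_smul hφ.dt x (continuousOn_right hut hx) fun t ht => (hd x hx t ht).1,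
      integral_dt_smul hφ x (continuousOn_right hutt hx) fun t ht => (hd x hx t ht).2]
    abel
  · refine ContinuousOn.intervalIntegrable ?_
    rw [hsub]
    have c1 : Continuous fun x => φ x 0 := hφ.isKernel.continuous.comp (Continuous.prodMk_left 0)
    have c2 : Continuous fun x => dt φ x 0 :=
      hφ.dt.isKernel.continuous.comp (Continuous.prodMk_left 0)
    exact (c1.continuousOn.smul (continuousOn_left hut le_rfl)).sub
      (c2.continuousOn.smul (continuousOn_left hu le_rfl))
  · rw [intervalIntegrable_iff_integrableOn_Ioc_of_le hL.le]
    exact (integrable_pairing (volume_restrict_compl L) hφ.isKernel hutt).integral_prod_left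

omit [CompleteSpace E] in
lemma integrable_of_dirac {a : ℝ} (ha : a ∈ Icc 0 L) {Φ : ℝ → ℝ → ℝ} (hΦ : IsKernel Φ)
    (hu : ContinuousOn (uncurry u) (Icc 0 L ×ˢ Ici 0)) :
    IntegrableOn (fun t => Φ a t • u a t) (Ioi 0) := by
  have i := integrable_pairing (dirac_compl ha) hΦ hu
  rw [spaceTime, Measure.dirac_prod] at i
  exact i.comp_measurable measurable_prodMk_left

/-- With the space integral taken first, two integrations by parts in `x` leave endpoint values,
which are pairings with Dirac masses. -/
lemma pairing_dx_dx (hL : 0 < L) (hφ : IsTest φ)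
    (hu : ContinuousOn (uncurry u) (Icc 0 L ×ˢ Ici 0))
    (hux : ContinuousOn (uncurry ux) (Icc 0 L ×ˢ Ici 0))
    (huxx : ContinuousOn (uncurry uxx) (Icc 0 L ×ˢ Ici 0))
    (hd : ∀ x ∈ Icc 0 L, ∀ t ∈ Ici (0 : ℝ),
      HasDerivWithinAt (fun y => u y t) (ux x t) (Icc 0 L) x ∧
      HasDerivWithinAt (fun y => ux y t) (uxx x t) (Icc 0 L) x) :
    pairing (volume.restrict (Ioc 0 L)) (dx (dx φ)) u =
      pairing (Measure.dirac L) (dx φ) u - pairing (Measure.dirac 0) (dx φ) u -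
        (pairing (Measure.dirac L) φ ux - pairing (Measure.dirac 0) φ ux) +
        pairing (volume.restrict (Ioc 0 L)) φ uxx := by
  have h0 : (0 : ℝ) ∈ Icc 0 L := ⟨le_rfl, hL.le⟩
  have h1 : L ∈ Icc 0 L := ⟨hL.le, le_rfl⟩
  have i1 := integrable_of_dirac h1 hφ.dx.isKernel hu
  have i2 := integrable_of_dirac h0 hφ.dx.isKernel hu
  have i3 := integrable_of_dirac h1 hφ.isKernel hux
  have i4 := integrable_of_dirac h0 hφ.isKernel hux
  have i5 : IntegrableOn (fun t => ∫ x in 0..L, φ x t • uxx x t) (Ioi 0) := by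
    simp only [intervalIntegral.integral_of_le hL.le]
    exact (integrable_pairing (volume_restrict_compl L) hφ.isKernel huxx).integral_prod_right
  have i12 : IntegrableOn (fun t => dx φ L t • u L t - dx φ 0 t • u 0 t) (Ioi 0) := i1.sub i2
  have i34 : IntegrableOn (fun t => φ L t • ux L t - φ 0 t • ux 0 t) (Ioi 0) := i3.sub i4
  have i14 : IntegrableOn (fun t => dx φ L t • u L t - dx φ 0 t • u 0 t -
    (φ L t • ux L t - φ 0 t • ux 0 t)) (Ioi 0) := i12.sub i34
  rw [pairing_volume hL hφ.dx.dx.isKernel hu, pairing_volume hL hφ.isKernel huxx,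
    pairing_dirac h1 hφ.dx.isKernel hu, pairing_dirac h0 hφ.dx.isKernel hu,
    pairing_dirac h1 hφ.isKernel hux, pairing_dirac h0 hφ.isKernel hux,
    ← integral_sub i1 i2, ← integral_sub i3 i4, ← integral_sub i12 i34,
    ← integral_add i14 i5]
  refine setIntegral_congr_fun measurableSet_Ioi fun t ht => ?_
  have ht : (0 : ℝ) ≤ t := (mem_Ioi.1 ht).le
  rw [integral_dx_smul hL hφ.dx t (continuousOn_left hux ht) fun x hx => (hd x hx t ht).1,
    integral_dx_smul hL hφ t (continuousOn_left huxx ht) fun x hx => (hd x hx t ht).2]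
  abel

/-- The weak identity for a function with continuous second derivatives that satisfies the boundary
conditions. -/
lemma weakOp_eq_of_hasDeriv (hc : 0 < c) (hL : 0 < L) (hφ : IsTest φ)
    (hu : ContinuousOn (uncurry u) (Icc 0 L ×ˢ Ici 0))
    (hut : ContinuousOn (uncurry ut) (Icc 0 L ×ˢ Ici 0))
    (hux : ContinuousOn (uncurry ux) (Icc 0 L ×ˢ Ici 0))
    (hutt : ContinuousOn (uncurry utt) (Icc 0 L ×ˢ Ici 0))
    (huxx : ContinuousOn (uncurry uxx) (Icc 0 L ×ˢ Ici 0))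
    (hd : ∀ x ∈ Icc 0 L, ∀ t ∈ Ici (0 : ℝ),
      HasDerivWithinAt (fun s => u x s) (ut x t) (Ici 0) t ∧
      HasDerivWithinAt (fun s => ut x s) (utt x t) (Ici 0) t ∧
      HasDerivWithinAt (fun y => u y t) (ux x t) (Icc 0 L) x ∧
      HasDerivWithinAt (fun y => ux y t) (uxx x t) (Icc 0 L) x)
    (hb0 : ∀ t > 0, ux 0 t = (h₁ / c) • ut 0 t) (hbL : ∀ t > 0, ux L t = -(h₂ / c) • ut L t) :
    weakOp c L h₁ h₂ φ u = (∫ t in Ioi (0 : ℝ), ∫ x in 0..L,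
      φ x t • (utt x t - c ^ 2 • uxx x t)) +
        initialOp c L h₁ h₂ φ (fun x => u x 0) fun x => ut x 0 := by
  have h0 : (0 : ℝ) ∈ Icc 0 L := ⟨le_rfl, hL.le⟩
  have h1 : L ∈ Icc 0 L := ⟨hL.le, le_rfl⟩
  have hμ := volume_restrict_compl L
  have e1 : pairing (Measure.dirac 0) φ ux = (h₁ / c) • pairing (Measure.dirac 0) φ ut := by
    rw [pairing_dirac h0 hφ.isKernel hux, pairing_dirac h0 hφ.isKernel hut, ← integral_smul]
    refine setIntegral_congr_fun measurableSet_Ioi fun t ht => ?_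
    rw [hb0 t ht, smul_comm]
  have e2 : pairing (Measure.dirac L) φ ux = -(h₂ / c) • pairing (Measure.dirac L) φ ut := by
    rw [pairing_dirac h1 hφ.isKernel hux, pairing_dirac h1 hφ.isKernel hut, ← integral_smul]
    refine setIntegral_congr_fun measurableSet_Ioi fun t ht => ?_
    rw [hbL t ht, smul_comm]
  have e3 : pairing (volume.restrict (Ioc 0 L)) (wave c φ) u =
      pairing (volume.restrict (Ioc 0 L)) (dt (dt φ)) u -
        c ^ 2 • pairing (volume.restrict (Ioc 0 L)) (dx (dx φ)) u := by
    simp only [pairing, wave, sub_smul, mul_smul]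
    have i1 : Integrable (fun z : ℝ × ℝ => c ^ 2 • dx (dx φ) z.1 z.2 • u z.1 z.2)
        (spaceTime (volume.restrict (Ioc 0 L))) :=
      (integrable_pairing hμ hφ.dx.dx.isKernel hu).smul (c ^ 2)
    rw [integral_sub (integrable_pairing hμ hφ.dt.dt.isKernel hu) i1, integral_smul]
  have e4 : (∫ t in Ioi (0 : ℝ), ∫ x in 0..L, φ x t • (utt x t - c ^ 2 • uxx x t)) =
      pairing (volume.restrict (Ioc 0 L)) φ utt - c ^ 2 • pairing (volume.restrict (Ioc 0 L)) φ uxx := by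
    rw [← pairing_volume hL hφ.isKernel (u := fun x t => utt x t - c ^ 2 • uxx x t)
      (hutt.sub (huxx.const_smul _)), pairing_sub hμ hφ.isKernel hutt
        (v := fun x t => c ^ 2 • uxx x t) (huxx.const_smul _)]
    congr 1
    simp only [pairing, smul_comm _ (c ^ 2)]
    rw [integral_smul]
  rw [e4, weakOp, initialOp, e3, pairing_dt_dt hL hφ hu hut hutt fun x hx t ht =>
      ⟨(hd x hx t ht).1, (hd x hx t ht).2.1⟩,
    pairing_dx_dx hL hφ hu hux huxx fun x hx t ht => (hd x hx t ht).2.2, e1, e2,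
    pairing_dirac_dt hφ h0 hu hut fun t ht => (hd 0 h0 t ht).1,
    pairing_dirac_dt hφ h1 hu hut fun t ht => (hd L h1 t ht).1]
  -- By the boundary conditions the endpoint terms `c² u_x` become multiples `± c h u_t`. They
  -- cancel those arising from integrating `φ_t u` along the boundary, and only the initial corner
  -- values survive.
  have e5 : c ^ 2 * (h₁ / c) = c * h₁ := by field_simp
  have e6 : c ^ 2 * (h₂ / c) = c * h₂ := by field_simp
  rw [← e5, ← e6]
  module

end Classical

lemma IsClassicalSolution.isWeakSolution (hc : 0 < c) (hL : 0 < L) {f g : ℝ → ℝ} {p u : ℝ → ℝ → ℝ}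
    (h : IsClassicalSolution c L h₁ h₂ f g p u) : IsWeakSolution c L h₁ h₂ f g p u := by
  obtain ⟨ut, ux, utt, uxx, hu, hut, hux, hutt, huxx, hd, hp, hb0, hbL, hf, hg⟩ := h
  refine (isWeakSolution_iff hL).2 ⟨hu, hf, fun φ hφ => ?_⟩
  rw [weakOp_eq_of_hasDeriv hc hL hφ hu hut hux hutt huxx hd hb0 hbL]
  congr 1
  · refine setIntegral_congr_fun measurableSet_Ioi fun t ht => ?_
    refine intervalIntegral.integral_congr_Ioo_of_le hL.le fun x hx => ?_
    rw [hp x hx t ht, smul_eq_mul, smul_eq_mul]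
    ring
  · have h0 : (0 : ℝ) ∈ Icc 0 L := ⟨le_rfl, hL.le⟩
    have h1 : L ∈ Icc 0 L := ⟨hL.le, le_rfl⟩
    simp only [initialOp]
    rw [hf L h1, hf 0 h0]
    congr 2
    refine intervalIntegral.integral_congr fun x hx => ?_
    rw [uIcc_of_le hL.le] at hx
    simp only [hf x hx, hg x hx]

end ViscousBar

/-! ### Modes as weak solutions, and the sum of their initial data. -/

namespace ViscousBar

open Filter Topology

variable {c L h₁ h₂ : ℝ} {φ : ℝ → ℝ → ℝ}

lemma continuousOn_of_hasSum {E : Type*} [NormedAddCommGroup E] [CompleteSpace E]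
    {u : ℤ → ℝ → ℝ → E} {v : ℝ → ℝ → E} (hu : ∀ r, ContinuousOn (uncurry (u r)) (Icc 0 L ×ˢ Ici 0))
    (hB : ∀ T > 0, ∃ B : ℤ → ℝ, Summable B ∧
      ∀ r, ∀ x ∈ Icc 0 L, ∀ t ∈ Icc 0 T, ‖u r x t‖ ≤ B r)
    (hs : ∀ x ∈ Icc 0 L, ∀ t ∈ Ici 0, HasSum (fun r => u r x t) (v x t)) :
    ContinuousOn (uncurry v) (Icc 0 L ×ˢ Ici 0) := by
  rintro ⟨x, t⟩ ⟨hx, ht⟩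
  have hT : 0 < t + 1 := by have : (0 : ℝ) ≤ t := ht; linarith
  obtain ⟨B, hB, hb⟩ := hB (t + 1) hT
  have hsub : Icc 0 L ×ˢ Icc 0 (t + 1) ⊆ Icc 0 L ×ˢ Ici (0 : ℝ) :=
    prod_mono le_rfl Icc_subset_Ici_self
  have h1 : ContinuousOn (fun z : ℝ × ℝ => ∑' r, u r z.1 z.2) (Icc 0 L ×ˢ Icc 0 (t + 1)) :=
    continuousOn_tsum (fun r => (hu r).mono hsub) hB fun r z hz => hb r z.1 hz.1 z.2 hz.2
  have h2 : ContinuousOn (uncurry v) (Icc 0 L ×ˢ Icc 0 (t + 1)) :=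
    h1.congr fun z hz => (hs z.1 hz.1 z.2 hz.2.1).tsum_eq.symm
  have hmem : (x, t) ∈ Icc 0 L ×ˢ Icc 0 (t + 1) := ⟨hx, ht, by linarith⟩
  -- The horizon `t + 1` leaves room above `t`, so the truncated strip is a neighbourhood of the
  -- point within the full strip.
  refine (h2 (x, t) hmem).mono_of_mem_nhdsWithin ?_
  have : Icc 0 L ×ˢ Icc 0 (t + 1) = Icc 0 L ×ˢ Ici 0 ∩ Prod.snd ⁻¹' Iic (t + 1) := by
    ext z; simp only [mem_prod, mem_Icc, mem_inter_iff, mem_Ici, mem_preimage, mem_Iic]; tauto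
  rw [this]
  exact inter_mem self_mem_nhdsWithin (mem_nhdsWithin_of_mem_nhds
    (continuous_snd.continuousAt.preimage_mem_nhds (Iic_mem_nhds (by simp))))

lemma weakOp_ofReal (u : ℝ → ℝ → ℝ) :
    weakOp c L h₁ h₂ φ (fun x t => (u x t : ℂ)) = (weakOp c L h₁ h₂ φ u : ℝ) := by
  have : ∀ (μ : Measure ℝ) (Φ : ℝ → ℝ → ℝ), pairing μ Φ (fun x t => (u x t : ℂ)) =
      (pairing μ Φ u : ℝ) := fun μ Φ => by
    simp only [pairing, Complex.real_smul, smul_eq_mul, ← Complex.ofReal_mul]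
    exact integral_ofReal
  simp only [weakOp, this, Complex.real_smul, smul_eq_mul]
  push_cast
  rfl

lemma initialOp_ofReal (f g : ℝ → ℝ) :
    initialOp c L h₁ h₂ φ (fun x => (f x : ℂ)) (fun x => (g x : ℂ)) =
      (initialOp c L h₁ h₂ φ f g : ℝ) := by
  simp only [initialOp, Complex.real_smul, smul_eq_mul, ← Complex.ofReal_mul, ← Complex.ofReal_sub]
  rw [intervalIntegral.integral_ofReal]
  push_cast
  rfl

namespace Admissible

variable (H : Admissible c L h₁ h₂)
include H

/-- The vibrating mode is a classical solution: its second space derivative is `k²` times itself, `λ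
= c k`, and the dual mode has the right values at both ends. -/
lemma weakOp_mode (hφ : IsTest φ) (a : ℂ) (r : ℤ) :
    weakOp c L h₁ h₂ φ (fun x t => a * (mode c L h₁ h₂ r x *
      Complex.exp (eigenvalue c L h₁ h₂ r * t))) =
    initialOp c L h₁ h₂ φ (fun x => a * mode c L h₁ h₂ r x)
      (fun x => a * (eigenvalue c L h₁ h₂ r * mode c L h₁ h₂ r x)) := by
  set l := eigenvalue c L h₁ h₂ r with hl
  set k := freq c L h₁ h₂ r with hk
  have hlk : l = c * k := H.eigenvalue_eq r
  have hc := H.ofReal_c_ne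
  have hm := continuous_mode (c := c) (L := L) (h₁ := h₁) (h₂ := h₂) r
  have hw := continuous_dualMode (c := c) (L := L) (h₁ := h₁) (h₂ := h₂) r
  have hde : ∀ t : ℝ, HasDerivAt (fun s : ℝ => Complex.exp (l * s)) (l * Complex.exp (l * t)) t := by
    intro t
    have h0 : HasDerivAt (fun y : ℂ => l * y) l t := by
      simpa using (hasDerivAt_id (t : ℂ)).const_mul l
    simpa [mul_comm] using h0.cexp.comp_ofReal
  have := weakOp_eq_of_hasDeriv (h₁ := h₁) (h₂ := h₂) H.hc H.hL hφ
    (u := fun x t => a * (mode c L h₁ h₂ r x * Complex.exp (l * t)))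
    (ut := fun x t => a * (mode c L h₁ h₂ r x * (l * Complex.exp (l * t))))
    (utt := fun x t => a * (mode c L h₁ h₂ r x * (l * (l * Complex.exp (l * t)))))
    (ux := fun x t => a * (k * dualMode c L h₁ h₂ r x * Complex.exp (l * t)))
    (uxx := fun x t => a * (k * (k * mode c L h₁ h₂ r x) * Complex.exp (l * t)))
    (by simp only [Function.uncurry_def]; fun_prop) (by simp only [Function.uncurry_def]; fun_prop)
    (by simp only [Function.uncurry_def]; fun_prop) (by simp only [Function.uncurry_def]; fun_prop)
    (by simp only [Function.uncurry_def]; fun_prop)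
    (fun x _ t _ => ⟨(((hde t).const_mul _).const_mul a).hasDerivWithinAt,
      ((((hde t).const_mul l).const_mul _).const_mul a).hasDerivWithinAt,
      (((hasDerivAt_mode r x).mul_const _).const_mul a).hasDerivWithinAt,
      ((((hasDerivAt_dualMode r x).const_mul k).mul_const _).const_mul a).hasDerivWithinAt⟩)
    (fun t _ => by
      simp only [dualMode_zero, mode_zero, hlk, Complex.real_smul]; push_cast; field_simp)
    (fun t _ => by
      simp only [H.dualMode_L, hlk, Complex.real_smul]; push_cast; field_simp)
  rw [this]
  have h0 : (∫ t in Ioi (0 : ℝ), ∫ x in 0..L, φ x t •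
      (a * (mode c L h₁ h₂ r x * (l * (l * Complex.exp (l * t)))) -
        c ^ 2 • (a * (k * (k * mode c L h₁ h₂ r x) * Complex.exp (l * t))))) = 0 := by
    have : ∀ x t : ℝ, φ x t • (a * (mode c L h₁ h₂ r x * (l * (l * Complex.exp (l * t)))) -
        c ^ 2 • (a * (k * (k * mode c L h₁ h₂ r x) * Complex.exp (l * t)))) = 0 := fun x t => by
      rw [Complex.real_smul, Complex.real_smul, hlk]; push_cast; ring
    simp only [this, intervalIntegral.integral_zero, integral_zero]
  rw [h0, zero_add]
  congr 1
  · ext x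
    rw [Complex.ofReal_zero, mul_zero, Complex.exp_zero, mul_one]
  · ext x
    rw [Complex.ofReal_zero, mul_zero, Complex.exp_zero]
    ring

/-- Constants supply the missing solution of frequency zero, which is not among the `λ_r`. -/
lemma weakOp_const (hφ : IsTest φ) (a : ℂ) : weakOp c L h₁ h₂ φ (fun _ _ => a) =
    initialOp c L h₁ h₂ φ (fun _ => a) (fun _ => 0) := by
  have := weakOp_eq_of_hasDeriv (h₁ := h₁) (h₂ := h₂) H.hc H.hL hφ
    (u := fun _ _ => a) (ut := fun _ _ => 0) (utt := fun _ _ => 0) (ux := fun _ _ => 0)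
    (uxx := fun _ _ => 0) continuousOn_const continuousOn_const continuousOn_const
    continuousOn_const continuousOn_const (fun x _ t _ => ⟨(hasDerivWithinAt_const _ _ _),
      hasDerivWithinAt_const _ _ _, hasDerivWithinAt_const _ _ _, hasDerivWithinAt_const _ _ _⟩)
    (by simp) (by simp)
  simpa using this

/-- The normalizing factor of the modal series. -/
lemma norm_ne_zero : ((1 - h₁ ^ 2) * L : ℂ) ≠ 0 := by
  have h1 := H.ofReal_one_sub_h₁
  have h2 := H.ofReal_one_add_h₁
  have : (1 - h₁ ^ 2 : ℂ) = (1 - h₁) * (1 + h₁) := by ring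
  rw [this]
  exact mul_ne_zero (mul_ne_zero h1 h2) H.ofReal_L_ne

lemma exists_norm_modal_le (T : ℝ) : ∃ M > 0, ∀ r : ℤ, ∀ x ∈ Icc 0 L, ∀ t ∈ Icc 0 T,
    ‖mode c L h₁ h₂ r x / eigenvalue c L h₁ h₂ r * Complex.exp (eigenvalue c L h₁ h₂ r * t)‖ ≤
      M * ‖freq c L h₁ h₂ r‖⁻¹ := by
  obtain ⟨K, hK, hb⟩ := H.exists_norm_mode_le
  have hc := H.hc
  set E := Real.exp (|(freq c L h₁ h₂ 0).re| * (c * T)) with hE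
  refine ⟨K / c * E, by positivity, fun r x hx t ht => ?_⟩
  have e1 : ‖Complex.exp (eigenvalue c L h₁ h₂ r * t)‖ ≤ E := by
    have := H.norm_exp_freq_le r (x := c * t) (R := c * T) (by
      rw [abs_of_nonneg (mul_nonneg hc.le ht.1)]; exact mul_le_mul_of_nonneg_left ht.2 hc.le)
    convert! this using 3
    rw [H.eigenvalue_eq]; push_cast; ring
  rw [norm_mul, norm_div, H.eigenvalue_eq, norm_mul, Complex.norm_real, Real.norm_of_nonneg hc.le,
    ← H.eigenvalue_eq]
  calc _ ≤ K / (c * ‖freq c L h₁ h₂ r‖) * E := by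
        gcongr
        exact (hb r x hx).1
    _ = _ := by field_simp

/-- The sum of the initial contributions of the modes. -/
lemma hasSum_initialOp (hφ : IsTest φ) {f g d : ℝ → ℝ}
    (hg : MemLp g 2 (volume.restrict (Ioc 0 L))) (hd : MemLp d 2 (volume.restrict (Ioc 0 L)))
    (hf : ∀ x ∈ Icc 0 L, f x = f 0 + ∫ y in 0..x, d y) :
    HasSum (fun r => initialOp c L h₁ h₂ φ
      (fun x => coeff c L h₁ h₂ g d r / ((1 - h₁ ^ 2) * L) / eigenvalue c L h₁ h₂ r *
        mode c L h₁ h₂ r x)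
      (fun x => coeff c L h₁ h₂ g d r / ((1 - h₁ ^ 2) * L) / eigenvalue c L h₁ h₂ r *
        (eigenvalue c L h₁ h₂ r * mode c L h₁ h₂ r x)))
    (initialOp c L h₁ h₂ φ (fun x => (f x : ℂ) - ((1 / (c * (h₁ + h₂)) *
      ((∫ ξ in 0..L, g ξ) + c * f L * h₂ + c * f 0 * h₁) : ℝ) : ℂ)) (fun x => (g x : ℂ))) := by
  have hL := H.hL
  have hn := H.norm_ne_zero
  have h0L : (0 : ℝ) ∈ Icc 0 L := ⟨le_rfl, hL.le⟩
  have hLL : L ∈ Icc 0 L := ⟨hL.le, le_rfl⟩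
  set Cst := 1 / (c * (h₁ + h₂)) * ((∫ ξ in 0..L, g ξ) + c * f L * h₂ + c * f 0 * h₁) with hC
  set a : ℤ → ℂ := fun r => coeff c L h₁ h₂ g d r / ((1 - h₁ ^ 2) * L) / eigenvalue c L h₁ h₂ r
    with ha
  have c1 : Continuous fun x => φ x 0 := hφ.isKernel.continuous.comp (Continuous.prodMk_left 0)
  have c2 : Continuous fun x => dt φ x 0 :=
    hφ.dt.isKernel.continuous.comp (Continuous.prodMk_left 0)
  -- The displacement series converges pointwise to `f` minus its static part.
  have hpt : ∀ x ∈ Icc 0 L, HasSum (fun r => a r * mode c L h₁ h₂ r x) ((f x : ℂ) - (Cst : ℝ)) := by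
    intro x hx
    have h1 := (H.hasSum_modal_initial hg hd hx).div_const ((1 - h₁ ^ 2) * L)
    convert! h1 using 1
    · ext r; simp only [ha]; ring
    · have hs : (c * (h₁ + h₂)) ≠ 0 := mul_ne_zero H.hc.ne' H.hsum
      have e : f x - Cst = (∫ y in 0..x, d y) -
          ((∫ y in 0..L, g y) + c * h₂ * ∫ y in 0..L, d y) / (c * (h₁ + h₂)) := by
        rw [hC, hf x hx, hf L hLL]
        have := H.hc.ne'
        have := H.hsum
        field_simp
        ring
      rw [← Complex.ofReal_sub, e]
      push_cast
      rw [mul_div_cancel_left₀ _ hn]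
  have hbound : ∃ B : ℤ → ℝ, Summable B ∧ ∀ r, ∀ x ∈ Icc 0 L, ‖a r * mode c L h₁ h₂ r x‖ ≤ B r := by
    obtain ⟨M, hM, hb⟩ := H.exists_norm_modal_le 0
    refine ⟨_, (H.summable_norm_div_freq (H.summable_coeff_sq hg hd)).mul_left
      (M * ‖((1 - h₁ ^ 2) * L : ℂ)‖⁻¹), fun r x hx => ?_⟩
    have h1 := hb r x hx 0 ⟨le_rfl, le_rfl⟩
    rw [Complex.ofReal_zero, mul_zero, Complex.exp_zero, mul_one] at h1
    have e : a r * mode c L h₁ h₂ r x = (mode c L h₁ h₂ r x / eigenvalue c L h₁ h₂ r) *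
        (coeff c L h₁ h₂ g d r / ((1 - h₁ ^ 2) * L)) := by simp only [ha]; ring
    rw [e, norm_mul, norm_div (coeff c L h₁ h₂ g d r), norm_div (coeff c L h₁ h₂ g d r)]
    calc _ ≤ M * ‖freq c L h₁ h₂ r‖⁻¹ * _ := by gcongr
      _ = _ := by ring
  obtain ⟨B, hB, hb⟩ := hbound
  obtain ⟨C2, hC2⟩ := isCompact_Icc.exists_bound_of_continuousOn (s := Icc 0 L) c2.continuousOn
  have hm := fun r => continuous_mode (c := c) (L := L) (h₁ := h₁) (h₂ := h₂) r
  -- The velocity series carries no factor `1 / k_r`. Its sum is taken only after testing with `φ(·,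
  -- 0)`, by completeness of the modes.
  have s1 : HasSum (fun r => ∫ x in 0..L, φ x 0 • (a r *
      (eigenvalue c L h₁ h₂ r * mode c L h₁ h₂ r x))) (∫ x in 0..L, φ x 0 • (g x : ℂ)) := by
    have hψ : MemLp (fun x => φ x 0) 2 (volume.restrict (Ioc 0 L)) := by
      have := memLp_continuous (F := fun x => (φ x 0 : ℂ)) (by fun_prop) 0 L
      exact this.re
    have h1 := (H.hasSum_coeff_mul_integral_mode hg hd hψ).div_const ((1 - h₁ ^ 2) * L)
    convert! h1 using 1
    · ext r
      rw [mul_div_right_comm, ← intervalIntegral.integral_const_mul]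
      refine intervalIntegral.integral_congr fun x _ => ?_
      simp only [ha, Complex.real_smul]
      have := H.eigenvalue_ne_zero r
      field_simp
    · rw [mul_div_cancel_left₀ _ hn]
      refine intervalIntegral.integral_congr fun x _ => ?_
      simp only [Complex.real_smul, mul_comm]
  -- The displacement series, in contrast, has summable uniform bounds, so dominated convergence
  -- applies.
  have s2 : HasSum (fun r => ∫ x in 0..L, dt φ x 0 • (a r * mode c L h₁ h₂ r x))
      (∫ x in 0..L, dt φ x 0 • ((f x : ℂ) - (Cst : ℝ))) := by
    refine intervalIntegral.hasSum_integral_of_dominated_convergence (fun r _ => C2 * B r)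
      (fun r => ?_) (fun r => ae_of_all _ fun x hx => ?_) (ae_of_all _ fun _ _ => hB.mul_left C2)
      intervalIntegrable_const (ae_of_all _ fun x hx => ?_)
    · exact Continuous.aestronglyMeasurable (by fun_prop)
    · rw [uIoc_of_le hL.le] at hx
      rw [norm_smul]
      exact mul_le_mul (hC2 x (Ioc_subset_Icc_self hx)) (hb r x (Ioc_subset_Icc_self hx))
        (norm_nonneg _) ((norm_nonneg _).trans (hC2 x (Ioc_subset_Icc_self hx)))
    · rw [uIoc_of_le hL.le] at hx
      exact (hpt x (Ioc_subset_Icc_self hx)).const_smul _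
  have hgi : IntervalIntegrable (fun x => φ x 0 • (g x : ℂ)) volume 0 L := by
    have := (hg.ofReal (K := ℂ)).intervalIntegrable hL.le
    exact this.continuousOn_smul c1.continuousOn
  have hfi : IntervalIntegrable (fun x => dt φ x 0 • ((f x : ℂ) - (Cst : ℝ))) volume 0 L := by
    have hfc : ContinuousOn f (Icc 0 L) := by
      have h1 := intervalIntegral.continuousOn_primitive_interval (a := 0) (b := L) (f := d)
        (μ := volume) (by
          rw [uIcc_of_le hL.le, integrableOn_Icc_iff_integrableOn_Ioc]
          exact hd.integrable one_le_two)
      rw [uIcc_of_le hL.le] at h1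
      exact (continuousOn_const.add h1).congr hf
    refine ContinuousOn.intervalIntegrable ?_
    rw [uIcc_of_le hL.le]
    exact c2.continuousOn.smul ((Complex.continuous_ofReal.comp_continuousOn hfc).sub
      continuousOn_const)
  simp only [initialOp]
  rw [intervalIntegral.integral_sub hgi hfi]
  refine (((s1.sub s2).congr_fun fun r => ?_).add
    (((hpt L hLL).const_smul _).const_smul _)).add (((hpt 0 h0L).const_smul _).const_smul _)
  rw [← intervalIntegral.integral_sub]
  · exact Continuous.intervalIntegrable (by fun_prop) _ _
  · exact Continuous.intervalIntegrable (by fun_prop) _ _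

end Admissible

end ViscousBar

/-! ### Duhamel superposition and Fubini. -/

namespace ViscousBar

open Filter Topology

variable {c L h₁ h₂ : ℝ} {φ : ℝ → ℝ → ℝ}

/-- The Duhamel superposition of the translates of `e` with weight `a`. -/
noncomputable def duhamel (a : ℝ → ℂ) (e : ℝ → ℝ → ℂ) (x t : ℝ) : ℂ :=
  ∫ τ in 0..t, a τ * e x (t - τ)

/-- Fubini on the region `0 < τ ≤ t`, followed by the substitution `t ↦ t + τ`, moves the delay from
the solution to the kernel. -/
lemma pairing_duhamel {μ : Measure ℝ} [IsFiniteMeasure μ] (hμ : μ (Icc 0 L)ᶜ = 0) {Φ : ℝ → ℝ → ℝ}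
    (hΦ : IsKernel Φ) {a : ℝ → ℂ} (ha : ∀ T, IntegrableOn a (Ioc 0 T)) {e : ℝ → ℝ → ℂ}
    (he : Continuous (uncurry e)) :
    IntegrableOn (fun τ => a τ * pairing μ (fun x t => Φ x (t + τ)) e) (Ioi 0) ∧
    pairing μ Φ (duhamel a e) =
      ∫ τ in Ioi (0 : ℝ), a τ * pairing μ (fun x t => Φ x (t + τ)) e := by
  obtain ⟨T, hT, hT'⟩ := hΦ.exists_bound_support
  set ρ : Measure ℝ := volume.restrict (Ioi 0) with hρ
  have ha' : AEStronglyMeasurable a ρ := by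
    have : Ioi (0 : ℝ) = ⋃ n : ℕ, Ioc 0 (n : ℝ) := by
      ext t
      simp only [mem_Ioi, mem_iUnion, mem_Ioc]
      exact ⟨fun h => (exists_nat_ge t).imp fun n hn => ⟨h, hn⟩, fun ⟨_, h, _⟩ => h⟩
    rw [hρ, this]
    exact aestronglyMeasurable_iUnion_iff.2 fun n => (ha n).aestronglyMeasurable
  -- The cut-off at `τ ≤ t` replaces the variable upper limit of the Duhamel integral by a product
  -- domain.
  set G : ℝ → ℝ × ℝ → ℂ := fun τ z =>
    if τ ≤ z.2 then a τ * (Φ z.1 z.2 • e z.1 (z.2 - τ)) else 0 with hG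
  have hcont : Continuous fun w : ℝ × ℝ × ℝ => Φ w.2.1 w.2.2 • e w.2.1 (w.2.2 - w.1) :=
    (hΦ.continuous.comp continuous_snd).smul (he.comp
      ((continuous_fst.comp continuous_snd).prodMk
        ((continuous_snd.comp continuous_snd).sub continuous_fst)))
  obtain ⟨M, hM⟩ := ((isCompact_Icc (a := (0 : ℝ)) (b := T)).prod
    ((isCompact_Icc (a := (0 : ℝ)) (b := L)).prod
      (isCompact_Icc (a := (0 : ℝ)) (b := T)))).exists_bound_of_continuousOn hcont.continuousOn
  have hGi : Integrable (uncurry G) (ρ.prod (spaceTime μ)) := by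
    -- The majorant is `‖a‖ M` on times up to `T`: later the kernel vanishes, and `τ ≤ t` then
    -- forces `τ ≤ T` as well.
    have b1 : Integrable ((Ioc 0 T).indicator a) ρ := by
      rw [integrable_indicator_iff measurableSet_Ioc, IntegrableOn, hρ,
        Measure.restrict_restrict measurableSet_Ioc,
        inter_eq_self_of_subset_left Ioc_subset_Ioi_self]
      exact ha T
    have b2 : Integrable ((univ ×ˢ Iic T : Set (ℝ × ℝ)).indicator fun _ => M) (spaceTime μ) := by
      rw [integrable_indicator_iff (MeasurableSet.univ.prod measurableSet_Iic)]
      refine integrableOn_const ?_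
      rw [spaceTime, Measure.prod_prod, Measure.restrict_apply measurableSet_Iic,
        inter_comm, Ioi_inter_Iic, Real.volume_Ioc]
      exact ENNReal.mul_ne_top (measure_ne_top _ _) ENNReal.ofReal_ne_top
    refine (b1.norm.mul_prod b2).mono' ?_ ?_
    · have : uncurry G = {w : ℝ × ℝ × ℝ | w.1 ≤ w.2.2}.indicator
          fun w => a w.1 * (Φ w.2.1 w.2.2 • e w.2.1 (w.2.2 - w.1)) := by
        ext w
        simp only [hG, uncurry, indicator, mem_ofPred_eq]
      rw [this]
      exact (ha'.comp_fst.mul hcont.aestronglyMeasurable).indicator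
        (measurableSet_le measurable_fst (measurable_snd.comp measurable_snd))
    · have h1 : ∀ᵐ w ∂(ρ.prod (spaceTime μ)), w.1 ∈ Ioi (0 : ℝ) :=
        Measure.quasiMeasurePreserving_fst.ae (ae_restrict_mem measurableSet_Ioi)
      have h2 : ∀ᵐ w ∂(ρ.prod (spaceTime μ)), w.2 ∈ Icc 0 L ×ˢ Ici (0 : ℝ) :=
        Measure.quasiMeasurePreserving_snd.ae (ae_spaceTime hμ)
      filter_upwards [h1, h2] with w hw1 hw2
      have hw1 : 0 < w.1 := hw1
      have hw3 : 0 ≤ w.2.2 := hw2.2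
      by_cases hle : w.1 ≤ w.2.2
      · by_cases hTt : T ≤ w.2.2
        · have : uncurry G w = 0 := by simp [hG, uncurry, hT' _ _ hTt]
          rw [this, norm_zero]
          refine mul_nonneg (norm_nonneg _) (indicator_nonneg (fun z _ => ?_) _)
          exact (norm_nonneg _).trans (hM (0, w.2.1, 0) ⟨⟨le_rfl, hT.le⟩, hw2.1, le_rfl, hT.le⟩)
        · rw [not_le] at hTt
          have m1 : w.1 ∈ Ioc 0 T := ⟨hw1, hle.trans hTt.le⟩
          have m2 : w.2 ∈ (univ ×ˢ Iic T : Set (ℝ × ℝ)) := ⟨mem_univ _, hTt.le⟩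
          simp only [hG, uncurry, hle, if_true, norm_mul (a w.1), indicator_of_mem m1,
            indicator_of_mem m2]
          gcongr
          exact hM w ⟨⟨hw1.le, m1.2⟩, hw2.1, hw3, hTt.le⟩
      · have : uncurry G w = 0 := by simp [hG, uncurry, hle]
        rw [this, norm_zero]
        refine mul_nonneg (norm_nonneg _) (indicator_nonneg (fun z _ => ?_) _)
        by_cases hL : w.2.1 ∈ Icc 0 L
        · exact (norm_nonneg _).trans (hM (0, w.2.1, 0) ⟨⟨le_rfl, hT.le⟩, hw2.1, le_rfl, hT.le⟩)
        · exact absurd hw2.1 hL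
  have hinner : ∀ τ ∈ Ioi (0 : ℝ), ∫ z, G τ z ∂spaceTime μ =
      a τ * pairing μ (fun x t => Φ x (t + τ)) e := by
    intro τ hτ
    have hτ : 0 < τ := hτ
    have hsh : Continuous (uncurry fun x t => e x (t - τ)) :=
      he.comp (continuous_fst.prodMk (continuous_snd.sub continuous_const))
    have i1 := integrable_pairing (u := fun x t => e x (t - τ)) hμ hΦ hsh.continuousOn
    have i2 : Integrable ({z : ℝ × ℝ | τ ≤ z.2}.indicator
        fun z => Φ z.1 z.2 • e z.1 (z.2 - τ)) (spaceTime μ) :=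
      i1.indicator (measurableSet_le measurable_const measurable_snd)
    have e1 : ∀ z, G τ z = a τ * ({z : ℝ × ℝ | τ ≤ z.2}.indicator
        (fun z => Φ z.1 z.2 • e z.1 (z.2 - τ)) z) := fun z => by
      simp only [hG, indicator, mem_ofPred_eq]; split_ifs <;> simp
    simp only [e1]
    rw [integral_const_mul]
    congr 1
    rw [spaceTime, integral_prod_symm _ i2,
      pairing_eq_integral_integral (L := L) hμ (hΦ.shift τ) he.continuousOn]
    set F : ℝ → ℂ := fun t => ∫ x, Φ x t • e x (t - τ) ∂μ with hF
    have e2 : ∀ t, ∫ x, {z : ℝ × ℝ | τ ≤ z.2}.indicator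
        (fun z => Φ z.1 z.2 • e z.1 (z.2 - τ)) (x, t) ∂μ = (Ici τ).indicator F t := fun t => by
      by_cases ht : τ ≤ t <;> simp [indicator, ht, hF]
    have e3 : ∀ t, ∫ x, Φ x (t + τ) • e x t ∂μ = F (t + τ) := fun t => by simp [hF]
    simp only [e2, e3]
    rw [setIntegral_indicator measurableSet_Ici, inter_eq_self_of_subset_right
      (s := Ioi (0 : ℝ)) (t := Ici τ) (Ici_subset_Ioi.2 hτ),
      integral_Ici_eq_integral_Ioi, ← (measurePreserving_add_right volume τ).setIntegral_preimage_emb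
        (measurableEmbedding_addRight τ) F (Ioi τ)]
    simp
  have houter : ∀ᵐ z ∂spaceTime μ, Φ z.1 z.2 • duhamel a e z.1 z.2 = ∫ τ, G τ z ∂ρ := by
    filter_upwards [ae_spaceTime (L := L) hμ] with z hz
    have hz2 : 0 ≤ z.2 := hz.2
    rw [duhamel, intervalIntegral.integral_of_le hz2, ← integral_smul]
    have : ∀ τ, G τ z = (Iic z.2).indicator
        (fun τ => Φ z.1 z.2 • (a τ * e z.1 (z.2 - τ))) τ := fun τ => by
      simp only [hG, indicator, mem_Iic, mul_smul_comm]
    simp only [this]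
    rw [hρ, setIntegral_indicator measurableSet_Iic, Ioi_inter_Iic]
  constructor
  · refine (hGi.integral_prod_left).congr ?_
    filter_upwards [ae_restrict_mem measurableSet_Ioi] with τ hτ using hinner τ hτ
  · rw [pairing, integral_congr_ae houter, ← integral_integral_swap hGi]
    exact setIntegral_congr_fun measurableSet_Ioi hinner

end ViscousBar

/-! ### Uniqueness by characteristic coordinates. -/

namespace ViscousBar

open Filter Topology

variable {c L h₁ h₂ : ℝ}

/-- The product of a right moving and a left moving wave. -/
noncomputable def waveProd (c : ℝ) (A B : ℝ → ℝ) (x t : ℝ) : ℝ := A (t - x / c) * B (t + x / c)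

lemma hasDerivAt_waveProd_right {A B : ℝ → ℝ} (hA : Differentiable ℝ A) (hB : Differentiable ℝ B)
    (x t : ℝ) : HasDerivAt (fun s => waveProd c A B x s)
      (waveProd c (deriv A) B x t + waveProd c A (deriv B) x t) t := by
  have h1 : HasDerivAt (fun s => A (s - x / c)) (deriv A (t - x / c)) t :=
    (hA _).hasDerivAt.comp_sub_const t _
  have h2 : HasDerivAt (fun s => B (s + x / c)) (deriv B (t + x / c)) t :=
    (hB _).hasDerivAt.comp_add_const t _
  exact h1.mul h2

lemma hasDerivAt_waveProd_left {A B : ℝ → ℝ} (hA : Differentiable ℝ A) (hB : Differentiable ℝ B)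
    (x t : ℝ) : HasDerivAt (fun y => waveProd c A B y t)
      (c⁻¹ * (waveProd c A (deriv B) x t - waveProd c (deriv A) B x t)) x := by
  have h0 : HasDerivAt (fun y : ℝ => y / c) c⁻¹ x := by
    simpa using (hasDerivAt_id x).div_const c
  have h1 : HasDerivAt (fun y => A (t - y / c)) (deriv A (t - x / c) * -c⁻¹) x :=
    (hA _).hasDerivAt.comp x (h0.const_sub t)
  have h2 : HasDerivAt (fun y => B (t + y / c)) (deriv B (t + x / c) * c⁻¹) x :=
    (hB _).hasDerivAt.comp x (h0.const_add t)
  refine (h1.mul h2).congr_deriv ?_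
  simp only [waveProd]; ring

lemma isTest_waveProd (hc : 0 < c) {A B : ℝ → ℝ} (hA : ContDiff ℝ ∞ A) (hB : ContDiff ℝ ∞ B)
    (hA' : HasCompactSupport A) (hB' : HasCompactSupport B) : IsTest (waveProd c A B) := by
  constructor
  · exact (hA.comp (contDiff_snd.sub (contDiff_fst.div_const c))).mul
      (hB.comp (contDiff_snd.add (contDiff_fst.div_const c)))
  · have hcont : Continuous fun z : ℝ × ℝ => (c * (z.2 - z.1) / 2, (z.1 + z.2) / 2) := by fun_prop
    refine HasCompactSupport.intro ((hA'.isCompact.prod hB'.isCompact).image hcont) ?_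
    rintro ⟨x, t⟩ hz
    by_contra hne
    have h1 : A (t - x / c) ≠ 0 := left_ne_zero_of_mul hne
    have h2 : B (t + x / c) ≠ 0 := right_ne_zero_of_mul hne
    refine hz ⟨(t - x / c, t + x / c), ⟨subset_tsupport _ h1, subset_tsupport _ h2⟩, ?_⟩
    ext <;> field_simp <;> ring

/-- In characteristic coordinates the wave operator is four times the mixed second derivative. -/
lemma wave_waveProd (hc : 0 < c) {A B : ℝ → ℝ} (hA : ContDiff ℝ ∞ A) (hB : ContDiff ℝ ∞ B)
    (x t : ℝ) : wave c (waveProd c A B) x t = 4 * waveProd c (deriv A) (deriv B) x t := by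
  have dA := hA.differentiable (by simp)
  have dB := hB.differentiable (by simp)
  have hA1 : ContDiff ℝ ∞ (deriv A) := (contDiff_infty_iff_deriv.1 hA).2
  have hB1 : ContDiff ℝ ∞ (deriv B) := (contDiff_infty_iff_deriv.1 hB).2
  have dA1 := hA1.differentiable (by simp)
  have dB1 := hB1.differentiable (by simp)
  have e1 : dt (waveProd c A B) = fun x t =>
      waveProd c (deriv A) B x t + waveProd c A (deriv B) x t := by
    ext x t; exact (hasDerivAt_waveProd_right dA dB x t).deriv
  have e2 : dx (waveProd c A B) = fun x t =>
      c⁻¹ * (waveProd c A (deriv B) x t - waveProd c (deriv A) B x t) := by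
    ext x t; exact (hasDerivAt_waveProd_left dA dB x t).deriv
  have e3 := (hasDerivAt_waveProd_right (c := c) dA1 dB x t).fun_add
    (hasDerivAt_waveProd_right (c := c) dA dB1 x t)
  have e4 := ((hasDerivAt_waveProd_left (c := c) dA dB1 x t).fun_sub
      (hasDerivAt_waveProd_left (c := c) dA1 dB x t)).const_mul c⁻¹
  rw [wave, e1, e2, dt, dx, e3.deriv, e4.deriv]
  field_simp
  ring

lemma exists_smooth_eq_one (R : ℝ) : ∃ χ : ℝ → ℝ, ContDiff ℝ ∞ χ ∧ HasCompactSupport χ ∧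
    ∀ s, |s| ≤ R → χ s = 1 ∧ deriv χ s = 0 := by
  let χ : ContDiffBump (0 : ℝ) := ⟨|R| + 1, |R| + 2, by positivity, by linarith⟩
  refine ⟨χ, χ.contDiff, χ.hasCompactSupport, fun s hs => ?_⟩
  have hs' : |s| < |R| + 1 := by linarith [le_abs_self R]
  have h1 : ∀ y ∈ Metric.ball (0 : ℝ) (|R| + 1), χ y = 1 := fun y hy =>
    χ.one_of_mem_closedBall (Metric.ball_subset_closedBall hy)
  have hs0 : s ∈ Metric.ball (0 : ℝ) (|R| + 1) := by simpa using hs'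
  refine ⟨h1 s hs0, ?_⟩
  have : (χ : ℝ → ℝ) =ᶠ[𝓝 s] fun _ => 1 :=
    (Metric.isOpen_ball.eventually_mem hs0).mono h1
  rw [this.deriv_eq, deriv_const]

lemma _root_.HasCompactSupport.exists_abs_le {ψ : ℝ → ℝ} (h : HasCompactSupport ψ) :
    ∃ R > 0, ∀ s, ψ s ≠ 0 → |s| ≤ R := by
  obtain ⟨R, hR⟩ := h.isCompact.isBounded.subset_closedBall 0
  refine ⟨max R 1, by positivity, fun s hs => ?_⟩
  have := hR (subset_tsupport _ hs)
  rw [mem_closedBall_zero_iff, Real.norm_eq_abs] at this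
  exact this.trans (le_max_left _ _)

/-- A test function has a compactly supported primitive on a half line. -/
lemma exists_primitive {ψ : ℝ → ℝ} (hψ : ContDiff ℝ ∞ ψ) (hψ' : HasCompactSupport ψ) (K : ℝ) :
    ∃ A : ℝ → ℝ, ContDiff ℝ ∞ A ∧ HasCompactSupport A ∧ ∀ s, -K ≤ s → deriv A s = ψ s := by
  obtain ⟨R, hR, hR'⟩ := hψ'.exists_abs_le
  -- The cut-off equals `1` on `[-K, R]`. To the right of `R` its values are irrelevant, since the
  -- primitive based at `R` vanishes there.
  obtain ⟨χ, h1, h2, h3⟩ := exists_smooth_eq_one (|K| + R)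
  set P : ℝ → ℝ := fun s => ∫ y in R..s, ψ y with hP
  have hPd : ∀ s, HasDerivAt P (ψ s) s := fun s =>
    intervalIntegral.integral_hasDerivAt_right (hψ.continuous.intervalIntegrable _ _)
      hψ.continuous.stronglyMeasurable.stronglyMeasurableAtFilter hψ.continuous.continuousAt
  have hPs : ContDiff ℝ ∞ P := by
    rw [contDiff_infty_iff_deriv]
    refine ⟨fun s => (hPd s).differentiableAt, ?_⟩
    rwa [show deriv P = ψ from funext fun s => (hPd s).deriv]
  refine ⟨fun s => χ s * P s, h1.mul hPs, h2.mul_right, fun s hs => ?_⟩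
  have hd : HasDerivAt (fun s => χ s * P s) (deriv χ s * P s + χ s * ψ s) s :=
    ((h1.differentiable (by simp)) s).hasDerivAt.mul (hPd s)
  rw [hd.deriv]
  by_cases hsR : |s| ≤ |K| + R
  · rw [(h3 s hsR).1, (h3 s hsR).2]; ring
  · have hs2 : R < s := by
      by_contra h
      refine hsR (abs_le.2 ⟨?_, ?_⟩)
      · linarith [le_abs_self K]
      · linarith [abs_nonneg K]
    have hψ0 : ∀ y, R < y → ψ y = 0 := fun y hy => by
      by_contra h
      have := hR' y h
      linarith [le_abs_self y]
    have hP0 : P s = 0 := by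
      rw [hP]
      simp only
      rw [intervalIntegral.integral_of_le hs2.le]
      exact setIntegral_eq_zero_of_forall_eq_zero fun y hy => hψ0 y hy.1
    rw [hP0, hψ0 s hs2]; ring

/-- A continuous function with vanishing weak derivative which vanishes near `-∞` is zero. -/
lemma eq_zero_of_integral_deriv_mul {F : ℝ → ℝ} (hF : Continuous F) {K : ℝ}
    (h0 : ∀ s, s ≤ -K → F s = 0) (h : ∀ A : ℝ → ℝ, ContDiff ℝ ∞ A → HasCompactSupport A →
      ∫ s, deriv A s * F s = 0) : F = 0 := by
  have hae : ∀ᵐ s, F s = 0 := by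
    refine ae_eq_zero_of_integral_contDiff_smul_eq_zero hF.locallyIntegrable fun ψ hψ hψ' => ?_
    obtain ⟨A, h1, h2, h3⟩ := exists_primitive hψ hψ' K
    rw [← h A h1 h2]
    refine integral_congr_ae (ae_of_all _ fun s => ?_)
    by_cases hs : -K ≤ s
    · simp only [h3 s hs, smul_eq_mul]
    · simp only [h0 s (not_le.1 hs).le, smul_zero, mul_zero]
  exact (Continuous.ae_eq_iff_eq volume hF continuous_const).1 hae

section KernelLinear

variable {E : Type*} [NormedAddCommGroup E] [NormedSpace ℝ E] {μ : Measure ℝ}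
  [IsFiniteMeasure μ] {Φ Ψ : ℝ → ℝ → ℝ} {u : ℝ → ℝ → E}

lemma pairing_kernel_add (hμ : μ (Icc 0 L)ᶜ = 0) (hΦ : IsKernel Φ) (hΨ : IsKernel Ψ)
    (hu : ContinuousOn (uncurry u) (Icc 0 L ×ˢ Ici 0)) :
    pairing μ (fun x t => Φ x t + Ψ x t) u = pairing μ Φ u + pairing μ Ψ u := by
  simp only [pairing, add_smul]
  exact integral_add (integrable_pairing hμ hΦ hu) (integrable_pairing hμ hΨ hu)

lemma pairing_kernel_sub (hμ : μ (Icc 0 L)ᶜ = 0) (hΦ : IsKernel Φ) (hΨ : IsKernel Ψ)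
    (hu : ContinuousOn (uncurry u) (Icc 0 L ×ˢ Ici 0)) :
    pairing μ (fun x t => Φ x t - Ψ x t) u = pairing μ Φ u - pairing μ Ψ u := by
  simp only [pairing, sub_smul]
  exact integral_sub (integrable_pairing hμ hΦ hu) (integrable_pairing hμ hΨ hu)

omit [IsFiniteMeasure μ] in
lemma pairing_kernel_const_mul (a : ℝ) :
    pairing μ (fun x t => a * Φ x t) u = a • pairing μ Φ u := by
  simp only [pairing, mul_smul]
  exact integral_smul _ _

omit [IsFiniteMeasure μ] in
lemma pairing_kernel_congr (hμ : μ (Icc 0 L)ᶜ = 0)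
    (h : ∀ x ∈ Icc 0 L, ∀ t ∈ Ici 0, Φ x t = Ψ x t) : pairing μ Φ u = pairing μ Ψ u := by
  refine integral_congr_ae ?_
  filter_upwards [ae_spaceTime (L := L) hμ] with z hz
  rw [h _ hz.1 _ hz.2]

end KernelLinear

namespace Admissible

variable (H : Admissible c L h₁ h₂)
include H

section Uniqueness

variable {d : ℝ → ℝ → ℝ} (hd : ContinuousOn (uncurry d) (Icc 0 L ×ˢ Ici 0))
  (hw : ∀ φ, IsTest φ → weakOp c L h₁ h₂ φ d = 0)
include hd hw

/-- Since `φ_t = A' B + A B'` and `c φ_x = A B' - A' B`, the boundary terms combine to the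
coefficients `h ± 1`. -/
lemma pairing_waveProd {A B : ℝ → ℝ} (hA : ContDiff ℝ ∞ A) (hB : ContDiff ℝ ∞ B)
    (hA' : HasCompactSupport A) (hB' : HasCompactSupport B) :
    4 * pairing (volume.restrict (Ioc 0 L)) (waveProd c (deriv A) (deriv B)) d =
      c * ((h₂ + 1) * pairing (Measure.dirac L) (waveProd c (deriv A) B) d +
        (h₂ - 1) * pairing (Measure.dirac L) (waveProd c A (deriv B)) d +
        (h₁ - 1) * pairing (Measure.dirac 0) (waveProd c (deriv A) B) d +
        (h₁ + 1) * pairing (Measure.dirac 0) (waveProd c A (deriv B)) d) := by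
  have hc := H.hc
  have h0 := dirac_compl (L := L) ⟨le_rfl, H.hL.le⟩
  have h1 := dirac_compl (L := L) ⟨H.hL.le, le_rfl⟩
  have dA := hA.differentiable (by simp)
  have dB := hB.differentiable (by simp)
  have hA1 : ContDiff ℝ ∞ (deriv A) := (contDiff_infty_iff_deriv.1 hA).2
  have hB1 : ContDiff ℝ ∞ (deriv B) := (contDiff_infty_iff_deriv.1 hB).2
  have k1 := (isTest_waveProd hc hA1 hB hA'.deriv hB').isKernel
  have k2 := (isTest_waveProd hc hA hB1 hA' hB'.deriv).isKernel
  have e1 : dt (waveProd c A B) = fun x t =>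
      waveProd c (deriv A) B x t + waveProd c A (deriv B) x t := by
    ext x t; exact (hasDerivAt_waveProd_right dA dB x t).deriv
  have e2 : dx (waveProd c A B) = fun x t =>
      c⁻¹ * (waveProd c A (deriv B) x t - waveProd c (deriv A) B x t) := by
    ext x t; exact (hasDerivAt_waveProd_left dA dB x t).deriv
  have e3 : wave c (waveProd c A B) = fun x t => 4 * waveProd c (deriv A) (deriv B) x t := by
    ext x t; exact wave_waveProd hc hA hB x t
  have := hw _ (isTest_waveProd hc hA hB hA' hB')
  rw [weakOp, e1, e2, e3, pairing_kernel_const_mul, pairing_kernel_const_mul,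
    pairing_kernel_const_mul, pairing_kernel_add h0 k1 k2 hd, pairing_kernel_add h1 k1 k2 hd,
    pairing_kernel_sub h0 k2 k1 hd, pairing_kernel_sub h1 k2 k1 hd] at this
  simp only [smul_eq_mul] at this
  field_simp at this
  linear_combination this

variable (hi : ∀ x ∈ Icc 0 L, d x 0 = 0)
include hi

omit hw H hi in
lemma continuous_boundary {a : ℝ} (ha : a ∈ Icc 0 L) : Continuous fun s => d a (max s 0) := by
  have h1 := continuousOn_right hd ha
  exact h1.comp_continuous (continuous_id.max continuous_const) fun s =>
    mem_Ici.2 (le_max_right _ _)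

-- The boundary trace is extended by zero to negative times through `max · 0`, which is legitimate
-- because `d` vanishes initially; translations then need no case distinction.
omit hw H hd in
lemma integral_Ioi_mul_boundary {a : ℝ} (ha : a ∈ Icc 0 L) (F : ℝ → ℝ) (b : ℝ) :
    ∫ t in Ioi 0, F (t - b) * d a t = ∫ s, F s * d a (max (s + b) 0) := by
  rw [← integral_sub_right_eq_self (fun s => F s * d a (max (s + b) 0)) b]
  simp only [sub_add_cancel]
  rw [← setIntegral_eq_integral_of_forall_compl_eq_zero (s := Ioi 0)
    (f := fun t => F (t - b) * d a (max t 0)) fun t ht => ?_]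
  · refine setIntegral_congr_fun measurableSet_Ioi fun t ht => ?_
    simp only [max_eq_left (mem_Ioi.1 ht).le]
  · simp only [max_eq_right (not_lt.1 (show ¬ 0 < t from ht)), hi a ha, mul_zero]

/-- Taking `B = 1` on all relevant arguments removes `B'` and leaves only `A'` tested against
boundary values: the wave along `t - x/c` links `x = 0` to `x = L`. -/
lemma boundary_relation_L (s : ℝ) :
    (h₂ + 1) * d L (max (s + L / c) 0) + (h₁ - 1) * d 0 (max s 0) = 0 := by
  have hc := H.hc
  have hL := H.hL
  have h0 : (0 : ℝ) ∈ Icc 0 L := ⟨le_rfl, hL.le⟩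
  have hLL : L ∈ Icc 0 L := ⟨hL.le, le_rfl⟩
  have hLc : 0 < L / c := div_pos hL hc
  have cL : Continuous fun s => d L (max (s + L / c) 0) :=
    (continuous_boundary hd hLL).comp (continuous_id.add continuous_const)
  have c0 := continuous_boundary hd h0
  refine congrFun (eq_zero_of_integral_deriv_mul (K := L / c)
    (F := fun s => (h₂ + 1) * d L (max (s + L / c) 0) + (h₁ - 1) * d 0 (max s 0))
    ((continuous_const.mul cL).add (continuous_const.mul c0)) (fun s hs => ?_)
    fun A hA hA' => ?_) s
  · rw [max_eq_right (by linarith), max_eq_right (by linarith), hi L hLL, hi 0 h0]; ring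
  · obtain ⟨R, hR, hR'⟩ := hA'.exists_abs_le
    obtain ⟨R2, hR2, hR2'⟩ := hA'.deriv.exists_abs_le
    -- The arguments `t + x/c` and `t - x/c` differ by at most `2L/c` on the bar, hence this radius.
    obtain ⟨B, hB, hB', hB1⟩ := exists_smooth_eq_one (R + R2 + 2 * (L / c))
    have key := H.pairing_waveProd hd hw hA hB hA' hB'
    have hA1 : ContDiff ℝ ∞ (deriv A) := (contDiff_infty_iff_deriv.1 hA).2
    have hBe : ∀ x ∈ Icc 0 L, ∀ t, |t - x / c| ≤ R + R2 → B (t + x / c) = 1 ∧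
        deriv B (t + x / c) = 0 := fun x hx t ht => by
      refine hB1 _ ?_
      have h1 : x / c ≤ L / c := by gcongr; exact hx.2
      have h2 : 0 ≤ x / c := div_nonneg hx.1 hc.le
      rw [abs_le] at ht ⊢
      constructor <;> linarith [ht.1, ht.2]
    have w1 : ∀ F : ℝ → ℝ, (∀ s, F s ≠ 0 → |s| ≤ R + R2) → ∀ x ∈ Icc 0 L, ∀ t ∈ Ici (0 : ℝ),
        waveProd c F (deriv B) x t = 0 := fun F hF x hx t _ => by
      by_cases h : F (t - x / c) = 0
      · simp [waveProd, h]
      · simp [waveProd, (hBe x hx t (hF _ h)).2]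
    have w2 : ∀ x ∈ Icc 0 L, ∀ t, waveProd c (deriv A) B x t = deriv A (t - x / c) :=
        fun x hx t => by
      by_cases h : deriv A (t - x / c) = 0
      · simp [waveProd, h]
      · rw [waveProd, (hBe x hx t ((hR2' _ h).trans (by linarith))).1, mul_one]
    have z : ∀ (μ : Measure ℝ), pairing μ (fun _ _ => (0 : ℝ)) d = 0 := fun μ => by simp [pairing]
    have hAR : ∀ s, A s ≠ 0 → |s| ≤ R + R2 := fun s hs => (hR' s hs).trans (by linarith)
    have hAR2 : ∀ s, deriv A s ≠ 0 → |s| ≤ R + R2 := fun s hs => (hR2' s hs).trans (by linarith)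
    have kk := (isTest_waveProd hc hA1 hB hA'.deriv hB').isKernel
    rw [pairing_kernel_congr (volume_restrict_compl L) (w1 _ hAR2),
      pairing_kernel_congr (dirac_compl h0) (w1 _ hAR),
      pairing_kernel_congr (dirac_compl hLL) (w1 _ hAR), z, z, z,
      pairing_dirac hLL kk hd, pairing_dirac h0 kk hd] at key
    simp only [w2 L hLL, w2 0 h0, smul_eq_mul, zero_div] at key
    rw [integral_Ioi_mul_boundary hi hLL (deriv A) (L / c),
      integral_Ioi_mul_boundary hi h0 (deriv A) 0] at key
    simp only [add_zero] at key
    have i1 : Integrable fun s => deriv A s * d L (max (s + L / c) 0) :=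
      (hA1.continuous.mul cL).integrable_of_hasCompactSupport hA'.deriv.mul_right
    have i2 : Integrable fun s => deriv A s * d 0 (max s 0) :=
      (hA1.continuous.mul c0).integrable_of_hasCompactSupport hA'.deriv.mul_right
    have e : ∀ s, deriv A s * ((h₂ + 1) * d L (max (s + L / c) 0) + (h₁ - 1) * d 0 (max s 0)) =
        (h₂ + 1) * (deriv A s * d L (max (s + L / c) 0)) +
          (h₁ - 1) * (deriv A s * d 0 (max s 0)) := fun s => by ring
    simp only [e]
    rw [integral_add (i1.const_mul _) (i2.const_mul _), integral_const_mul, integral_const_mul]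
    have := mul_left_cancel₀ hc.ne' (key.symm.trans (by simp : (4 : ℝ) * 0 = c * 0))
    linarith

/-- The same argument with `A = 1`, for the wave along `t + x/c`. -/
lemma boundary_relation_zero (s : ℝ) :
    (h₂ - 1) * d L (max (s - L / c) 0) + (h₁ + 1) * d 0 (max s 0) = 0 := by
  have hc := H.hc
  have hL := H.hL
  have h0 : (0 : ℝ) ∈ Icc 0 L := ⟨le_rfl, hL.le⟩
  have hLL : L ∈ Icc 0 L := ⟨hL.le, le_rfl⟩
  have hLc : 0 < L / c := div_pos hL hc
  have cL : Continuous fun s => d L (max (s - L / c) 0) :=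
    (continuous_boundary hd hLL).comp (continuous_id.sub continuous_const)
  have c0 := continuous_boundary hd h0
  refine congrFun (eq_zero_of_integral_deriv_mul (K := 0)
    (F := fun s => (h₂ - 1) * d L (max (s - L / c) 0) + (h₁ + 1) * d 0 (max s 0))
    ((continuous_const.mul cL).add (continuous_const.mul c0)) (fun s hs => ?_)
    fun B hB hB' => ?_) s
  · rw [max_eq_right (by linarith), max_eq_right (by linarith), hi L hLL, hi 0 h0]; ring
  · obtain ⟨R, hR, hR'⟩ := hB'.exists_abs_le
    obtain ⟨R2, hR2, hR2'⟩ := hB'.deriv.exists_abs_le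
    obtain ⟨A, hA, hA', hA1⟩ := exists_smooth_eq_one (R + R2 + 2 * (L / c))
    have key := H.pairing_waveProd hd hw hA hB hA' hB'
    have hB1 : ContDiff ℝ ∞ (deriv B) := (contDiff_infty_iff_deriv.1 hB).2
    have hAe : ∀ x ∈ Icc 0 L, ∀ t, |t + x / c| ≤ R + R2 → A (t - x / c) = 1 ∧
        deriv A (t - x / c) = 0 := fun x hx t ht => by
      refine hA1 _ ?_
      have h1 : x / c ≤ L / c := by gcongr; exact hx.2
      have h2 : 0 ≤ x / c := div_nonneg hx.1 hc.le
      rw [abs_le] at ht ⊢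
      constructor <;> linarith [ht.1, ht.2]
    have w1 : ∀ F : ℝ → ℝ, (∀ s, F s ≠ 0 → |s| ≤ R + R2) → ∀ x ∈ Icc 0 L, ∀ t ∈ Ici (0 : ℝ),
        waveProd c (deriv A) F x t = 0 := fun F hF x hx t _ => by
      by_cases h : F (t + x / c) = 0
      · simp [waveProd, h]
      · simp [waveProd, (hAe x hx t (hF _ h)).2]
    have w2 : ∀ x ∈ Icc 0 L, ∀ t, waveProd c A (deriv B) x t = deriv B (t + x / c) :=
        fun x hx t => by
      by_cases h : deriv B (t + x / c) = 0
      · simp [waveProd, h]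
      · rw [waveProd, (hAe x hx t ((hR2' _ h).trans (by linarith))).1, one_mul]
    have z : ∀ (μ : Measure ℝ), pairing μ (fun _ _ => (0 : ℝ)) d = 0 := fun μ => by simp [pairing]
    have hBR : ∀ s, B s ≠ 0 → |s| ≤ R + R2 := fun s hs => (hR' s hs).trans (by linarith)
    have hBR2 : ∀ s, deriv B s ≠ 0 → |s| ≤ R + R2 := fun s hs => (hR2' s hs).trans (by linarith)
    have kk := (isTest_waveProd hc hA hB1 hA' hB'.deriv).isKernel
    rw [pairing_kernel_congr (volume_restrict_compl L) (w1 _ hBR2),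
      pairing_kernel_congr (dirac_compl h0) (w1 _ hBR),
      pairing_kernel_congr (dirac_compl hLL) (w1 _ hBR), z, z, z,
      pairing_dirac hLL kk hd, pairing_dirac h0 kk hd] at key
    simp only [w2 L hLL, w2 0 h0, smul_eq_mul, zero_div] at key
    simp only [← sub_neg_eq_add] at key
    rw [integral_Ioi_mul_boundary hi hLL (deriv B) (-(L / c)),
      integral_Ioi_mul_boundary hi h0 (deriv B) (-0)] at key
    simp only [neg_zero, add_zero, ← sub_eq_add_neg, sub_neg_eq_add] at key
    have i1 : Integrable fun s => deriv B s * d L (max (s - L / c) 0) :=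
      (hB1.continuous.mul cL).integrable_of_hasCompactSupport hB'.deriv.mul_right
    have i2 : Integrable fun s => deriv B s * d 0 (max s 0) :=
      (hB1.continuous.mul c0).integrable_of_hasCompactSupport hB'.deriv.mul_right
    have e : ∀ s, deriv B s * ((h₂ - 1) * d L (max (s - L / c) 0) + (h₁ + 1) * d 0 (max s 0)) =
        (h₂ - 1) * (deriv B s * d L (max (s - L / c) 0)) +
          (h₁ + 1) * (deriv B s * d 0 (max s 0)) := fun s => by ring
    simp only [e]
    rw [integral_add (i1.const_mul _) (i2.const_mul _), integral_const_mul, integral_const_mul]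
    have := mul_left_cancel₀ hc.ne' (key.symm.trans (by simp : (4 : ℝ) * 0 = c * 0))
    linarith

/-- Induction over round trips: if the trace at `0` vanishes at time `s - 2L/c`, the first relation
gives zero at `L` at time `s - L/c`, and the second gives zero at `0` at time `s`. -/
lemma boundary_eq_zero (s : ℝ) : d 0 (max s 0) = 0 ∧ d L (max s 0) = 0 := by
  have hLc : 0 < L / c := div_pos H.hL H.hc
  have n1 : h₁ + 1 ≠ 0 := fun h => H.h₁_ne_neg_one (by linarith)
  have n2 : h₂ + 1 ≠ 0 := fun h => H.h₂_ne_neg_one (by linarith)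
  have rL := H.boundary_relation_L hd hw hi
  have r0 := H.boundary_relation_zero hd hw hi
  have key : ∀ n : ℕ, ∀ s ≤ n * (2 * (L / c)), d 0 (max s 0) = 0 := by
    intro n
    induction n with
    | zero =>
      intro s hs
      rw [max_eq_right (by simpa using hs), hi 0 ⟨le_rfl, H.hL.le⟩]
    | succ n ih =>
      intro s hs
      have h1 := ih (s - 2 * (L / c)) (by push_cast at hs; linarith)
      have h2 := rL (s - 2 * (L / c))
      rw [h1, mul_zero, add_zero, show s - 2 * (L / c) + L / c = s - L / c by ring] at h2
      have h3 := r0 s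
      rw [(mul_eq_zero.1 h2).resolve_left n2, mul_zero, zero_add] at h3
      exact (mul_eq_zero.1 h3).resolve_left n1
  have h0 : ∀ s, d 0 (max s 0) = 0 := fun s => by
    obtain ⟨n, hn⟩ := exists_nat_ge (s / (2 * (L / c)))
    exact key n s ((div_le_iff₀ (by positivity)).1 hn)
  refine ⟨h0 s, ?_⟩
  have h2 := rL (s - L / c)
  rw [h0, mul_zero, add_zero, sub_add_cancel] at h2
  exact (mul_eq_zero.1 h2).resolve_left n2

/-- For `x` in the bar and `t ≥ 0` both arguments are at least `-L/c`, where `α` and `β` are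
derivatives of compactly supported functions; the boundary terms have already been removed. -/
lemma pairing_waveProd_eq_zero {α β : ℝ → ℝ} (hα : ContDiff ℝ ∞ α) (hβ : ContDiff ℝ ∞ β)
    (hα' : HasCompactSupport α) (hβ' : HasCompactSupport β) :
    pairing (volume.restrict (Ioc 0 L)) (waveProd c α β) d = 0 := by
  have hc := H.hc
  have hLc : 0 < L / c := div_pos H.hL H.hc
  obtain ⟨A, hA, hA', hAα⟩ := exists_primitive hα hα' (L / c)
  obtain ⟨B, hB, hB', hBβ⟩ := exists_primitive hβ hβ' (L / c)
  have hA1 : ContDiff ℝ ∞ (deriv A) := (contDiff_infty_iff_deriv.1 hA).2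
  have hB1 : ContDiff ℝ ∞ (deriv B) := (contDiff_infty_iff_deriv.1 hB).2
  have h0 : (0 : ℝ) ∈ Icc 0 L := ⟨le_rfl, H.hL.le⟩
  have hLL : L ∈ Icc 0 L := ⟨H.hL.le, le_rfl⟩
  have b0 : ∀ t ∈ Ioi (0 : ℝ), d 0 t = 0 ∧ d L t = 0 := fun t ht => by
    simpa [max_eq_left (mem_Ioi.1 ht).le] using H.boundary_eq_zero hd hw hi t
  have z0 : ∀ Φ, IsKernel Φ → pairing (Measure.dirac 0) Φ d = 0 := fun Φ hΦ => by
    rw [pairing_dirac h0 hΦ hd]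
    exact setIntegral_eq_zero_of_forall_eq_zero fun t ht => by rw [(b0 t ht).1, smul_zero]
  have zL : ∀ Φ, IsKernel Φ → pairing (Measure.dirac L) Φ d = 0 := fun Φ hΦ => by
    rw [pairing_dirac hLL hΦ hd]
    exact setIntegral_eq_zero_of_forall_eq_zero fun t ht => by rw [(b0 t ht).2, smul_zero]
  have k1 := (isTest_waveProd hc hA1 hB hA'.deriv hB').isKernel
  have k2 := (isTest_waveProd hc hA hB1 hA' hB'.deriv).isKernel
  have key := H.pairing_waveProd hd hw hA hB hA' hB'
  rw [z0 _ k1, z0 _ k2, zL _ k1, zL _ k2,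
    pairing_kernel_congr (Ψ := waveProd c α β) (volume_restrict_compl L) fun x hx t ht => ?_] at key
  · linarith
  · have h1 : x / c ≤ L / c := by gcongr; exact hx.2
    have h2 : 0 ≤ x / c := div_nonneg hx.1 hc.le
    have h3 : 0 ≤ t := ht
    rw [waveProd, waveProd, hAα _ (by linarith), hBβ _ (by linarith)]

/-- If `d` were nonzero at an interior point, a product of bumps concentrated there in
characteristic coordinates would see only one sign of `d`. -/
lemma eq_zero_of_mem_interior {x₀ t₀ : ℝ} (hx : x₀ ∈ Ioo 0 L) (ht : 0 < t₀) : d x₀ t₀ = 0 := by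
  have hc := H.hc
  by_contra hne
  -- The factor `d x₀ t₀` makes the value at the point positive whatever its sign; clamping the
  -- arguments extends the function continuously to the plane.
  let e : ℝ → ℝ → ℝ := fun x t => d x₀ t₀ * d (max 0 (min x L)) (max t 0)
  have he : Continuous (uncurry e) := by
    refine continuous_const.mul (hd.comp_continuous
      (f := fun z : ℝ × ℝ => (max 0 (min z.1 L), max z.2 0)) (by fun_prop) fun z => ?_)
    exact ⟨⟨le_max_left _ _, max_le H.hL.le (min_le_right _ _)⟩, mem_Ici.2 (le_max_right _ _)⟩
  have he' : ∀ x ∈ Icc 0 L, ∀ t ∈ Ici (0 : ℝ), e x t = d x₀ t₀ * d x t := fun x hx t ht => by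
    simp only [e, min_eq_left hx.2, max_eq_right hx.1, max_eq_left (mem_Ici.1 ht)]
  have hpos : 0 < e x₀ t₀ := by
    rw [he' _ (Ioo_subset_Icc_self hx) _ ht.le]
    exact mul_self_pos.2 hne
  let T : ℝ × ℝ → ℝ × ℝ := fun z => (c * (z.2 - z.1) / 2, (z.1 + z.2) / 2)
  have hT : Continuous T := by fun_prop
  have hT0 : T (t₀ - x₀ / c, t₀ + x₀ / c) = (x₀, t₀) := by
    ext <;> simp only [T] <;> field_simp <;> ring
  have hU : {z : ℝ × ℝ | z ∈ Ioo 0 L ×ˢ Ioi 0 ∧ 0 < uncurry e z} ∈ 𝓝 (x₀, t₀) :=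
    (((isOpen_Ioo.prod isOpen_Ioi).inter (isOpen_lt continuous_const he))).mem_nhds
      ⟨⟨hx, ht⟩, hpos⟩
  rw [← hT0] at hU
  obtain ⟨ε, hε, hball⟩ := Metric.mem_nhds_iff.1 (hT.continuousAt.preimage_mem_nhds hU)
  let α : ContDiffBump (t₀ - x₀ / c) := ⟨ε / 2, ε, by positivity, by linarith⟩
  let β : ContDiffBump (t₀ + x₀ / c) := ⟨ε / 2, ε, by positivity, by linarith⟩
  have hsupp : ∀ x t, waveProd c α β x t ≠ 0 → (x ∈ Ioo 0 L ∧ 0 < t) ∧ 0 < e x t := by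
    intro x t h
    have h1 : t - x / c ∈ support α := left_ne_zero_of_mul h
    have h2 : t + x / c ∈ support β := right_ne_zero_of_mul h
    rw [ContDiffBump.support_eq] at h1 h2
    have h3 := hball (show (t - x / c, t + x / c) ∈ Metric.ball (t₀ - x₀ / c, t₀ + x₀ / c) ε by
      rw [← ball_prod_same]; exact ⟨h1, h2⟩)
    have h4 : T (t - x / c, t + x / c) = (x, t) := by
      ext <;> simp only [T] <;> field_simp <;> ring
    rw [mem_preimage, h4] at h3
    exact h3
  have key := H.pairing_waveProd_eq_zero hd hw hi α.contDiff β.contDiff α.hasCompactSupport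
    β.hasCompactSupport
  have kk := (isTest_waveProd hc α.contDiff β.contDiff α.hasCompactSupport
    β.hasCompactSupport).isKernel
  have hint : ∫ z : ℝ × ℝ, waveProd c α β z.1 z.2 * e z.1 z.2 = 0 := by
    rw [← setIntegral_eq_integral_of_forall_compl_eq_zero (s := Ioc 0 L ×ˢ Ioi 0) fun z hz => ?_]
    · rw [Measure.volume_eq_prod, ← Measure.prod_restrict]
      calc _ = ∫ z, d x₀ t₀ • (waveProd c α β z.1 z.2 • d z.1 z.2)
            ∂spaceTime (volume.restrict (Ioc 0 L)) := by
            refine integral_congr_ae ?_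
            filter_upwards [ae_spaceTime (L := L) (volume_restrict_compl L)] with z hz
            rw [he' _ hz.1 _ hz.2, smul_eq_mul, smul_eq_mul]; ring
        _ = 0 := by rw [integral_smul, show (∫ z, _ ∂_ : ℝ) = 0 from key, smul_zero]
    · by_contra h
      have := (hsupp _ _ (left_ne_zero_of_mul h)).1
      exact hz ⟨Ioo_subset_Ioc_self this.1, this.2⟩
  refine hint.not_gt ?_
  refine Continuous.integral_pos_of_hasCompactSupport_nonneg_nonzero
    (f := fun z : ℝ × ℝ => waveProd c α β z.1 z.2 * e z.1 z.2)
    (kk.continuous.mul he) kk.hasCompactSupport.mul_right (fun z => ?_) (x := (x₀, t₀)) ?_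
  · by_cases h : waveProd c α β z.1 z.2 = 0
    · simp [h]
    · exact mul_nonneg (mul_nonneg α.nonneg β.nonneg) (hsupp _ _ h).2.le
  · refine mul_ne_zero ?_ hpos.ne'
    simp only [waveProd]
    rw [α.one_of_mem_closedBall (Metric.mem_closedBall_self α.rIn_pos.le),
      β.one_of_mem_closedBall (Metric.mem_closedBall_self β.rIn_pos.le)]
    norm_num

/-- The homogeneous problem has only the trivial weak solution. -/
theorem eq_zero_of_weakOp_eq_zero : ∀ x ∈ Icc 0 L, ∀ t ∈ Ici (0 : ℝ), d x t = 0 := by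
  intro x hx t ht
  rcases (mem_Ici.1 ht).eq_or_lt with rfl | ht
  · exact hi x hx
  have b := H.boundary_eq_zero hd hw hi t
  rw [max_eq_left ht.le] at b
  rcases hx.1.eq_or_lt with rfl | h0
  · exact b.1
  rcases hx.2.eq_or_lt with rfl | h1
  · exact b.2
  exact H.eq_zero_of_mem_interior hd hw hi ⟨h0, h1⟩ ht

end Uniqueness

end Admissible

end ViscousBar

/-! ### Time-shifted test functions and bounds for Duhamel integrals. -/

namespace ViscousBar

open Filter Topology

section Shift

variable {c L h₁ h₂ : ℝ} {φ : ℝ → ℝ → ℝ}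

lemma dt_shift (τ : ℝ) : dt (fun x t => φ x (t + τ)) = fun x t => dt φ x (t + τ) := by
  ext x t
  exact deriv_comp_add_const (fun s => φ x s) τ t

lemma wave_shift (τ : ℝ) : wave c (fun x t => φ x (t + τ)) = fun x t => wave c φ x (t + τ) := by
  ext x t
  simp only [wave, dt_shift]
  rfl

lemma weakOp_duhamel (hL : 0 < L) (hφ : IsTest φ) {a : ℝ → ℂ} (ha : ∀ T, IntegrableOn a (Ioc 0 T))
    {e : ℝ → ℝ → ℂ} (he : Continuous (uncurry e)) :
    IntegrableOn (fun τ => a τ * weakOp c L h₁ h₂ (fun x t => φ x (t + τ)) e) (Ioi 0) ∧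
    weakOp c L h₁ h₂ φ (duhamel a e) =
      ∫ τ in Ioi (0 : ℝ), a τ * weakOp c L h₁ h₂ (fun x t => φ x (t + τ)) e := by
  have h0 := dirac_compl (L := L) ⟨le_rfl, hL.le⟩
  have h1 := dirac_compl (L := L) ⟨hL.le, le_rfl⟩
  obtain ⟨i1, e1⟩ := pairing_duhamel (volume_restrict_compl L) (hφ.wave c) ha he
  obtain ⟨i2, e2⟩ := pairing_duhamel h1 hφ.dt.isKernel ha he
  obtain ⟨i3, e3⟩ := pairing_duhamel h0 hφ.dt.isKernel ha he
  obtain ⟨i4, e4⟩ := pairing_duhamel h1 hφ.dx.isKernel ha he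
  obtain ⟨i5, e5⟩ := pairing_duhamel h0 hφ.dx.isKernel ha he
  have key : ∀ {F₁ F₂ F₃ F₄ F₅ : ℝ → ℂ}, IntegrableOn F₁ (Ioi 0) → IntegrableOn F₂ (Ioi 0) →
      IntegrableOn F₃ (Ioi 0) → IntegrableOn F₄ (Ioi 0) → IntegrableOn F₅ (Ioi 0) →
      ∀ α β γ : ℝ,
      IntegrableOn (fun τ => F₁ τ - α • F₂ τ - β • F₃ τ + γ • (F₄ τ - F₅ τ)) (Ioi 0) ∧
      ∫ τ in Ioi 0, (F₁ τ - α • F₂ τ - β • F₃ τ + γ • (F₄ τ - F₅ τ)) =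
        (∫ τ in Ioi 0, F₁ τ) - α • (∫ τ in Ioi 0, F₂ τ) - β • (∫ τ in Ioi 0, F₃ τ) +
        γ • ((∫ τ in Ioi 0, F₄ τ) - ∫ τ in Ioi 0, F₅ τ) := by
    intro F₁ F₂ F₃ F₄ F₅ i1 i2 i3 i4 i5 α β γ
    have j2 : IntegrableOn (fun τ => α • F₂ τ) (Ioi 0) := i2.smul α
    have j3 : IntegrableOn (fun τ => β • F₃ τ) (Ioi 0) := i3.smul β
    have j4 : IntegrableOn (fun τ => γ • (F₄ τ - F₅ τ)) (Ioi 0) := (i4.sub i5).smul γ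
    have j5 : IntegrableOn (fun τ => F₁ τ - α • F₂ τ) (Ioi 0) := i1.sub j2
    have j6 : IntegrableOn (fun τ => F₁ τ - α • F₂ τ - β • F₃ τ) (Ioi 0) := j5.sub j3
    refine ⟨j6.add j4, ?_⟩
    rw [integral_add j6 j4, integral_sub j5 j3, integral_sub i1 j2, integral_smul, integral_smul,
      integral_smul, integral_sub i4 i5]
  have e : ∀ τ, a τ * weakOp c L h₁ h₂ (fun x t => φ x (t + τ)) e =
      a τ * pairing (volume.restrict (Ioc 0 L)) (fun x t => wave c φ x (t + τ)) e
      - (c * h₂) • (a τ * pairing (Measure.dirac L) (fun x t => dt φ x (t + τ)) e)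
      - (c * h₁) • (a τ * pairing (Measure.dirac 0) (fun x t => dt φ x (t + τ)) e)
      + c ^ 2 • (a τ * pairing (Measure.dirac L) (fun x t => dx φ x (t + τ)) e -
        a τ * pairing (Measure.dirac 0) (fun x t => dx φ x (t + τ)) e) := fun τ => by
    rw [weakOp, dt_shift, wave_shift]
    simp only [Complex.real_smul]
    rw [show dx (fun x t => φ x (t + τ)) = fun x t => dx φ x (t + τ) from rfl]
    ring
  simp only [e]
  obtain ⟨k1, k2⟩ := key i1 i2 i3 i4 i5 (c * h₂) (c * h₁) (c ^ 2)
  refine ⟨k1, ?_⟩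
  rw [weakOp, e1, e2, e3, e4, e5, k2]

lemma norm_pairing_le {μ : Measure ℝ} [IsFiniteMeasure μ] (hμ : μ (Icc 0 L)ᶜ = 0)
    {Φ : ℝ → ℝ → ℝ} {T M B : ℝ} (hT : 0 ≤ T) (hM : ∀ x t, |Φ x t| ≤ M)
    (hΦ : ∀ x t, T ≤ t → Φ x t = 0) {u : ℝ → ℝ → ℂ}
    (hu : ∀ x ∈ Icc 0 L, ∀ t ∈ Icc 0 T, ‖u x t‖ ≤ B) :
    ‖pairing μ Φ u‖ ≤ μ.real univ * T * M * B := by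
  have hM0 : 0 ≤ M := (abs_nonneg _).trans (hM 0 0)
  set s : Set (ℝ × ℝ) := univ ×ˢ Iic T with hs
  have hsm : MeasurableSet s := MeasurableSet.univ.prod measurableSet_Iic
  have hsv : (spaceTime μ).real s = μ.real univ * T := by
    rw [measureReal_def, hs, spaceTime, Measure.prod_prod, Measure.restrict_apply measurableSet_Iic,
      inter_comm, Ioi_inter_Iic, Real.volume_Ioc, ENNReal.toReal_mul, sub_zero,
      ENNReal.toReal_ofReal hT, measureReal_def]
  have hst : spaceTime μ s ≠ ⊤ := by
    rw [hs, spaceTime, Measure.prod_prod, Measure.restrict_apply measurableSet_Iic,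
      inter_comm, Ioi_inter_Iic, Real.volume_Ioc]
    exact ENNReal.mul_ne_top (measure_ne_top _ _) ENNReal.ofReal_ne_top
  have hb : Integrable (s.indicator fun _ => M * B) (spaceTime μ) := by
    rw [integrable_indicator_iff hsm]
    exact integrableOn_const hst
  refine (norm_integral_le_of_norm_le hb ?_).trans ?_
  · filter_upwards [ae_spaceTime (L := L) hμ] with z hz
    by_cases h : z.2 < T
    · rw [indicator_of_mem (show z ∈ s from ⟨mem_univ _, h.le⟩), norm_smul, Real.norm_eq_abs]
      exact mul_le_mul (hM _ _) (hu _ hz.1 _ ⟨hz.2, h.le⟩) (norm_nonneg _) hM0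
    · rw [hΦ _ _ (not_lt.1 h), zero_smul, norm_zero]
      refine indicator_nonneg (fun _ _ => mul_nonneg hM0 ?_) _
      exact (norm_nonneg _).trans (hu _ hz.1 0 ⟨le_rfl, hT⟩)
  · rw [integral_indicator_const _ hsm, hsv, smul_eq_mul, mul_assoc _ M B]

lemma IsKernel.exists_norm_pairing_shift_le {Φ : ℝ → ℝ → ℝ} (hL : 0 < L) (hΦ : IsKernel Φ)
    {μ : Measure ℝ} [IsFiniteMeasure μ] (hμ : μ (Icc 0 L)ᶜ = 0) :
    ∃ T₀ > 0, ∀ T ≥ T₀, ∃ W > 0, ∀ τ > 0, ∀ (u : ℝ → ℝ → ℂ) (B : ℝ),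
      (∀ x ∈ Icc 0 L, ∀ t ∈ Icc 0 T, ‖u x t‖ ≤ B) →
      ‖pairing μ (fun x t => Φ x (t + τ)) u‖ ≤ (Ioc 0 T).indicator (fun _ => W * B) τ := by
  obtain ⟨T₀, hT₀, hsupp⟩ := hΦ.exists_bound_support
  obtain ⟨M, hM, hb⟩ := hΦ.exists_bound
  refine ⟨T₀, hT₀, fun T hT => ⟨μ.real univ * T * M + 1, ?_, fun τ hτ u B hu => ?_⟩⟩
  · have : 0 ≤ μ.real univ := measureReal_nonneg
    have : 0 ≤ T := by linarith
    positivity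
  · have hT0 : 0 ≤ T := by linarith
    have hB : 0 ≤ B := (norm_nonneg _).trans (hu 0 ⟨le_rfl, hL.le⟩ 0 ⟨le_rfl, hT0⟩)
    by_cases h : τ ≤ T
    · rw [indicator_of_mem (show τ ∈ Ioc 0 T from ⟨hτ, h⟩)]
      have := norm_pairing_le hμ (Φ := fun x t => Φ x (t + τ)) hT0 (fun x t => hb x (t + τ))
        (fun x t ht => hsupp x _ (by linarith)) hu
      linarith
    · rw [indicator_of_notMem (fun h' => h h'.2)]
      have := norm_pairing_le hμ (Φ := fun x t => Φ x (t + τ)) le_rfl (fun x t => hb x (t + τ))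
        (fun x t ht => hsupp x _ (by linarith)) (B := B)
        (fun x hx t ht => hu x hx t ⟨ht.1, ht.2.trans hT0⟩)
      simpa using this

/-- The bound is uniform in the shift and vanishes for `τ > T`. It dominates the interchange of the
sum over modes with the integral over `τ`. -/
lemma exists_norm_weakOp_shift_le (hL : 0 < L) (hφ : IsTest φ) (c h₁ h₂ : ℝ) :
    ∃ T > 0, ∃ W > 0, ∀ τ > 0, ∀ (u : ℝ → ℝ → ℂ) (B : ℝ),
      (∀ x ∈ Icc 0 L, ∀ t ∈ Icc 0 T, ‖u x t‖ ≤ B) →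
      ‖weakOp c L h₁ h₂ (fun x t => φ x (t + τ)) u‖ ≤ (Ioc 0 T).indicator (fun _ => W * B) τ := by
  have h0 := dirac_compl (L := L) ⟨le_rfl, hL.le⟩
  have h1 := dirac_compl (L := L) ⟨hL.le, le_rfl⟩
  obtain ⟨T1, hT1, b1⟩ := (hφ.wave c).exists_norm_pairing_shift_le hL (volume_restrict_compl L)
  obtain ⟨T2, hT2, b2⟩ := hφ.dt.isKernel.exists_norm_pairing_shift_le hL h1
  obtain ⟨T3, hT3, b3⟩ := hφ.dt.isKernel.exists_norm_pairing_shift_le hL h0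
  obtain ⟨T4, hT4, b4⟩ := hφ.dx.isKernel.exists_norm_pairing_shift_le hL h1
  obtain ⟨T5, hT5, b5⟩ := hφ.dx.isKernel.exists_norm_pairing_shift_le hL h0
  -- The sum is a common time horizon for the five pairings.
  set T := T1 + T2 + T3 + T4 + T5 with hT
  obtain ⟨W1, hW1, w1⟩ := b1 T (by rw [hT, ge_iff_le]; linarith)
  obtain ⟨W2, hW2, w2⟩ := b2 T (by rw [hT, ge_iff_le]; linarith)
  obtain ⟨W3, hW3, w3⟩ := b3 T (by rw [hT, ge_iff_le]; linarith)
  obtain ⟨W4, hW4, w4⟩ := b4 T (by rw [hT, ge_iff_le]; linarith)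
  obtain ⟨W5, hW5, w5⟩ := b5 T (by rw [hT, ge_iff_le]; linarith)
  refine ⟨T, by positivity, W1 + |c * h₂| * W2 + |c * h₁| * W3 + c ^ 2 * (W4 + W5), by positivity,
    fun τ hτ u B hu => ?_⟩
  have e : ∀ V : ℝ, (Ioc 0 T).indicator (fun _ => V * B) τ =
      V * (Ioc 0 T).indicator (fun _ => B) τ := fun V => by
    by_cases h : τ ∈ Ioc 0 T <;> simp [h]
  have k1 := w1 τ hτ u B hu
  have k2 := w2 τ hτ u B hu
  have k3 := w3 τ hτ u B hu
  have k4 := w4 τ hτ u B hu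
  have k5 := w5 τ hτ u B hu
  rw [e] at k1 k2 k3 k4 k5 ⊢
  rw [weakOp, dt_shift, wave_shift,
    show dx (fun x t => φ x (t + τ)) = fun x t => dx φ x (t + τ) from rfl]
  have n2 := norm_smul (c * h₂) (pairing (Measure.dirac L) (fun x t => dt φ x (t + τ)) u)
  have n3 := norm_smul (c * h₁) (pairing (Measure.dirac 0) (fun x t => dt φ x (t + τ)) u)
  have n4 := norm_smul (c ^ 2) (pairing (Measure.dirac L) (fun x t => dx φ x (t + τ)) u -
    pairing (Measure.dirac 0) (fun x t => dx φ x (t + τ)) u)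
  rw [Real.norm_eq_abs] at n2 n3 n4
  rw [abs_of_nonneg (sq_nonneg c)] at n4
  refine (norm_add_le _ _).trans ?_
  refine (add_le_add ((norm_sub_le _ _).trans (add_le_add (norm_sub_le _ _) le_rfl)) le_rfl).trans ?_
  rw [n2, n3, n4]
  have m2 := mul_le_mul_of_nonneg_left k2 (abs_nonneg (c * h₂))
  have m3 := mul_le_mul_of_nonneg_left k3 (abs_nonneg (c * h₁))
  have m4 := mul_le_mul_of_nonneg_left ((norm_sub_le _ _).trans (add_le_add k4 k5)) (sq_nonneg c)
  linarith

/-- A separated profile gives a continuous Duhamel integral. -/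
lemma continuousOn_duhamel {a : ℝ → ℂ} (ha : ∀ T, IntegrableOn a (Ioc 0 T)) {m : ℝ → ℂ}
    (hm : Continuous m) (l : ℂ) : ContinuousOn
      (uncurry (duhamel a fun x t => m x * Complex.exp (l * t))) (Icc 0 L ×ˢ Ici 0) := by
  have e : ∀ x t, duhamel a (fun x t => m x * Complex.exp (l * t)) x t =
      m x * Complex.exp (l * t) * ∫ τ in 0..t, a τ * Complex.exp (-(l * τ)) := fun x t => by
    rw [duhamel, ← intervalIntegral.integral_const_mul]
    refine intervalIntegral.integral_congr fun τ _ => ?_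
    rw [Complex.ofReal_sub, mul_sub, sub_eq_add_neg, Complex.exp_add]
    ring
  have hi : ∀ T, IntegrableOn (fun τ => a τ * Complex.exp (-(l * τ))) (Icc 0 T) := fun T =>
    IntegrableOn.mul_continuousOn ((integrableOn_Icc_iff_integrableOn_Ioc (by simp)).2 (ha T))
      (Continuous.continuousOn (by fun_prop)) isCompact_Icc
  have h1 : ContinuousOn (fun t => ∫ τ in 0..t, a τ * Complex.exp (-(l * τ))) (Ici 0) := by
    intro t ht
    have ht : 0 ≤ t := ht
    have := intervalIntegral.continuousOn_primitive_interval
      (f := fun τ => a τ * Complex.exp (-(l * τ))) (μ := volume) (a := 0) (b := t + 1)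
      (by rw [uIcc_of_le (by linarith)]; exact hi _)
    rw [uIcc_of_le (by linarith)] at this
    refine (this t ⟨ht, by linarith⟩).mono_of_mem_nhdsWithin ?_
    rw [← Ici_inter_Iic]
    exact inter_mem self_mem_nhdsWithin (mem_nhdsWithin_of_mem_nhds (Iic_mem_nhds (by linarith)))
  have e' : uncurry (duhamel a fun x t => m x * Complex.exp (l * t)) = fun z =>
      m z.1 * Complex.exp (l * z.2) * ∫ τ in 0..z.2, a τ * Complex.exp (-(l * τ)) := by
    ext ⟨x, t⟩; exact e x t
  rw [e']
  refine ContinuousOn.mul (Continuous.continuousOn (by fun_prop)) ?_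
  exact h1.comp continuousOn_snd fun z hz => hz.2

end Shift

/-! ### Free vibrations with given initial data. -/

section Free

variable {c L h₁ h₂ : ℝ}

/-- The vibration `mode r x * exp (λ_r t) / λ_r`. -/
noncomputable def vibration (c L h₁ h₂ : ℝ) (r : ℤ) (x t : ℝ) : ℂ :=
  mode c L h₁ h₂ r x / eigenvalue c L h₁ h₂ r * Complex.exp (eigenvalue c L h₁ h₂ r * t)

/-- The static part of the solution with initial data `f`, `g`. -/
noncomputable def equilibrium (c L h₁ h₂ : ℝ) (f g : ℝ → ℝ) : ℝ :=
  1 / (c * (h₁ + h₂)) * ((∫ ξ in (0 : ℝ)..L, g ξ) + c * f L * h₂ + c * f 0 * h₁)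

/-- The expansion of the solution of the homogeneous equation with initial data `f`, `g`, where `d`
is the derivative of `f`. -/
noncomputable def free (c L h₁ h₂ : ℝ) (f g d : ℝ → ℝ) (x t : ℝ) : ℂ :=
  equilibrium c L h₁ h₂ f g +
    ∑' r : ℤ, coeff c L h₁ h₂ g d r / ((1 - h₁ ^ 2) * L) * vibration c L h₁ h₂ r x t

lemma continuous_vibration (r : ℤ) : Continuous (uncurry (vibration c L h₁ h₂ r)) := by
  have := continuous_mode (c := c) (L := L) (h₁ := h₁) (h₂ := h₂) r
  exact ((this.comp continuous_fst).div_const _).mul (by fun_prop)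

lemma continuous_const_mul_vibration (a : ℂ) (r : ℤ) :
    Continuous (uncurry fun x t => a * vibration c L h₁ h₂ r x t) :=
  (continuous_vibration r).const_mul a

lemma weakOp_const_mul {φ : ℝ → ℝ → ℝ} (a : ℂ) (u : ℝ → ℝ → ℂ) :
    weakOp c L h₁ h₂ φ (fun x t => a * u x t) = a * weakOp c L h₁ h₂ φ u := by
  have : ∀ (μ : Measure ℝ) (Φ : ℝ → ℝ → ℝ), pairing μ Φ (fun x t => a * u x t) =
      a * pairing μ Φ u := fun μ Φ => by
    simp only [pairing, ← mul_smul_comm]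
    exact integral_const_mul a _
  simp only [weakOp, this, Complex.real_smul]
  ring

lemma initialOp_sub_const {φ : ℝ → ℝ → ℝ} (hφ : IsTest φ) {F G : ℝ → ℂ}
    (hF : IntervalIntegrable F volume 0 L) (hG : IntervalIntegrable G volume 0 L) (a : ℂ) :
    initialOp c L h₁ h₂ φ (fun x => F x - a) G =
      initialOp c L h₁ h₂ φ F G - initialOp c L h₁ h₂ φ (fun _ => a) (fun _ => 0) := by
  have c1 : Continuous fun x => (φ x 0 : ℂ) := Complex.continuous_ofReal.comp
    (hφ.contDiff.continuous.comp (by fun_prop : Continuous fun x : ℝ => (x, (0 : ℝ))))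
  have c2 : Continuous fun x => (dt φ x 0 : ℂ) := Complex.continuous_ofReal.comp
    (hφ.dt.contDiff.continuous.comp (by fun_prop : Continuous fun x : ℝ => (x, (0 : ℝ))))
  have i1 : IntervalIntegrable (fun x => φ x 0 * G x - dt φ x 0 * F x) volume 0 L :=
    (hG.continuousOn_mul c1.continuousOn).sub (hF.continuousOn_mul c2.continuousOn)
  have i2 : IntervalIntegrable (fun x => φ x 0 * 0 - dt φ x 0 * a) volume 0 L :=
    ((c1.mul continuous_const).sub (c2.mul continuous_const)).intervalIntegrable _ _
  simp only [initialOp, Complex.real_smul]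
  rw [show (∫ x in 0..L, ((φ x 0 : ℂ) * G x - dt φ x 0 * (F x - a))) =
    (∫ x in 0..L, ((φ x 0 : ℂ) * G x - dt φ x 0 * F x)) -
      ∫ x in 0..L, ((φ x 0 : ℂ) * 0 - dt φ x 0 * a) by
    rw [← intervalIntegral.integral_sub i1 i2]
    exact intervalIntegral.integral_congr fun x _ => by ring]
  ring

namespace Admissible

variable (H : Admissible c L h₁ h₂)
include H

section

variable {g d : ℝ → ℝ} (hg : MemLp g 2 (volume.restrict (Ioc 0 L)))
  (hd : MemLp d 2 (volume.restrict (Ioc 0 L)))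
include hg hd

lemma hasSum_vibration (x t : ℝ) :
    HasSum (fun r : ℤ => coeff c L h₁ h₂ g d r / ((1 - h₁ ^ 2) * L) * vibration c L h₁ h₂ r x t)
    (∑' r : ℤ, coeff c L h₁ h₂ g d r / ((1 - h₁ ^ 2) * L) * vibration c L h₁ h₂ r x t) := by
  refine Summable.hasSum ?_
  refine ((H.hasSum_modal hg hd x t).summable.mul_left ((1 - h₁ ^ 2) * L : ℂ)⁻¹).congr fun r => ?_
  rw [vibration]; ring

lemma exists_norm_vibration_le (T : ℝ) : ∃ B : ℤ → ℝ, Summable B ∧ ∀ r, ∀ x ∈ Icc 0 L,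
    ∀ t ∈ Icc 0 T,
      ‖coeff c L h₁ h₂ g d r / ((1 - h₁ ^ 2) * L) * vibration c L h₁ h₂ r x t‖ ≤ B r := by
  obtain ⟨M, hM, hb⟩ := H.exists_norm_modal_le T
  refine ⟨_, (H.summable_norm_div_freq (H.summable_coeff_sq hg hd)).mul_left
    (M * ‖((1 - h₁ ^ 2) * L : ℂ)‖⁻¹), fun r x hx t ht => ?_⟩
  have h1 := hb r x hx t ht
  rw [norm_mul, norm_div (coeff c L h₁ h₂ g d r), norm_div (coeff c L h₁ h₂ g d r), vibration]
  calc _ ≤ ‖coeff c L h₁ h₂ g d r‖ / ‖((1 - h₁ ^ 2) * L : ℂ)‖ * (M * ‖freq c L h₁ h₂ r‖⁻¹) := by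
        gcongr
    _ = _ := by ring

lemma continuousOn_free (f : ℝ → ℝ) :
    ContinuousOn (uncurry (free c L h₁ h₂ f g d)) (Icc 0 L ×ˢ Ici 0) :=
  continuousOn_const.add (continuousOn_of_hasSum
    (u := fun r x t => coeff c L h₁ h₂ g d r / ((1 - h₁ ^ 2) * L) * vibration c L h₁ h₂ r x t)
    (fun r => (continuous_const_mul_vibration _ r).continuousOn)
    (fun T _ => H.exists_norm_vibration_le hg hd T) fun x _ t _ => H.hasSum_vibration hg hd x t)

/-- Kept as a statement about the single numbers `weakOp φ (vibration r)`, so that it also applies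
at each time `τ` of the Duhamel integral, with `φ` shifted and `g` replaced by the force. -/
lemma hasSum_weakOp_free {φ : ℝ → ℝ → ℝ} (hφ : IsTest φ) {f : ℝ → ℝ}
    (hf : ∀ x ∈ Icc 0 L, f x = f 0 + ∫ y in 0..x, d y) :
    HasSum (fun r => coeff c L h₁ h₂ g d r / ((1 - h₁ ^ 2) * L) *
      weakOp c L h₁ h₂ φ (vibration c L h₁ h₂ r))
    (initialOp c L h₁ h₂ φ (fun x => (f x : ℂ)) (fun x => (g x : ℂ)) -
      equilibrium c L h₁ h₂ f g * weakOp c L h₁ h₂ φ (fun _ _ => (1 : ℂ))) := by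
  have hfc : ContinuousOn f (uIcc 0 L) := by
    have := hd.intervalIntegrable H.hL.le
    refine ((intervalIntegral.continuousOn_primitive_interval' this
      left_mem_uIcc).const_add (f 0)).congr fun x hx => ?_
    rw [uIcc_of_le H.hL.le] at hx
    exact hf x hx
  have hfi : IntervalIntegrable (fun x => (f x : ℂ)) volume 0 L :=
    (Complex.continuous_ofReal.comp_continuousOn hfc).intervalIntegrable
  have hgi : IntervalIntegrable (fun x => (g x : ℂ)) volume 0 L :=
    ⟨(hg.intervalIntegrable H.hL.le).1.ofReal, (hg.intervalIntegrable H.hL.le).2.ofReal⟩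
  convert! H.hasSum_initialOp hφ hg hd hf using 1
  · ext r
    rw [← H.weakOp_mode hφ, ← weakOp_const_mul]
    congr 1
    ext x t
    rw [vibration]; ring
  · rw [initialOp_sub_const hφ hfi hgi, ← H.weakOp_const hφ, ← weakOp_const_mul, mul_one]
    rfl

lemma weakOp_free {φ : ℝ → ℝ → ℝ} (hφ : IsTest φ) {f : ℝ → ℝ}
    (hf : ∀ x ∈ Icc 0 L, f x = f 0 + ∫ y in 0..x, d y) :
    weakOp c L h₁ h₂ φ (free c L h₁ h₂ f g d) =
      initialOp c L h₁ h₂ φ (fun x => (f x : ℂ)) (fun x => (g x : ℂ)) := by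
  have h1 : ContinuousOn (uncurry fun x t => ∑' r : ℤ, coeff c L h₁ h₂ g d r /
      ((1 - h₁ ^ 2) * L) * vibration c L h₁ h₂ r x t) (Icc 0 L ×ˢ Ici 0) := continuousOn_of_hasSum
    (u := fun r x t => coeff c L h₁ h₂ g d r / ((1 - h₁ ^ 2) * L) * vibration c L h₁ h₂ r x t)
    (fun r => (continuous_const_mul_vibration _ r).continuousOn)
    (fun T _ => H.exists_norm_vibration_le hg hd T) fun x _ t _ => H.hasSum_vibration hg hd x t
  have h2 := hasSum_weakOp (h₁ := h₁) (h₂ := h₂) (c := c) H.hL hφ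
    (u := fun r x t => coeff c L h₁ h₂ g d r / ((1 - h₁ ^ 2) * L) * vibration c L h₁ h₂ r x t)
    (fun r => (continuous_const_mul_vibration _ r).continuousOn)
    (fun T _ => H.exists_norm_vibration_le hg hd T) fun x _ t _ => H.hasSum_vibration hg hd x t
  simp only [weakOp_const_mul] at h2
  have h3 := weakOp_add (h₁ := h₁) (h₂ := h₂) (c := c) H.hL hφ
    (u := fun _ _ => (equilibrium c L h₁ h₂ f g : ℂ) * 1) continuousOn_const h1
  rw [weakOp_const_mul, h2.unique (H.hasSum_weakOp_free hg hd hφ hf), add_sub_cancel] at h3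
  simp only [mul_one] at h3
  exact h3

lemma free_zero {f : ℝ → ℝ} (hf : ∀ x ∈ Icc 0 L, f x = f 0 + ∫ y in 0..x, d y) {x : ℝ}
    (hx : x ∈ Icc 0 L) : free c L h₁ h₂ f g d x 0 = f x := by
  have hc := H.hc.ne'
  have hs := H.hsum
  have hn : (1 - h₁ ^ 2) * L ≠ 0 := by exact_mod_cast H.norm_ne_zero
  have h1 := (H.hasSum_modal_initial hg hd hx).mul_left ((1 - h₁ ^ 2) * L : ℂ)⁻¹
  have h2 : (fun r : ℤ => ((1 - h₁ ^ 2) * L : ℂ)⁻¹ * (mode c L h₁ h₂ r x /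
      eigenvalue c L h₁ h₂ r * coeff c L h₁ h₂ g d r)) = fun r =>
      coeff c L h₁ h₂ g d r / ((1 - h₁ ^ 2) * L) * vibration c L h₁ h₂ r x 0 := by
    ext r
    rw [vibration, Complex.ofReal_zero, mul_zero, Complex.exp_zero]; ring
  rw [h2] at h1
  rw [free, h1.tsum_eq, equilibrium, hf x hx]
  have hfL := hf L ⟨H.hL.le, le_rfl⟩
  rw [hfL, show ((1 - h₁ ^ 2) * L : ℂ) = ((1 - h₁ ^ 2) * L : ℝ) by push_cast; rfl,
    ← Complex.ofReal_inv, ← Complex.ofReal_mul, inv_mul_cancel_left₀ hn]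
  norm_cast
  field_simp
  ring

end

end Admissible

end Free

end ViscousBar

/-! ### Forced vibrations. -/

namespace ViscousBar

open Filter Topology

lemma integrable_tsum_of_summable_integral_norm {α ι : Type*} [Countable ι] {m : MeasurableSpace α}
    {μ : Measure α} {F : ι → α → ℂ} (hF : ∀ i, Integrable (F i) μ)
    (h : Summable fun i => ∫ a, ‖F i a‖ ∂μ) : Integrable (fun a => ∑' i, F i a) μ := by
  refine ⟨(AEMeasurable.tsum fun i => (hF i).1.aemeasurable).aestronglyMeasurable, ?_⟩
  refine (lintegral_mono fun a => enorm_tsum_le_tsum_enorm).trans_lt ?_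
  rw [lintegral_tsum fun i => (hF i).1.enorm]
  simp only [← fun i => ofReal_integral_norm_eq_lintegral_enorm (hF i)]
  rw [← ENNReal.ofReal_tsum_of_nonneg (fun i => integral_nonneg fun a => norm_nonneg _) h]
  exact ENNReal.ofReal_lt_top

variable {c L h₁ h₂ : ℝ}

/-- The normalized modal coefficients of the force density `p` at time `τ`. -/
noncomputable def forcing (c L h₁ h₂ : ℝ) (p : ℝ → ℝ → ℝ) (r : ℤ) (τ : ℝ) : ℂ :=
  coeff c L h₁ h₂ (fun ξ => p ξ τ) (fun _ => 0) r / ((1 - h₁ ^ 2) * L)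

/-- The mean displacement velocity produced by the force density `p` at time `τ`. -/
noncomputable def meanForcing (c L h₁ h₂ : ℝ) (p : ℝ → ℝ → ℝ) (τ : ℝ) : ℂ :=
  equilibrium c L h₁ h₂ (fun _ => 0) (fun ξ => p ξ τ)

/-- The expansion of the solution with force density `p` and vanishing initial data. -/
noncomputable def forced (c L h₁ h₂ : ℝ) (p : ℝ → ℝ → ℝ) (x t : ℝ) : ℂ :=
  duhamel (meanForcing c L h₁ h₂ p) (fun _ _ => 1) x t +
    ∑' r : ℤ, duhamel (forcing c L h₁ h₂ p r) (vibration c L h₁ h₂ r) x t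

lemma coeff_zero_right (g : ℝ → ℝ) (r : ℤ) :
    coeff c L h₁ h₂ g (fun _ => 0) r = ∫ ξ in 0..L, mode c L h₁ h₂ r ξ * g ξ := by
  simp [coeff]

lemma meanForcing_eq (p : ℝ → ℝ → ℝ) (τ : ℝ) : meanForcing c L h₁ h₂ p τ =
    ((1 / (c * (h₁ + h₂)) * ∫ ξ in 0..L, p ξ τ : ℝ) : ℂ) := by
  simp [meanForcing, equilibrium]

section Sections

variable {p : ℝ → ℝ → ℝ} {T : ℝ}
  (hp : MemLp (uncurry p) 2 (volume.restrict (Ioc 0 L ×ˢ Ioc 0 T)))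
include hp

lemma memLp_prod : MemLp (uncurry p) 2
    ((volume.restrict (Ioc 0 L)).prod (volume.restrict (Ioc 0 T))) := by
  rwa [Measure.prod_restrict, ← Measure.volume_eq_prod]

lemma ae_memLp_section : ∀ᵐ τ ∂volume.restrict (Ioc 0 T),
    MemLp (fun ξ => p ξ τ) 2 (volume.restrict (Ioc 0 L)) := by
  have h := memLp_prod hp
  filter_upwards [h.1.prodMk_right, h.integrable_sq.prod_left_ae] with τ h1 h2
  exact (memLp_two_iff_integrable_sq h1).2 h2

lemma integrable_sq_section (hL : 0 < L) :
    IntegrableOn (fun τ => ∫ ξ in 0..L, p ξ τ ^ 2) (Ioc 0 T) := by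
  simp only [intervalIntegral.integral_of_le hL.le]
  exact (memLp_prod hp).integrable_sq.integral_prod_right

lemma integrable_section_mul (hL : 0 < L) {F : ℝ → ℂ} (hF : Continuous F) :
    IntegrableOn (fun τ => ∫ ξ in 0..L, F ξ * p ξ τ) (Ioc 0 T) := by
  simp only [intervalIntegral.integral_of_le hL.le]
  have h1 := ((memLp_prod hp).integrable one_le_two).ofReal (𝕜 := ℂ)
  obtain ⟨C, hC⟩ := isCompact_Icc.exists_bound_of_continuousOn (s := Icc 0 L) hF.continuousOn
  have h2 := h1.bdd_mul (f := fun z : ℝ × ℝ => F z.1) (c := C)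
    (hF.comp continuous_fst).aestronglyMeasurable (by
      have : ∀ᵐ z ∂(volume.restrict (Ioc 0 L)).prod (volume.restrict (Ioc 0 T)), z.1 ∈ Ioc 0 L :=
        Measure.quasiMeasurePreserving_fst.ae (ae_restrict_mem measurableSet_Ioc)
      filter_upwards [this] with z hz using hC _ (Ioc_subset_Icc_self hz))
  exact h2.integral_prod_right

lemma integrable_forcing (hL : 0 < L) (r : ℤ) :
    IntegrableOn (forcing c L h₁ h₂ p r) (Ioc 0 T) := by
  have := (integrable_section_mul hp hL
    (continuous_mode (c := c) (L := L) (h₁ := h₁) (h₂ := h₂) r)).div_const ((1 - h₁ ^ 2) * L : ℂ)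
  refine this.congr (ae_of_all _ fun τ => ?_)
  simp only [forcing, coeff_zero_right]

lemma integrable_meanForcing (hL : 0 < L) :
    IntegrableOn (meanForcing c L h₁ h₂ p) (Ioc 0 T) := by
  have := (integrable_section_mul hp hL (F := fun _ => 1) continuous_const).const_mul
    ((1 / (c * (h₁ + h₂)) : ℝ) : ℂ)
  refine this.congr (ae_of_all _ fun τ => ?_)
  simp only [meanForcing_eq, one_mul, Complex.ofReal_mul, intervalIntegral.integral_ofReal]

end Sections

namespace Admissible

variable (H : Admissible c L h₁ h₂)
include H

/-- Bessel's inequality at almost every time, integrated over `(0, T]`, makes the forcing square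
summable over modes; Young's inequality then pairs it with `‖k_r‖⁻¹`. -/
lemma summable_integral_forcing {p : ℝ → ℝ → ℝ} {T : ℝ} (hT : 0 ≤ T)
    (hp : MemLp (uncurry p) 2 (volume.restrict (Ioc 0 L ×ˢ Ioc 0 T))) :
    Summable fun r => (∫ τ in Ioc 0 T, ‖forcing c L h₁ h₂ p r τ‖) * ‖freq c L h₁ h₂ r‖⁻¹ := by
  obtain ⟨K, hK, hb⟩ := H.exists_sum_norm_coeff_sq_le
  set N := ‖((1 - h₁ ^ 2) * L : ℂ)‖ with hN
  have hE := integrable_sq_section hp H.hL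
  have hbound : ∀ s : Finset ℤ, ∀ᵐ τ ∂volume.restrict (Ioc 0 T),
      ∑ r ∈ s, ‖forcing c L h₁ h₂ p r τ‖ ^ 2 ≤ N⁻¹ ^ 2 * K * ∫ ξ in 0..L, p ξ τ ^ 2 := fun s => by
    filter_upwards [ae_memLp_section hp] with τ hτ
    have := hb _ (fun _ => 0) hτ (memLp_const 0) s
    simp only [forcing, norm_div, div_pow, ← Finset.sum_div]
    simp only [ne_eq, OfNat.ofNat_ne_zero, not_false_eq_true, zero_pow, add_zero] at this
    rw [← hN, div_eq_inv_mul, ← inv_pow, mul_assoc]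
    gcongr
  have hi : ∀ r, IntegrableOn (fun τ => ‖forcing c L h₁ h₂ p r τ‖ ^ 2) (Ioc 0 T) := fun r => by
    refine (hE.const_mul (N⁻¹ ^ 2 * K)).mono'
      ((integrable_forcing hp H.hL r).aestronglyMeasurable.norm.pow 2) ?_
    filter_upwards [hbound {r}] with τ hτ
    rw [Real.norm_of_nonneg (sq_nonneg _)]
    simpa using hτ
  have hs : Summable fun r => ∫ τ in Ioc 0 T, ‖forcing c L h₁ h₂ p r τ‖ ^ 2 := by
    refine summable_of_sum_le (c := ∫ τ in Ioc 0 T, N⁻¹ ^ 2 * K * ∫ ξ in 0..L, p ξ τ ^ 2)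
      (fun r => integral_nonneg fun τ => sq_nonneg _) fun s => ?_
    rw [← integral_finsetSum _ fun r _ => hi r]
    exact integral_mono_ae (integrable_finsetSum _ fun r _ => hi r) (hE.const_mul _) (hbound s)
  refine Summable.of_nonneg_of_le (fun r => mul_nonneg (integral_nonneg fun τ => norm_nonneg _)
    (by positivity)) (fun r => ?_) (hs.add (H.summable_inv_norm_freq_sq.mul_left T))
  set k := ‖freq c L h₁ h₂ r‖⁻¹ with hk
  have i2 : IntegrableOn (fun _ : ℝ => k ^ 2) (Ioc 0 T) := integrableOn_const (by simp)
  calc _ = ∫ τ in Ioc 0 T, ‖forcing c L h₁ h₂ p r τ‖ * k := (integral_mul_const _ _).symm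
    _ ≤ ∫ τ in Ioc 0 T, (‖forcing c L h₁ h₂ p r τ‖ ^ 2 + k ^ 2) := by
      refine integral_mono ((integrable_forcing hp H.hL r).norm.mul_const k) ((hi r).add i2)
        fun τ => ?_
      nlinarith [sq_nonneg (‖forcing c L h₁ h₂ p r τ‖ - k),
        sq_nonneg ‖forcing c L h₁ h₂ p r τ‖, sq_nonneg k]
    _ = _ := by
      rw [integral_add (hi r) i2, setIntegral_const]
      simp [hk, hT]

section

variable {p : ℝ → ℝ → ℝ}
  (hp : ∀ T : ℝ, MemLp (uncurry p) 2 (volume.restrict (Ioc 0 L ×ˢ Ioc 0 T)))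
include hp

lemma exists_norm_duhamel_vibration_le {T : ℝ} (hT : 0 < T) :
    ∃ B : ℤ → ℝ, Summable B ∧ ∀ r, ∀ x ∈ Icc 0 L, ∀ t ∈ Icc 0 T,
      ‖duhamel (forcing c L h₁ h₂ p r) (vibration c L h₁ h₂ r) x t‖ ≤ B r := by
  obtain ⟨M, hM, hb⟩ := H.exists_norm_modal_le T
  refine ⟨_, (H.summable_integral_forcing hT.le (hp T)).mul_right M, fun r x hx t ht => ?_⟩
  have hi := integrable_forcing (c := c) (h₁ := h₁) (h₂ := h₂) (hp T) H.hL r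
  set k := ‖freq c L h₁ h₂ r‖⁻¹ with hk
  rw [duhamel, intervalIntegral.integral_of_le ht.1]
  calc _ ≤ ∫ τ in Ioc 0 t, ‖forcing c L h₁ h₂ p r τ‖ * (M * k) := by
        refine norm_integral_le_of_norm_le
          ((hi.mono_set (Ioc_subset_Ioc_right ht.2)).norm.mul_const _) ?_
        filter_upwards [ae_restrict_mem measurableSet_Ioc] with τ hτ
        rw [norm_mul]
        gcongr
        exact hb r x hx _ ⟨by linarith [hτ.2], by linarith [hτ.1, ht.2]⟩
    _ ≤ ∫ τ in Ioc 0 T, ‖forcing c L h₁ h₂ p r τ‖ * (M * k) :=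
        setIntegral_mono_set (hi.norm.mul_const _) (ae_of_all _ fun τ => by positivity)
          (Ioc_subset_Ioc_right ht.2).eventuallyLE
    _ = _ := by rw [integral_mul_const]; ring

lemma hasSum_duhamel_vibration {x t : ℝ} (hx : x ∈ Icc 0 L) (ht : 0 ≤ t) :
    HasSum (fun r => duhamel (forcing c L h₁ h₂ p r) (vibration c L h₁ h₂ r) x t)
      (∑' r, duhamel (forcing c L h₁ h₂ p r) (vibration c L h₁ h₂ r) x t) := by
  obtain ⟨B, hB, hb⟩ := H.exists_norm_duhamel_vibration_le hp (T := t + 1) (by linarith)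
  exact (Summable.of_norm_bounded hB fun r => hb r x hx t ⟨ht, by linarith⟩).hasSum

lemma continuousOn_duhamel_vibration (r : ℤ) : ContinuousOn
    (uncurry (duhamel (forcing c L h₁ h₂ p r) (vibration c L h₁ h₂ r))) (Icc 0 L ×ˢ Ici 0) :=
  continuousOn_duhamel (fun T => integrable_forcing (hp T) H.hL r)
    (m := fun x => mode c L h₁ h₂ r x / eigenvalue c L h₁ h₂ r)
    ((continuous_mode r).div_const _) (eigenvalue c L h₁ h₂ r)

lemma continuousOn_duhamel_meanForcing : ContinuousOn
    (uncurry (duhamel (meanForcing c L h₁ h₂ p) fun _ _ => 1)) (Icc 0 L ×ˢ Ici 0) := by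
  simpa using continuousOn_duhamel (L := L) (a := meanForcing c L h₁ h₂ p)
    (fun T => integrable_meanForcing (hp T) H.hL) (m := fun _ => 1) continuous_const 0

lemma continuousOn_tsum_duhamel : ContinuousOn (uncurry fun x t =>
    ∑' r, duhamel (forcing c L h₁ h₂ p r) (vibration c L h₁ h₂ r) x t) (Icc 0 L ×ˢ Ici 0) :=
  continuousOn_of_hasSum (H.continuousOn_duhamel_vibration hp)
    (fun _ hT => H.exists_norm_duhamel_vibration_le hp hT)
    fun _ hx _ ht => H.hasSum_duhamel_vibration hp hx ht

lemma continuousOn_forced : ContinuousOn (uncurry (forced c L h₁ h₂ p)) (Icc 0 L ×ˢ Ici 0) :=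
  (H.continuousOn_duhamel_meanForcing hp).add (H.continuousOn_tsum_duhamel hp)

omit H hp in
lemma forced_zero (x : ℝ) : forced c L h₁ h₂ p x 0 = 0 := by
  simp [forced, duhamel]

omit H in
lemma ae_memLp_section_Ioi : ∀ᵐ τ ∂volume.restrict (Ioi 0),
    MemLp (fun ξ => p ξ τ) 2 (volume.restrict (Ioc 0 L)) := by
  have : Ioi (0 : ℝ) = ⋃ n : ℕ, Ioc 0 (n : ℝ) := by
    ext t
    simp only [mem_Ioi, mem_iUnion, mem_Ioc]
    exact ⟨fun h => (exists_nat_ge t).imp fun n hn => ⟨h, hn⟩, fun ⟨_, h, _⟩ => h⟩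
  rw [this, ae_restrict_iUnion_iff]
  exact fun n => ae_memLp_section (hp n)

/-- Duhamel's principle in weak form: after sum and integral are interchanged, the integrand at
almost every `τ` is the initial term of a free vibration with zero displacement and velocity `p(·,
τ)`, that is `∫ p φ dx` at time `τ`. -/
lemma weakOp_forced {φ : ℝ → ℝ → ℝ} (hφ : IsTest φ) :
    weakOp c L h₁ h₂ φ (forced c L h₁ h₂ p) =
      ((∫ t in Ioi (0 : ℝ), ∫ x in (0 : ℝ)..L, p x t * φ x t : ℝ) : ℂ) := by
  have hL := H.hL
  obtain ⟨T, hT, W, hW, hb⟩ := exists_norm_weakOp_shift_le hL hφ c h₁ h₂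
  obtain ⟨M, hM, hM'⟩ := H.exists_norm_modal_le T
  obtain ⟨i0, e0⟩ := weakOp_duhamel (c := c) (h₁ := h₁) (h₂ := h₂) hL hφ
    (fun T => integrable_meanForcing (c := c) (h₁ := h₁) (h₂ := h₂) (hp T) hL)
    (e := fun _ _ => 1) continuous_const
  have hD := fun r => weakOp_duhamel (c := c) (h₁ := h₁) (h₂ := h₂) hL hφ
    (fun T => integrable_forcing (c := c) (h₁ := h₁) (h₂ := h₂) (hp T) hL r)
    (continuous_vibration (c := c) (L := L) (h₁ := h₁) (h₂ := h₂) r)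
  set F : ℤ → ℝ → ℂ := fun r τ => forcing c L h₁ h₂ p r τ *
    weakOp c L h₁ h₂ (fun x t => φ x (t + τ)) (vibration c L h₁ h₂ r) with hF
  have hFb : ∀ r, ∀ τ ∈ Ioi (0 : ℝ), ‖F r τ‖ ≤ (Ioc 0 T).indicator
      (fun τ => ‖forcing c L h₁ h₂ p r τ‖ * (W * (M * ‖freq c L h₁ h₂ r‖⁻¹))) τ := by
    intro r τ hτ
    have := hb τ hτ (vibration c L h₁ h₂ r) (M * ‖freq c L h₁ h₂ r‖⁻¹) (hM' r)
    by_cases h : τ ∈ Ioc 0 T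
    · rw [indicator_of_mem h] at this ⊢
      rw [hF]
      simp only [norm_mul]
      gcongr
    · rw [indicator_of_notMem h] at this ⊢
      simp [hF, norm_le_zero_iff.1 this]
  -- Summability of the `L¹` norms, which allows the sum over the modes to be taken under the
  -- integral.
  have hFs : Summable fun r => ∫ τ in Ioi (0 : ℝ), ‖F r τ‖ := by
    refine Summable.of_nonneg_of_le (fun r => integral_nonneg fun τ => norm_nonneg _)
      (fun r => ?_) ((H.summable_integral_forcing hT.le (hp T)).mul_right (W * M))
    have hi := (integrable_forcing (c := c) (h₁ := h₁) (h₂ := h₂) (hp T) hL r).norm.mul_const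
      (W * (M * ‖freq c L h₁ h₂ r‖⁻¹))
    calc _ ≤ ∫ τ in Ioi (0 : ℝ), (Ioc 0 T).indicator (fun τ => ‖forcing c L h₁ h₂ p r τ‖ *
          (W * (M * ‖freq c L h₁ h₂ r‖⁻¹))) τ := by
          refine setIntegral_mono_on (hD r).1.norm ?_ measurableSet_Ioi (hFb r)
          exact (IntegrableOn.integrable_indicator hi measurableSet_Ioc).integrableOn
      _ = _ := by
          rw [setIntegral_indicator measurableSet_Ioc,
            inter_eq_self_of_subset_right Ioc_subset_Ioi_self, integral_mul_const]
          ring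
  have h1 := hasSum_weakOp (c := c) (h₁ := h₁) (h₂ := h₂) hL hφ
    (H.continuousOn_duhamel_vibration hp)
    (fun _ hT => H.exists_norm_duhamel_vibration_le hp hT)
    fun _ hx _ ht => H.hasSum_duhamel_vibration hp hx ht
  simp only [(hD _).2] at h1
  have h2 := hasSum_integral_of_summable_integral_norm (fun r => (hD r).1) hFs
  have hFi := integrable_tsum_of_summable_integral_norm (fun r => (hD r).1) hFs
  have h3 := weakOp_add (c := c) (h₁ := h₁) (h₂ := h₂) hL hφ
    (H.continuousOn_duhamel_meanForcing hp) (H.continuousOn_tsum_duhamel hp)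
  rw [e0, h1.unique h2, ← integral_add i0 hFi] at h3
  refine h3.trans ?_
  rw [show (((∫ t in Ioi (0 : ℝ), ∫ x in (0 : ℝ)..L, p x t * φ x t : ℝ)) : ℂ) =
    ∫ t in Ioi (0 : ℝ), ((∫ x in (0 : ℝ)..L, p x t * φ x t : ℝ) : ℂ) from integral_ofReal.symm]
  refine integral_congr_ae ?_
  filter_upwards [ae_memLp_section_Ioi hp] with τ hτ
  -- With zero displacement the corner terms vanish, and the shifted test function at time `0` is
  -- `φ(·, τ)`.
  have h4 := H.hasSum_weakOp_free hτ (d := fun _ => 0) (memLp_const 0) (hφ.shift τ)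
    (f := fun _ => 0) (by simp)
  rw [show (∑' r, F r τ) = _ from h4.tsum_eq]
  simp only [meanForcing, add_sub_cancel]
  simp only [initialOp, zero_add, Complex.ofReal_zero, smul_zero, sub_zero, add_zero]
  rw [← intervalIntegral.integral_ofReal]
  refine intervalIntegral.integral_congr fun x _ => ?_
  simp [mul_comm]

end

end Admissible

end ViscousBar

/-! ### Existence and the representation formula. -/

namespace ViscousBar

open Filter Topology

variable {c L h₁ h₂ : ℝ}

lemma integral_deriv_mul_absolutelyContinuous {a b : ℝ} {f G G' : ℝ → ℝ}
    (hf : AbsolutelyContinuousOnInterval f a b) (hG : ∀ x, HasDerivAt G (G' x) x)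
    (hG' : Continuous G') :
    ∫ x in a..b, G' x * f x = G b * f b - G a * f a - ∫ x in a..b, G x * deriv f x := by
  have e : deriv G = G' := funext fun x => (hG x).deriv
  have h1 : ContDiff ℝ 1 G := contDiff_one_iff_deriv.2
    ⟨fun x => (hG x).differentiableAt, by rwa [e]⟩
  have := h1.contDiffOn.absolutelyContinuousOnInterval.integral_mul_deriv_eq_deriv_mul hf
  rw [e] at this
  linarith

lemma integral_deriv_mul_absolutelyContinuous_complex {a b : ℝ} {f : ℝ → ℝ} {F F' : ℝ → ℂ}
    (hf : AbsolutelyContinuousOnInterval f a b) (hF : ∀ x, HasDerivAt F (F' x) x)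
    (hF' : Continuous F') :
    ∫ x in a..b, F' x * f x = F b * f b - F a * f a - ∫ x in a..b, F x * deriv f x := by
  have cF : Continuous F := continuous_iff_continuousAt.2 fun x => (hF x).continuousAt
  have cf : ContinuousOn (fun x => (f x : ℂ)) (uIcc a b) :=
    Complex.continuous_ofReal.comp_continuousOn hf.continuousOn
  have i1 : IntervalIntegrable (fun x => F' x * (f x : ℂ)) volume a b :=
    (hF'.continuousOn.mul cf).intervalIntegrable
  have id' : IntervalIntegrable (fun x => ((deriv f x : ℝ) : ℂ)) volume a b :=
    ⟨hf.intervalIntegrable_deriv.1.ofReal, hf.intervalIntegrable_deriv.2.ofReal⟩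
  have i2 : IntervalIntegrable (fun x => F x * ((deriv f x : ℝ) : ℂ)) volume a b :=
    id'.continuousOn_mul cF.continuousOn
  apply Complex.ext
  · have h := integral_deriv_mul_absolutelyContinuous hf (G := fun x => (F x).re)
      (G' := fun x => (F' x).re) (fun x => Complex.reCLM.hasFDerivAt.comp_hasDerivAt x (hF x))
      (Complex.continuous_re.comp hF')
    have e1 := Complex.reCLM.intervalIntegral_comp_comm i1
    have e2 := Complex.reCLM.intervalIntegral_comp_comm i2
    simp only [Complex.reCLM_apply, Complex.re_mul_ofReal] at e1 e2
    simp only [Complex.sub_re, Complex.re_mul_ofReal]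
    rw [← e1, ← e2, h]
  · have h := integral_deriv_mul_absolutelyContinuous hf (G := fun x => (F x).im)
      (G' := fun x => (F' x).im) (fun x => Complex.imCLM.hasFDerivAt.comp_hasDerivAt x (hF x))
      (Complex.continuous_im.comp hF')
    have e1 := Complex.imCLM.intervalIntegral_comp_comm i1
    have e2 := Complex.imCLM.intervalIntegral_comp_comm i2
    simp only [Complex.imCLM_apply, Complex.im_mul_ofReal] at e1 e2
    simp only [Complex.sub_im, Complex.im_mul_ofReal]
    rw [← e1, ← e2, h]

/-- Used with real and imaginary parts, to pass between the complex expansion and real weak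
solutions. -/
lemma weakOp_comp_clm (hL : 0 < L) {φ : ℝ → ℝ → ℝ} (hφ : IsTest φ) (ℓ : ℂ →L[ℝ] ℝ) {u : ℝ → ℝ → ℂ}
    (hu : ContinuousOn (uncurry u) (Icc 0 L ×ˢ Ici 0)) :
    weakOp c L h₁ h₂ φ (fun x t => ℓ (u x t)) = ℓ (weakOp c L h₁ h₂ φ u) := by
  have h0 := dirac_compl (L := L) ⟨le_rfl, hL.le⟩
  have h1 := dirac_compl (L := L) ⟨hL.le, le_rfl⟩
  have key : ∀ {μ : Measure ℝ} [IsFiniteMeasure μ], μ (Icc 0 L)ᶜ = 0 → ∀ {Φ}, IsKernel Φ →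
      pairing μ Φ (fun x t => ℓ (u x t)) = ℓ (pairing μ Φ u) := fun {μ} _ hμ {Φ} hΦ => by
    simp only [pairing, ← map_smul]
    exact ℓ.integral_comp_comm (integrable_pairing hμ hΦ hu)
  simp only [weakOp, map_add, map_sub, map_smul, key (volume_restrict_compl L) (hφ.wave c),
    key h0 hφ.dt.isKernel, key h1 hφ.dt.isKernel, key h0 hφ.dx.isKernel, key h1 hφ.dx.isKernel]

namespace Admissible

variable (H : Admissible c L h₁ h₂)
include H

lemma eq_zero_of_weakOp_eq_zero_complex {d : ℝ → ℝ → ℂ}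
    (hd : ContinuousOn (uncurry d) (Icc 0 L ×ˢ Ici 0))
    (hw : ∀ φ, IsTest φ → weakOp c L h₁ h₂ φ d = 0) (hi : ∀ x ∈ Icc 0 L, d x 0 = 0) :
    ∀ x ∈ Icc 0 L, ∀ t ∈ Ici (0 : ℝ), d x t = 0 := by
  have key : ∀ ℓ : ℂ →L[ℝ] ℝ, ∀ x ∈ Icc 0 L, ∀ t ∈ Ici (0 : ℝ), ℓ (d x t) = 0 := fun ℓ =>
    H.eq_zero_of_weakOp_eq_zero (d := fun x t => ℓ (d x t)) (ℓ.continuous.comp_continuousOn hd)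
      (fun φ hφ => by rw [weakOp_comp_clm H.hL hφ ℓ hd, hw φ hφ, map_zero])
      fun x hx => by rw [hi x hx, map_zero]
  intro x hx t ht
  exact Complex.ext (key Complex.reCLM x hx t ht) (key Complex.imCLM x hx t ht)

/-- The product of two modes with the time factor is a combination of the four exponentials `exp
(k_r (c t ± x ± y))`, so symmetric convergence follows from the scalar series. -/
lemma hasSum_mode_mul_vibration (y x t : ℝ) : ∃ S, HasSum (fun r : ℤ => mode c L h₁ h₂ r y *
    mode c L h₁ h₂ r x / eigenvalue c L h₁ h₂ r * Complex.exp (eigenvalue c L h₁ h₂ r * t)) S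
    (SummationFilter.symmetricIcc ℤ) := by
  obtain ⟨S₁, s1⟩ := H.hasSum_exp_div_freq (c * t + x + y)
  obtain ⟨S₂, s2⟩ := H.hasSum_exp_div_freq (c * t + x - y)
  obtain ⟨S₃, s3⟩ := H.hasSum_exp_div_freq (c * t - x + y)
  obtain ⟨S₄, s4⟩ := H.hasSum_exp_div_freq (c * t - x - y)
  have h := (((s1.mul_left ((1 + h₁ : ℂ) ^ 2)).add (s2.mul_left ((1 + h₁ : ℂ) * (1 - h₁)))).add
    ((s3.mul_left ((1 - h₁ : ℂ) * (1 + h₁))).add (s4.mul_left ((1 - h₁ : ℂ) ^ 2)))).mul_left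
      ((4 * c : ℂ)⁻¹)
  refine ⟨_, h.congr_fun fun r => ?_⟩
  have hc := H.ofReal_c_ne
  have hk := H.freq_ne_zero r
  rw [mode_eq, mode_eq, H.eigenvalue_eq]
  push_cast
  simp only [mul_add, sub_eq_add_neg, mul_neg, Complex.exp_add, mul_assoc]
  rw [mul_left_comm (freq c L h₁ h₂ r) (c : ℂ)]
  field_simp
  ring

section Representation

variable {f g : ℝ → ℝ} {p : ℝ → ℝ → ℝ} (hf : AbsolutelyContinuousOnInterval f 0 L)
  (hf' : MemLp (deriv f) 2 (volume.restrict (Ioc 0 L)))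
  (hg : MemLp g 2 (volume.restrict (Ioc 0 L)))
  (hp : ∀ T : ℝ, MemLp (uncurry p) 2 (volume.restrict (Ioc 0 L ×ˢ Ioc 0 T)))

include hf in
lemma eq_add_integral_deriv : ∀ x ∈ Icc 0 L, f x = f 0 + ∫ y in 0..x, deriv f y := by
  intro x hx
  have : AbsolutelyContinuousOnInterval f 0 x := hf.mono (by
    rw [uIcc_of_le hx.1, uIcc_of_le H.hL.le]; exact Icc_subset_Icc_right hx.2)
  rw [this.integral_deriv_eq_sub]
  ring

include hf' hg hp in
lemma continuousOn_expansion : ContinuousOn (uncurry fun x t =>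
    free c L h₁ h₂ f g (deriv f) x t + forced c L h₁ h₂ p x t) (Icc 0 L ×ˢ Ici 0) :=
  (H.continuousOn_free hg hf' f).add (H.continuousOn_forced hp)

include hf hf' hg in
lemma expansion_zero {x : ℝ} (hx : x ∈ Icc 0 L) :
    free c L h₁ h₂ f g (deriv f) x 0 + forced c L h₁ h₂ p x 0 = f x := by
  rw [H.free_zero hg hf' (H.eq_add_integral_deriv hf) hx, forced_zero, add_zero]

include hf hf' hg hp

lemma weakOp_expansion {φ : ℝ → ℝ → ℝ} (hφ : IsTest φ) :
    weakOp c L h₁ h₂ φ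
      (fun x t => free c L h₁ h₂ f g (deriv f) x t + forced c L h₁ h₂ p x t) =
    (((∫ t in Ioi (0 : ℝ), ∫ x in (0 : ℝ)..L, p x t * φ x t) +
      initialOp c L h₁ h₂ φ f g : ℝ) : ℂ) := by
  rw [weakOp_add H.hL hφ (H.continuousOn_free hg hf' f) (H.continuousOn_forced hp),
    H.weakOp_free hg hf' hφ (H.eq_add_integral_deriv hf), H.weakOp_forced hp hφ, initialOp_ofReal,
    Complex.ofReal_add, add_comm]

/-- The real part of the expansion is a weak solution. -/
theorem exists_isWeakSolution : ∃ u, IsWeakSolution c L h₁ h₂ f g p u := by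
  have hV := H.continuousOn_expansion hf' hg hp
  refine ⟨fun x t => Complex.reCLM (free c L h₁ h₂ f g (deriv f) x t + forced c L h₁ h₂ p x t),
    (isWeakSolution_iff H.hL).2 ⟨Complex.continuous_re.comp_continuousOn hV, fun x hx => ?_,
      fun φ hφ => ?_⟩⟩
  · rw [H.expansion_zero hf hf' hg hx]; rfl
  · rw [weakOp_comp_clm H.hL hφ _ hV, H.weakOp_expansion hf hf' hg hp hφ]; rfl

/-- Every weak solution is given by the expansion. -/
theorem eq_expansion {u : ℝ → ℝ → ℝ} (hu : IsWeakSolution c L h₁ h₂ f g p u) {x t : ℝ}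
    (hx : x ∈ Icc 0 L) (ht : t ∈ Ici (0 : ℝ)) :
    (u x t : ℂ) = free c L h₁ h₂ f g (deriv f) x t + forced c L h₁ h₂ p x t := by
  obtain ⟨h1, h2, h3⟩ := (isWeakSolution_iff H.hL).1 hu
  have hV := H.continuousOn_expansion hf' hg hp
  have hU : ContinuousOn (uncurry fun x t => (u x t : ℂ)) (Icc 0 L ×ˢ Ici 0) :=
    Complex.continuous_ofReal.comp_continuousOn h1
  refine sub_eq_zero.1 (H.eq_zero_of_weakOp_eq_zero_complex (d := fun x t => (u x t : ℂ) -
    (free c L h₁ h₂ f g (deriv f) x t + forced c L h₁ h₂ p x t)) (hU.sub hV)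
    (fun φ hφ => ?_) (fun x hx => ?_) x hx t ht)
  · rw [weakOp_sub H.hL hφ hU hV, weakOp_ofReal, h3 φ hφ, H.weakOp_expansion hf hf' hg hp hφ,
      sub_self]
  · rw [h2 x hx, H.expansion_zero hf hf' hg hx, sub_self]

-- `λ · mode` is `c` times the derivative of the dual mode. Integration by parts moves the
-- derivative to `f`, and the endpoint values `-h₂ mode(L)` and `h₁` of the dual mode give the
-- boundary terms.
omit hf' hp in
lemma integral_mode_mul (r : ℤ) :
    ∫ ξ in (0 : ℝ)..L, mode c L h₁ h₂ r ξ * (eigenvalue c L h₁ h₂ r * (f ξ : ℂ) + (g ξ : ℂ)) =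
    coeff c L h₁ h₂ g (deriv f) r - c * h₂ * f L * mode c L h₁ h₂ r L -
      c * h₁ * f 0 * mode c L h₁ h₂ r 0 := by
  have cm := continuous_mode (c := c) (L := L) (h₁ := h₁) (h₂ := h₂) r
  have cw := continuous_dualMode (c := c) (L := L) (h₁ := h₁) (h₂ := h₂) r
  have key := integral_deriv_mul_absolutelyContinuous_complex hf
    (hasDerivAt_dualMode (c := c) (L := L) (h₁ := h₁) (h₂ := h₂) r)
    (continuous_const.mul cm)
  have hgi : IntervalIntegrable (fun x => (g x : ℂ)) volume 0 L :=
    ⟨(hg.intervalIntegrable H.hL.le).1.ofReal, (hg.intervalIntegrable H.hL.le).2.ofReal⟩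
  have i1 : IntervalIntegrable (fun x => mode c L h₁ h₂ r x * (g x : ℂ)) volume 0 L :=
    hgi.continuousOn_mul cm.continuousOn
  have i2 : IntervalIntegrable (fun x => c * (freq c L h₁ h₂ r * mode c L h₁ h₂ r x * (f x : ℂ)))
      volume 0 L :=
    (continuousOn_const.mul ((continuous_const.mul cm).continuousOn.mul
      (Complex.continuous_ofReal.comp_continuousOn hf.continuousOn))).intervalIntegrable
  have id' : IntervalIntegrable (fun x => ((deriv f x : ℝ) : ℂ)) volume 0 L :=
    ⟨hf.intervalIntegrable_deriv.1.ofReal, hf.intervalIntegrable_deriv.2.ofReal⟩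
  have i3 : IntervalIntegrable (fun x => c * (dualMode c L h₁ h₂ r x * ((deriv f x : ℝ) : ℂ)))
      volume 0 L :=
    (id'.continuousOn_mul cw.continuousOn).const_mul _
  have e : ∀ ξ, mode c L h₁ h₂ r ξ * (eigenvalue c L h₁ h₂ r * (f ξ : ℂ) + (g ξ : ℂ)) =
      c * (freq c L h₁ h₂ r * mode c L h₁ h₂ r ξ * f ξ) + mode c L h₁ h₂ r ξ * g ξ := fun ξ => by
    rw [H.eigenvalue_eq]; ring
  simp only [e]
  rw [intervalIntegral.integral_add i2 i1, intervalIntegral.integral_const_mul, key, coeff,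
    intervalIntegral.integral_sub i1 i3, intervalIntegral.integral_const_mul, H.dualMode_L,
    dualMode_zero, mode_zero]
  ring

/-- The coefficient series converges absolutely; splitting it by `integral_mode_mul` costs this,
since the endpoint series converge only symmetrically. In the final formula the endpoint series
cancel again. -/
theorem exists_hasSum {u : ℝ → ℝ → ℝ} (hu : IsWeakSolution c L h₁ h₂ f g p u) {x t : ℝ}
    (hx : x ∈ Icc 0 L) (ht : t ∈ Ici (0 : ℝ)) : ∃ S₁ S₂ S₃ S₄ : ℂ,
      HasSum (fun r : ℤ => mode c L h₁ h₂ r L * mode c L h₁ h₂ r x / eigenvalue c L h₁ h₂ r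
        * Complex.exp (eigenvalue c L h₁ h₂ r * t)) S₁ (SummationFilter.symmetricIcc ℤ) ∧
      HasSum (fun r : ℤ => mode c L h₁ h₂ r 0 * mode c L h₁ h₂ r x / eigenvalue c L h₁ h₂ r
        * Complex.exp (eigenvalue c L h₁ h₂ r * t)) S₂ (SummationFilter.symmetricIcc ℤ) ∧
      HasSum (fun r : ℤ => mode c L h₁ h₂ r x / eigenvalue c L h₁ h₂ r
        * Complex.exp (eigenvalue c L h₁ h₂ r * t) * ∫ ξ in (0 : ℝ)..L, mode c L h₁ h₂ r ξ
          * (eigenvalue c L h₁ h₂ r * (f ξ : ℂ) + (g ξ : ℂ))) S₃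
        (SummationFilter.symmetricIcc ℤ) ∧
      HasSum (fun r : ℤ => mode c L h₁ h₂ r x / eigenvalue c L h₁ h₂ r * ∫ τ in (0 : ℝ)..t,
        Complex.exp (eigenvalue c L h₁ h₂ r * ((t : ℂ) - (τ : ℂ))) *
          ∫ ξ in (0 : ℝ)..L, (p ξ τ : ℂ) * mode c L h₁ h₂ r ξ) S₄
        (SummationFilter.symmetricIcc ℤ) ∧
      (u x t : ℂ) =
        (((1 / (c * (h₁ + h₂))
          * ((∫ ξ in (0 : ℝ)..L, g ξ) + c * f L * h₂ + c * f 0 * h₁) : ℝ)) : ℂ)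
        + ((c * f L * h₂ / ((1 - h₁ ^ 2) * L) : ℝ) : ℂ) * S₁
        + ((c * f 0 * h₁ / ((1 - h₁ ^ 2) * L) : ℝ) : ℂ) * S₂
        + ((1 / ((1 - h₁ ^ 2) * L) : ℝ) : ℂ) * S₃
        + ((1 / (c * (h₁ + h₂)) * ∫ τ in (0 : ℝ)..t, ∫ ξ in (0 : ℝ)..L, p ξ τ : ℝ) : ℂ)
        + ((1 / ((1 - h₁ ^ 2) * L) : ℝ) : ℂ) * S₄ := by
  have hn := H.norm_ne_zero
  obtain ⟨S₁, s1⟩ := H.hasSum_mode_mul_vibration L x t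
  obtain ⟨S₂, s2⟩ := H.hasSum_mode_mul_vibration 0 x t
  have s3 := (((H.hasSum_vibration hg hf' x t).symmetricIcc.mul_left ((1 - h₁ ^ 2) * L : ℂ)).sub
    (s1.mul_left (c * h₂ * f L : ℂ))).sub (s2.mul_left (c * h₁ * f 0 : ℂ))
  have s4 := (H.hasSum_duhamel_vibration hp hx ht).symmetricIcc.mul_left ((1 - h₁ ^ 2) * L : ℂ)
  set A := ∑' r, coeff c L h₁ h₂ g (deriv f) r / ((1 - h₁ ^ 2) * L : ℂ) *
    vibration c L h₁ h₂ r x t with hA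
  set B := ∑' r, duhamel (forcing c L h₁ h₂ p r) (vibration c L h₁ h₂ r) x t with hB
  -- The third sum is the full coefficient series minus the two endpoint series; the fourth is the
  -- rescaled sum of the Duhamel terms.
  refine ⟨S₁, S₂, (1 - h₁ ^ 2) * L * A - c * h₂ * f L * S₁ - c * h₁ * f 0 * S₂,
    (1 - h₁ ^ 2) * L * B, s1, s2, ?_, ?_, ?_⟩
  rotate_left 2
  · rw [H.eq_expansion hf hf' hg hp hu hx ht, free, forced, equilibrium, ← hA, ← hB]
    have : duhamel (meanForcing c L h₁ h₂ p) (fun _ _ => 1) x t =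
        ((1 / (c * (h₁ + h₂)) * ∫ τ in (0 : ℝ)..t, ∫ ξ in (0 : ℝ)..L, p ξ τ : ℝ) : ℂ) := by
      simp only [duhamel, meanForcing_eq, mul_one]
      rw [intervalIntegral.integral_ofReal, intervalIntegral.integral_const_mul]
    rw [this]
    rw [show ((c * f L * h₂ / ((1 - h₁ ^ 2) * L) : ℝ) : ℂ) =
      c * f L * h₂ / ((1 - h₁ ^ 2) * L : ℂ) by push_cast; rfl,
      show ((c * f 0 * h₁ / ((1 - h₁ ^ 2) * L) : ℝ) : ℂ) =
      c * f 0 * h₁ / ((1 - h₁ ^ 2) * L : ℂ) by push_cast; rfl,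
      show ((1 / ((1 - h₁ ^ 2) * L) : ℝ) : ℂ) = 1 / ((1 - h₁ ^ 2) * L : ℂ) by push_cast; rfl]
    clear_value A B
    generalize ((1 - h₁ ^ 2) * L : ℂ) = N at hn ⊢
    field_simp
    ring
  · convert! s3 using 1
    ext r
    rw [H.integral_mode_mul hf hg, vibration]
    generalize ((1 - h₁ ^ 2) * L : ℂ) = N at hn ⊢
    field_simp
  · convert! s4 using 1
    ext r
    rw [duhamel, ← intervalIntegral.integral_const_mul, ← intervalIntegral.integral_const_mul]
    refine intervalIntegral.integral_congr fun τ _ => ?_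
    simp only [forcing, vibration, coeff_zero_right, Complex.ofReal_sub]
    rw [show (∫ ξ in (0 : ℝ)..L, (p ξ τ : ℂ) * mode c L h₁ h₂ r ξ) =
      ∫ ξ in (0 : ℝ)..L, mode c L h₁ h₂ r ξ * (p ξ τ : ℂ) by simp only [mul_comm]]
    generalize ((1 - h₁ ^ 2) * L : ℂ) = N at hn ⊢
    field_simp

end Representation

end Admissible

end ViscousBar

theorem mainTheorem1 (c L h₁ h₂ : ℝ) (hc : 0 < c) (hL : 0 < L)
    (hsum : h₁ + h₂ ≠ 0) (h₁_ne_one : h₁ ≠ 1) (h₁_ne_neg_one : h₁ ≠ -1)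
    (h₂_ne_one : h₂ ≠ 1) (h₂_ne_neg_one : h₂ ≠ -1)
    (f g : ℝ → ℝ) (p : ℝ → ℝ → ℝ)
    (hf : AbsolutelyContinuousOnInterval f 0 L)
    (hf' : MemLp (deriv f) 2 (volume.restrict (Ioc 0 L)))
    (hg : MemLp g 2 (volume.restrict (Ioc 0 L)))
    (hp : ∀ T : ℝ, MemLp (uncurry p) 2 (volume.restrict (Ioc 0 L ×ˢ Ioc 0 T))) :
    (∃ u : ℝ → ℝ → ℝ, ViscousBar.IsWeakSolution c L h₁ h₂ f g p u) ∧
    (∀ u : ℝ → ℝ → ℝ, ViscousBar.IsClassicalSolution c L h₁ h₂ f g p u →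
      ViscousBar.IsWeakSolution c L h₁ h₂ f g p u) ∧
    (∀ u : ℝ → ℝ → ℝ, ViscousBar.IsWeakSolution c L h₁ h₂ f g p u →
      ∀ x ∈ Icc 0 L, ∀ t ∈ Ici (0 : ℝ), ∃ S₁ S₂ S₃ S₄ : ℂ,
        HasSum (fun r : ℤ =>
          ViscousBar.mode c L h₁ h₂ r L * ViscousBar.mode c L h₁ h₂ r x
            / ViscousBar.eigenvalue c L h₁ h₂ r
            * Complex.exp (ViscousBar.eigenvalue c L h₁ h₂ r * t))
          S₁ (SummationFilter.symmetricIcc ℤ) ∧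
        HasSum (fun r : ℤ =>
          ViscousBar.mode c L h₁ h₂ r 0 * ViscousBar.mode c L h₁ h₂ r x
            / ViscousBar.eigenvalue c L h₁ h₂ r
            * Complex.exp (ViscousBar.eigenvalue c L h₁ h₂ r * t))
          S₂ (SummationFilter.symmetricIcc ℤ) ∧
        HasSum (fun r : ℤ =>
          ViscousBar.mode c L h₁ h₂ r x / ViscousBar.eigenvalue c L h₁ h₂ r
            * Complex.exp (ViscousBar.eigenvalue c L h₁ h₂ r * t)
            * ∫ ξ in (0 : ℝ)..L, ViscousBar.mode c L h₁ h₂ r ξ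
                * (ViscousBar.eigenvalue c L h₁ h₂ r * (f ξ : ℂ) + (g ξ : ℂ)))
          S₃ (SummationFilter.symmetricIcc ℤ) ∧
        HasSum (fun r : ℤ =>
          ViscousBar.mode c L h₁ h₂ r x / ViscousBar.eigenvalue c L h₁ h₂ r
            * ∫ τ in (0 : ℝ)..t,
                Complex.exp (ViscousBar.eigenvalue c L h₁ h₂ r * ((t : ℂ) - (τ : ℂ)))
                  * ∫ ξ in (0 : ℝ)..L, (p ξ τ : ℂ) * ViscousBar.mode c L h₁ h₂ r ξ)
          S₄ (SummationFilter.symmetricIcc ℤ) ∧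
        (u x t : ℂ) =
          (((1 / (c * (h₁ + h₂))
            * ((∫ ξ in (0 : ℝ)..L, g ξ) + c * f L * h₂ + c * f 0 * h₁) : ℝ)) : ℂ)
          + ((c * f L * h₂ / ((1 - h₁ ^ 2) * L) : ℝ) : ℂ) * S₁
          + ((c * f 0 * h₁ / ((1 - h₁ ^ 2) * L) : ℝ) : ℂ) * S₂
          + ((1 / ((1 - h₁ ^ 2) * L) : ℝ) : ℂ) * S₃
          + ((1 / (c * (h₁ + h₂)) * ∫ τ in (0 : ℝ)..t, ∫ ξ in (0 : ℝ)..L, p ξ τ : ℝ) : ℂ)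
          + ((1 / ((1 - h₁ ^ 2) * L) : ℝ) : ℂ) * S₄) := by
  have H : ViscousBar.Admissible c L h₁ h₂ :=
    ⟨hc, hL, hsum, h₁_ne_one, h₁_ne_neg_one, h₂_ne_one, h₂_ne_neg_one⟩
  exact ⟨H.exists_isWeakSolution hf hf' hg hp, fun u hu => hu.isWeakSolution hc hL,
    fun u hu x hx t ht => H.exists_hasSum hf hf' hg hp hu hx ht⟩
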